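/- Let $k$ be a field, let $A$ be a finite dimensional associative unital $k$-algebra and let $B \subseteq A$ be a unital subalgebra. Modules are left modules unless stated otherwise, and $A/B$ is regarded as a $B$-bimodule, i.e. as a module over $B^e = B \otimes_k B^{op}$. Assume that 1. $\mathrm{pd}_{B^e}(A/B) < \infty$; 2. $(A/B)^{\otimes_B p} = 0$ for some integer $p \ge 0$; 3. $\mathrm{Tor}_i^B(A/B, (A/B)^{\otimes_B j}) = 0$ for all $i, j \geq 1$; 4. the extension $B \subseteq A$ is split, i.e. there is a homomorphism of $k$-algebras $\pi : A \to B$ with $\pi|_B = \mathrm{id}_B$. For $R \in \{A, B\}$ let $D_{sg}(R) = D^b(\mathrm{mod}\, R)/K^b(\mathrm{proj}\, R)$ be the singularity category of $R$. Let $\underline{\mathrm{Gproj}}\, R$ be the stable category of finitely generated Gorenstein projective $R$-modules: a module is Gorenstein projective if it is isomorphic to $\mathrm{Ker}\, d^0$ for an exact complex $P^\bullet$ of finitely generated projective modules such that $\mathrm{Hom}_R(P^\bullet, Q)$ is exact for every finitely generated projective $Q$, and maps whose difference factors through a finitely generated projective module are identified. Let $F_R : \underline{\mathrm{Gproj}}\,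 R \to D_{sg}(R)$ be the canonical functor, which sends a module to its stalk complex in degree zero, and let $D_{def}(R) = D_{sg}(R)/\mathrm{Im}\, F_R$ be the Gorenstein defect category of $R$ (a Verdier quotient). Then restriction of scalars $D^b(\mathrm{mod}\, A) \to D^b(\mathrm{mod}\, B)$ induces a triangle equivalence $G : D_{sg}(A) \to D_{sg}(B)$. It restricts to an equivalence of the stable categories of Gorenstein projective modules: there is an equivalence $E : \underline{\mathrm{Gproj}}\, A \to \underline{\mathrm{Gproj}}\, B$ with $G \circ F_A \cong F_B \circ E$. Moreover, $G$ induces a triangle equivalence of the Gorenstein defect categories $D_{def}(A) \to D_{def}(B)$, that is, one which commutes with $G$ and the two quotient functors up to an isomorphism of triangle functors. -/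

import Mathlib

open CategoryTheory CategoryTheory.Limits CategoryTheory.Pretriangulated
open scoped TensorProduct ZeroObject

universe w₁ w₂ w u

namespace RingExt

noncomputable section

section Bimodules
variable (k : Type w) [Field k]

/-- The enveloping algebra `Rᵉ = R ⊗ Rᵒᵖ`.  An `R`-bimodule (with central action of `k`) is a left
`Rᵉ`-module: `(x ⊗ op y) • m` is `x m y`. -/
abbrev Env (R : Type u) [Ring R] [Algebra k R] : Type u := R ⊗[k] Rᵐᵒᵖ

variable {k}
variable {R A : Type u} [Ring R] [Algebra k R] [Ring A] [Algebra k A]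

/-- The action of `Rᵉ` on `A` through a homomorphism of algebras `φ : R → A`. -/
def envAction (φ : R →ₐ[k] A) : Env k R →ₐ[k] Module.End k A :=
  (AlgHom.mulLeftRight k A).comp (Algebra.TensorProduct.map φ φ.op)

theorem envAction_tmul (φ : R →ₐ[k] A) (x y : R) (a : A) :
    envAction φ (x ⊗ₜ[k] MulOpposite.op y) a = φ x * a * φ y := by
  simp [envAction]

theorem map_envAction (φ : R →ₐ[k] A) (e : Env k R) (r : R) :
    φ (envAction (AlgHom.id k R) e r) = envAction φ e (φ r) := by
  induction e using TensorProduct.induction_on with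
  | zero => simp
  | tmul x y =>
    obtain ⟨y, rfl⟩ := MulOpposite.op_surjective y
    rw [envAction_tmul, envAction_tmul]; simp
  | add x y hx hy => simp [hx, hy]

/-- `A` as an `R`-bimodule, through a homomorphism of algebras `φ : R → A`. -/
def bimodule (φ : R →ₐ[k] A) : ModuleCat.{u} (Env k R) :=
  (ModuleCat.restrictScalars (envAction φ).toRingHom).obj (ModuleCat.of (Module.End k A) A)

/-- `φ : R → A`, as a homomorphism of `R`-bimodules. -/
def bimoduleHom (φ : R →ₐ[k] A) : bimodule (AlgHom.id k R) ⟶ bimodule φ :=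
  ModuleCat.ofHom (X := bimodule (AlgHom.id k R)) (Y := bimodule φ)
    { toFun := fun r => (φ (show R from r) : A)
      map_add' := fun x y => φ.map_add x y
      map_smul' := fun e r => map_envAction φ e r }

/-- The `R`-bimodule `A / R`, the cokernel of `φ : R → A`. -/
def quotientBimodule (φ : R →ₐ[k] A) : ModuleCat.{u} (Env k R) :=
  ModuleCat.of (Env k R) (bimodule φ ⧸ LinearMap.range (bimoduleHom φ).hom)

/-- The left `R`-module underlying an `R`-bimodule. -/
def leftModule (M : ModuleCat.{u} (Env k R)) : ModuleCat.{u} R :=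
  (ModuleCat.restrictScalars
    (Algebra.TensorProduct.includeLeft : R →ₐ[k] Env k R).toRingHom).obj M

/-- Right multiplication by `b` on an `R`-bimodule. -/
def rightMul (M : ModuleCat.{u} (Env k R)) (m : leftModule M) (b : R) : leftModule M :=
  show M from ((1 : R) ⊗ₜ[k] MulOpposite.op b : Env k R) • (show M from m)

/-- The relations `m b ⊗ n = m ⊗ b n`, as an `R`-submodule of `M ⊗_ℤ N`. -/
def balanced (M : ModuleCat.{u} (Env k R)) (N : ModuleCat.{u} R) :
    Submodule R (leftModule M ⊗[ℤ] N) :=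
  Submodule.span R
    {t | ∃ (m : leftModule M) (b : R) (n : N),
      t = rightMul M m b ⊗ₜ[ℤ] n - m ⊗ₜ[ℤ] (b • n)}

/-- The tensor product `M ⊗_R N` of an `R`-bimodule and a left `R`-module, a left `R`-module. -/
abbrev BalancedTensor (M : ModuleCat.{u} (Env k R)) (N : ModuleCat.{u} R) : Type u :=
  (leftModule M ⊗[ℤ] N) ⧸ balanced M N

theorem balancedTensor_hom_ext {M : ModuleCat.{u} (Env k R)} {N : ModuleCat.{u} R}
    {P : Type u} [AddCommGroup P] [Module R P] {f g : BalancedTensor M N →ₗ[R] P}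
    (h : ∀ (m : leftModule M) (n : N),
      f (Submodule.Quotient.mk (m ⊗ₜ[ℤ] n)) = g (Submodule.Quotient.mk (m ⊗ₜ[ℤ] n))) : f = g := by
  refine LinearMap.ext fun x => ?_
  obtain ⟨x, rfl⟩ := Submodule.Quotient.mk_surjective _ x
  induction x using TensorProduct.induction_on with
  | zero => rw [Submodule.Quotient.mk_zero, map_zero, map_zero]
  | tmul m n => exact h m n
  | add x y hx hy => rw [Submodule.Quotient.mk_add, map_add, map_add, hx, hy]

/-- The map `M ⊗_R f`. -/
def tensorMap (M : ModuleCat.{u} (Env k R)) {N N' : ModuleCat.{u} R} (f : N ⟶ N') :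
    BalancedTensor M N →ₗ[R] BalancedTensor M N' :=
  (balanced M N).mapQ (balanced M N')
    (TensorProduct.AlgebraTensorModule.map (LinearMap.id (R := R) (M := leftModule M))
      (f.hom.restrictScalars ℤ)) (by
    refine Submodule.span_le.2 ?_
    rintro _ ⟨m, b, n, rfl⟩
    refine Submodule.subset_span ⟨m, b, f.hom n, ?_⟩
    simp)

theorem tensorMap_mk (M : ModuleCat.{u} (Env k R)) {N N' : ModuleCat.{u} R} (f : N ⟶ N')
    (m : leftModule M) (n : N) :
    tensorMap M f (Submodule.Quotient.mk (m ⊗ₜ[ℤ] n)) =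
      Submodule.Quotient.mk (m ⊗ₜ[ℤ] f.hom n) := rfl

/-- The functor `M ⊗_R -` on left `R`-modules, for an `R`-bimodule `M`. -/
def tensorFunctor (M : ModuleCat.{u} (Env k R)) : ModuleCat.{u} R ⥤ ModuleCat.{u} R where
  obj N := ModuleCat.of R (BalancedTensor M N)
  map f := ModuleCat.ofHom (tensorMap M f)
  map_id _ := ModuleCat.hom_ext (balancedTensor_hom_ext fun _ _ => rfl)
  map_comp _ _ := ModuleCat.hom_ext (balancedTensor_hom_ext fun _ _ => rfl)

instance (M : ModuleCat.{u} (Env k R)) : (tensorFunctor M).Additive where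
  map_add {N N' f g} := ModuleCat.hom_ext (balancedTensor_hom_ext fun m n => by
    change tensorMap M (f + g) _ = tensorMap M f _ + tensorMap M g _
    rw [tensorMap_mk, tensorMap_mk, tensorMap_mk, ← Submodule.Quotient.mk_add,
      ← TensorProduct.tmul_add]
    rfl)

/-- `Tor_i^R(M, N)` for an `R`-bimodule `M`: the left derived functors of `M ⊗_R -`. -/
def Tor (M : ModuleCat.{u} (Env k R)) (i : ℕ) (N : ModuleCat.{u} R) : ModuleCat.{u} R :=
  ((tensorFunctor M).leftDerived i).obj N

/-- The tensor powers `M^{⊗_R j}` of an `R`-bimodule, as left `R`-modules; `M^{⊗_R 0} = R`. -/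
def tensorPower (M : ModuleCat.{u} (Env k R)) : ℕ → ModuleCat.{u} R
  | 0 => ModuleCat.of R R
  | j + 1 => (tensorFunctor M).obj (tensorPower M j)

end Bimodules

theorem isNoetherianRing_of_finite (k : Type w) [Field k] (R : Type u) [Ring R] [Algebra k R]
    [Module.Finite k R] : IsNoetherianRing R :=
  IsNoetherianRing.of_finite k R

section Categories
variable (R : Type u) [Ring R] [IsNoetherianRing R]

/-- Bounded cochain complexes of finitely generated projective modules. -/
def IsBoundedProjective {R : Type u} [Ring R] [IsNoetherianRing R]
    (K : CochainComplex (FGModuleCat.{u} R) ℤ) : Prop :=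
  (∃ a : ℤ, K.IsStrictlyGE a) ∧ (∃ b : ℤ, K.IsStrictlyLE b) ∧ ∀ n, Module.Projective R (K.X n)

theorem projective_of_module {R : Type u} [Ring R] [IsNoetherianRing R] (X : FGModuleCat.{u} R)
    [Module.Projective R X] : Projective X where
  factors {E Y} f e he := by
    have : Epi ((forget₂ (FGModuleCat.{u} R) (ModuleCat.{u} R)).map e) := inferInstance
    have hs : Function.Surjective e.hom.hom := (ModuleCat.epi_iff_surjective _).1 this
    obtain ⟨h, hh⟩ := Module.projective_lifting_property e.hom.hom f.hom.hom hs
    exact ⟨FGModuleCat.ofHom h, FGModuleCat.hom_ext hh⟩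

theorem module_projective_of_iso {R : Type u} [Ring R] [IsNoetherianRing R]
    {X Y : FGModuleCat.{u} R} (e : X ≅ Y) (h : Module.Projective R X) : Module.Projective R Y :=
  Module.Projective.of_equiv (FGModuleCat.isoToLinearEquiv e)

theorem module_projective_of_isZero {R : Type u} [Ring R] [IsNoetherianRing R]
    {X : FGModuleCat.{u} R} (h : IsZero X) : Module.Projective R X := by
  have : Subsingleton X := ModuleCat.subsingleton_of_isZero
    ((forget₂ (FGModuleCat.{u} R) (ModuleCat.{u} R)).map_isZero h)
  have : Module.Free R X := Module.Free.of_subsingleton R X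
  infer_instance

theorem module_projective_biprod {R : Type u} [Ring R] [IsNoetherianRing R]
    (X Y : FGModuleCat.{u} R) [Module.Projective R X] [Module.Projective R Y] :
    Module.Projective R (X ⊞ Y : FGModuleCat.{u} R) := by
  let s : (X ⊞ Y : FGModuleCat.{u} R) →ₗ[R] X × Y :=
    (biprod.fst (X := X) (Y := Y)).hom.hom.prod (biprod.snd (X := X) (Y := Y)).hom.hom
  let r : X × Y →ₗ[R] (X ⊞ Y : FGModuleCat.{u} R) :=
    (biprod.inl (X := X) (Y := Y)).hom.hom.coprod (biprod.inr (X := X) (Y := Y)).hom.hom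
  refine Module.Projective.of_split s r (LinearMap.ext fun x => ?_)
  exact congrArg (fun h : X ⊞ Y ⟶ X ⊞ Y => h.hom.hom x) (biprod.total (X := X) (Y := Y))

theorem isBoundedProjective_mappingCone {R : Type u} [Ring R] [IsNoetherianRing R]
    {K L : CochainComplex (FGModuleCat.{u} R) ℤ} (φ : K ⟶ L)
    (hK : IsBoundedProjective K) (hL : IsBoundedProjective L) :
    IsBoundedProjective (CochainComplex.mappingCone φ) := by
  obtain ⟨⟨a, _⟩, ⟨b, _⟩, hp⟩ := hK
  obtain ⟨⟨a', _⟩, ⟨b', _⟩, hp'⟩ := hL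
  refine ⟨⟨min a a' - 1, ?_⟩, ⟨max b b', ?_⟩, fun n => ?_⟩
  · rw [CochainComplex.isStrictlyGE_iff]
    intro i hi
    rw [CochainComplex.mappingCone.isZero_X_iff]
    exact ⟨K.isZero_of_isStrictlyGE a _, L.isZero_of_isStrictlyGE a' _⟩
  · rw [CochainComplex.isStrictlyLE_iff]
    intro i hi
    rw [CochainComplex.mappingCone.isZero_X_iff]
    exact ⟨K.isZero_of_isStrictlyLE b _, L.isZero_of_isStrictlyLE b' _⟩
  · have := hp (n + 1)
    have := hp' n
    exact module_projective_of_iso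
      (HomologicalComplex.homotopyCofiber.XIsoBiprod φ n (n + 1) rfl).symm
      (module_projective_biprod _ _)

variable {R} in
/-- A complete projective resolution: an exact complex of finitely generated projective modules
such that `Hom(P, Q)` is exact for every finitely generated projective module `Q`. -/
structure IsTotallyAcyclic (P : CochainComplex (FGModuleCat.{u} R) ℤ) : Prop where
  projective (n : ℤ) : Module.Projective R (P.X n)
  acyclic : P.Acyclic
  hom_exact (Q : FGModuleCat.{u} R) (_ : Module.Projective R Q) (i j l : ℤ) (_ : i + 1 = j)
    (_ : j + 1 = l) (f : P.X j ⟶ Q) (_ : P.d i j ≫ f = 0) : ∃ g : P.X l ⟶ Q, P.d j l ≫ g = f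

/-- Finitely generated Gorenstein projective modules. -/
def gproj : ObjectProperty (FGModuleCat.{u} R) := fun M =>
  ∃ P : CochainComplex (FGModuleCat.{u} R) ℤ, IsTotallyAcyclic P ∧
    Nonempty (M ≅ kernel (P.d 0 1))

theorem gproj_zero : gproj R 0 := by
  have h (n : ℤ) : IsZero ((0 : CochainComplex (FGModuleCat.{u} R) ℤ).X n) :=
    (HomologicalComplex.eval (FGModuleCat.{u} R) (ComplexShape.up ℤ) n).map_isZero
      (isZero_zero (CochainComplex (FGModuleCat.{u} R) ℤ))
  exact ⟨0, ⟨fun n => module_projective_of_isZero (h n),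
    fun n => ShortComplex.exact_of_isZero_X₂ _ (h n),
    fun Q _ i j l _ _ f _ => ⟨0, (h j).eq_of_src _ _⟩⟩,
    ⟨(isZero_zero _).iso ((h 0).of_mono (kernel.ι _))⟩⟩

/-- The category `Gproj R`. -/
abbrev Gproj := (gproj R).FullSubcategory

/-- Two maps in `Gproj R` are identified when their difference factors through a finitely
generated projective module. -/
def stableRel : HomRel (Gproj R) := fun X Y f g =>
  ∃ (P : FGModuleCat.{u} R) (_ : Module.Projective R P) (a : X.obj ⟶ P) (b : P ⟶ Y.obj),
    f.hom - g.hom = a ≫ b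

/-- The stable category of finitely generated Gorenstein projective modules. -/
abbrev StableGproj := CategoryTheory.Quotient (stableRel R)

variable [HasDerivedCategory.{w₁} (FGModuleCat.{u} R)]

/-- The bounded derived category `D^b(mod R)`. -/
abbrev Db := DerivedCategory.Bounded (FGModuleCat.{u} R)

/-- The subcategory `K^b(proj R)` of `D^b(mod R)`: the objects that are isomorphic to a bounded
complex of finitely generated projective modules. -/
def perfect : ObjectProperty (Db R) := fun X =>
  ∃ K : CochainComplex (FGModuleCat.{u} R) ℤ, IsBoundedProjective K ∧
    Nonempty (X.obj ≅ DerivedCategory.Q.obj K)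

instance : (perfect R).IsClosedUnderIsomorphisms where
  of_iso := by
    rintro X Y e ⟨K, hK, ⟨f⟩⟩
    exact ⟨K, hK, ⟨(ObjectProperty.ι _).mapIso e.symm ≪≫ f⟩⟩

instance : (perfect R).IsStableUnderShift ℤ where
  isStableUnderShiftBy n :=
    { le_shift := by
        rintro X ⟨K, ⟨⟨a, ha⟩, ⟨b, hb⟩, hp⟩, ⟨f⟩⟩
        refine ⟨K⟦n⟧, ⟨⟨a - n, K.isStrictlyGE_shift a n (a - n) (by lia)⟩,
          ⟨b - n, K.isStrictlyLE_shift b n (b - n) (by lia)⟩, fun i => hp (i + n)⟩, ⟨?_⟩⟩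
        exact ((ObjectProperty.ι _).commShiftIso n).app X ≪≫
          (shiftFunctor (DerivedCategory (FGModuleCat.{u} R)) n).mapIso f ≪≫
          (DerivedCategory.Q.commShiftIso n).symm.app K }

instance : (perfect R).IsTriangulatedClosed₃ := .mk' (by
  rintro T hT ⟨K, hK, ⟨e⟩⟩ ⟨L, hL, ⟨f⟩⟩
  obtain ⟨⟨b, _⟩, hp⟩ := hK.2
  have (n : ℤ) : Projective (K.X n) := by
    have := hp n
    exact projective_of_module _
  have := CochainComplex.isKProjective_of_projective K b
  let ι := ObjectProperty.ι (DerivedCategory.TStructure.t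
    (C := FGModuleCat.{u} R)).bounded
  obtain ⟨φ', hφ'⟩ := (CochainComplex.IsKProjective.Qh_map_bijective K
    ((HomotopyCategory.quotient _ _).obj L)).surjective
      ((DerivedCategory.quotientCompQhIso _).hom.app K ≫ e.inv ≫ ι.map T.mor₁ ≫ f.hom ≫
        (DerivedCategory.quotientCompQhIso _).inv.app L)
  obtain ⟨φ, rfl⟩ := (HomotopyCategory.quotient _ _).map_surjective φ'
  have hφ : DerivedCategory.Q.map φ = e.inv ≫ ι.map T.mor₁ ≫ f.hom := by
    rw [← cancel_epi ((DerivedCategory.quotientCompQhIso (FGModuleCat.{u} R)).hom.app K),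
      ← DerivedCategory.quotientCompQhIso_hom_naturality, hφ']
    simp
  refine ⟨CochainComplex.mappingCone φ, isBoundedProjective_mappingCone φ hK hL, ⟨?_⟩⟩
  exact Triangle.π₃.mapIso (isoTriangleOfIso₁₂ _ _ (ι.map_distinguished T hT)
    (DerivedCategory.mappingCone_triangle_distinguished φ) e f (by
      change ι.map T.mor₁ ≫ f.hom = e.hom ≫ DerivedCategory.Q.map φ
      rw [hφ, Iso.hom_inv_id_assoc])))

instance : (perfect R).ContainsZero where
  exists_zero := by
    refine ⟨0, isZero_zero _, 0, ⟨⟨0, inferInstance⟩, ⟨0, inferInstance⟩, fun n => ?_⟩, ⟨?_⟩⟩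
    · exact module_projective_of_isZero
        ((HomologicalComplex.eval (FGModuleCat.{u} R) (ComplexShape.up ℤ) n).map_isZero
          (isZero_zero (CochainComplex (FGModuleCat.{u} R) ℤ)))
    · exact ((ObjectProperty.ι _).map_isZero (isZero_zero _)).iso
        (DerivedCategory.Q.map_isZero (isZero_zero _))

instance : (perfect R).IsTriangulated where
  toIsTriangulatedClosed₂ := .of_isTriangulatedClosed₃

/-- The singularity category `D_sg(R)`, the Verdier quotient `D^b(mod R) / K^b(proj R)`. -/
abbrev Dsg := (perfect R).trW.Localization

/-- The quotient functor `D^b(mod R) ⥤ D_sg(R)`. -/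
abbrev toDsg : Db R ⥤ Dsg R := (perfect R).trW.Q

/-- Stalk complexes in degree zero, `mod R ⥤ D^b(mod R)`. -/
def stalk : FGModuleCat.{u} R ⥤ Db R :=
  ObjectProperty.lift _ (DerivedCategory.singleFunctor (FGModuleCat.{u} R) 0)
    fun _ => ⟨⟨0, inferInstance⟩, ⟨0, inferInstance⟩⟩

instance : (stalk R).Additive where
  map_add {X Y f g} := by
    apply (ObjectProperty.ι _).map_injective
    exact (DerivedCategory.singleFunctor (FGModuleCat.{u} R) 0).map_add

theorem perfect_stalk (P : FGModuleCat.{u} R) [Module.Projective R P] :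
    perfect R ((stalk R).obj P) := by
  refine ⟨(CochainComplex.singleFunctor _ 0).obj P, ⟨⟨0, inferInstance⟩, ⟨0, inferInstance⟩,
    fun n => ?_⟩, ⟨(DerivedCategory.singleFunctorIsoCompQ _ 0).app P⟩⟩
  by_cases h : n = 0
  · subst h
    exact module_projective_of_iso
      (HomologicalComplex.singleObjXSelf (ComplexShape.up ℤ) 0 P).symm inferInstance
  · exact module_projective_of_isZero
      (HomologicalComplex.isZero_single_obj_X (ComplexShape.up ℤ) 0 P n h)

theorem isZero_toDsg {X : Db R} (hX : perfect R X) : IsZero ((toDsg R).obj X) := by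
  have : IsIso ((toDsg R).map (0 : (0 : Db R) ⟶ X)) :=
    Localization.inverts (toDsg R) (perfect R).trW _
      ⟨X, 𝟙 X, 0, contractible_distinguished₁ X, hX⟩
  exact ((toDsg R).map_isZero (isZero_zero _)).of_iso (asIso ((toDsg R).map (0 : 0 ⟶ X))).symm

/-- The canonical functor from the stable category of finitely generated Gorenstein projective
modules to `D_sg(R)`, which sends a module to its stalk complex in degree zero. -/
def stableToDsg : StableGproj R ⥤ Dsg R :=
  CategoryTheory.Quotient.lift (stableRel R) ((gproj R).ι ⋙ stalk R ⋙ toDsg R) (by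
    rintro X Y f g ⟨P, _, a, b, h⟩
    have hz := isZero_toDsg R (perfect_stalk R P)
    change (stalk R ⋙ toDsg R).map f.hom = (stalk R ⋙ toDsg R).map g.hom
    rw [← sub_eq_zero, ← Functor.map_sub, h, Functor.map_comp]
    rw [hz.eq_of_tgt ((stalk R ⋙ toDsg R).map a) 0, zero_comp])

/-- The subcategory of `D_sg(R)` by which the Gorenstein defect category is a quotient: the
essential image of the stable category of Gorenstein projective modules, closed under shifts,
extensions and direct summands.  (That image is already closed under them, so that
nothing is added; and a Verdier quotient does not change when the subcategory is replaced
by its thick closure.) -/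
def gprojImage : ObjectProperty (Dsg R) := (stableToDsg R).essImage.triangEnvelope

instance : (stableToDsg R).essImage.Nonempty :=
  ⟨_, ⟨(CategoryTheory.Quotient.functor _).obj ⟨0, gproj_zero R⟩, ⟨Iso.refl _⟩⟩⟩

instance : (gprojImage R).IsTriangulated :=
  inferInstanceAs ((stableToDsg R).essImage.triangEnvelope.IsTriangulated)

/-- The Gorenstein defect category `D_def(R)`. -/
abbrev Ddef := (gprojImage R).trW.Localization

/-- The quotient functor `D_sg(R) ⥤ D_def(R)`. -/
abbrev toDdef : Dsg R ⥤ Ddef R := (gprojImage R).trW.Q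

end Categories

section Restriction

variable {k : Type w} [Field k] {R S : Type u} [Ring R] [Ring S] [Algebra k R] [Algebra k S]
  [Module.Finite k S]

/-- Restriction of scalars `mod S ⥤ mod R` along a homomorphism `φ : R → S` of `k`-algebras, where
`S` is finite dimensional over `k`. -/
def restrict (φ : R →ₐ[k] S) : FGModuleCat.{u} S ⥤ FGModuleCat.{u} R :=
  ObjectProperty.lift _ ((ModuleCat.isFG S).ι ⋙ ModuleCat.restrictScalars φ.toRingHom) (fun M => by
    let N := (ModuleCat.restrictScalars φ.toRingHom).obj M.obj
    let : Module k M := Module.compHom M (algebraMap k S)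
    let : Module k N := inferInstanceAs (Module k M)
    have : IsScalarTower k S M := ⟨fun c s m => by
      change (c • s) • m = (algebraMap k S c) • (s • m)
      rw [Algebra.smul_def, mul_smul]⟩
    have : IsScalarTower k R N := ⟨fun c r n => by
      change φ (c • r) • (show M from n) = (algebraMap k S c) • (φ r • (show M from n))
      rw [map_smul, Algebra.smul_def, mul_smul]⟩
    have : Module.Finite k N := Module.Finite.trans (R := k) S M
    exact Module.Finite.of_restrictScalars_finite k R N)

variable (φ : R →ₐ[k] S)

instance : (restrict φ).Additive where

variable [IsNoetherianRing R] [IsNoetherianRing S]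

instance : PreservesFiniteLimits (restrict φ) := by
  have : PreservesFiniteLimits (ModuleCat.restrictScalars.{u} φ.toRingHom) :=
    ⟨fun _ _ _ => ⟨inferInstance⟩⟩
  have : PreservesFiniteLimits (restrict φ ⋙ forget₂ (FGModuleCat.{u} R) (ModuleCat.{u} R)) :=
    comp_preservesFiniteLimits (forget₂ (FGModuleCat.{u} S) (ModuleCat.{u} S))
      (ModuleCat.restrictScalars φ.toRingHom)
  exact preservesFiniteLimits_of_reflects_of_preserves _
    (forget₂ (FGModuleCat.{u} R) (ModuleCat.{u} R))

instance : PreservesFiniteColimits (restrict φ) := by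
  have : PreservesFiniteColimits (ModuleCat.restrictScalars.{u} φ.toRingHom) :=
    ⟨fun _ _ _ => ⟨inferInstance⟩⟩
  have : PreservesFiniteColimits (restrict φ ⋙ forget₂ (FGModuleCat.{u} R) (ModuleCat.{u} R)) :=
    comp_preservesFiniteColimits (forget₂ (FGModuleCat.{u} S) (ModuleCat.{u} S))
      (ModuleCat.restrictScalars φ.toRingHom)
  exact preservesFiniteColimits_of_reflects_of_preserves _
    (forget₂ (FGModuleCat.{u} R) (ModuleCat.{u} R))

variable [HasDerivedCategory.{w₁} (FGModuleCat.{u} R)] [HasDerivedCategory.{w₂} (FGModuleCat.{u} S)]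

/-- The functor `D^b(mod S) ⥤ D^b(mod R)` induced by restriction of scalars. -/
def restrictDb : Db S ⥤ Db R :=
  ObjectProperty.lift _ (DerivedCategory.Bounded.ι ⋙ (restrict φ).mapDerivedCategory) (by
    rintro ⟨X, ⟨a, ⟨K, e, hK⟩⟩, ⟨b, ⟨L, f, hL⟩⟩⟩
    let F := (restrict φ).mapHomologicalComplex (ComplexShape.up ℤ)
    let G := (restrict φ).mapDerivedCategory
    refine ⟨⟨a, ⟨F.obj K, G.mapIso e ≪≫ (restrict φ).mapDerivedCategoryFactors.app K, ?_⟩⟩,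
      ⟨b, ⟨F.obj L, G.mapIso f ≪≫ (restrict φ).mapDerivedCategoryFactors.app L, ?_⟩⟩⟩
    · rw [CochainComplex.isStrictlyGE_iff]
      exact fun i hi => (restrict φ).map_isZero (K.isZero_of_isStrictlyGE a i)
    · rw [CochainComplex.isStrictlyLE_iff]
      exact fun i hi => (restrict φ).map_isZero (L.isZero_of_isStrictlyLE b i))

instance : (restrictDb φ).CommShift ℤ :=
  inferInstanceAs ((ObjectProperty.lift _
    (DerivedCategory.Bounded.ι ⋙ (restrict φ).mapDerivedCategory) _).CommShift ℤ)

instance : (restrictDb φ).IsTriangulated :=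
  inferInstanceAs ((ObjectProperty.lift _
    (DerivedCategory.Bounded.ι ⋙ (restrict φ).mapDerivedCategory) _).IsTriangulated)

end Restriction
end

end RingExt

set_option linter.unusedSectionVars false
set_option linter.unusedVariables false

/-! Write `R` for `B`, `φ : R → A` for the inclusion and `V = A / R`. Restriction along `π` followed
by restriction along `φ` is the identity. Hence, once both functors preserve perfect complexes, it
suffices that the one along `π` is essentially surjective on singularity categories;
`isEquivalence_of_section` does the rest.

Two sequences link `A` to `R`: `0 → N → A ⊗_R N → V ⊗_R N → 0` over `R`
(`inducedSequence_shortExact`), and `0 → K → A ⊗_R M → M → 0` over `A`, where `K` restricts to `V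
⊗_R M` (`exists_iso_restrict_kernel`). Each use of the second one adds a tensor factor `V`, so
iteration stops by nilpotency. Finiteness of the projective dimension of `V` is used twice: `V ⊗_R
N` has finite projective dimension when the higher Tor of `V` and `N` vanishes
(`hasProjectiveDimensionLT_tensor`), and high syzygies do have vanishing Tor
(`TensorAcyclic.of_syzygy`). It follows that an `A`-module of finite projective dimension over `R`
has finite projective dimension over `A` (`finPD_of_restrict`). If `M` is Tor-acyclic, then both `M`
and its restriction along `φ` and then `π` are quotients of `A ⊗_R M` by kernels of finite
projective dimension, so they agree in `D_sg(A)` (`exists_iso_section_stalk`). Every object of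
`D_sg(A)` is a shift of such a module.

Tor vanishing is expressed through Ext: for an injective coseparator `E`, `Ext^i(N, Hom_R(V, E))` is
dual to `Tor_i(V, N)`. The same device serves any left adjoint in place of `V ⊗_R -`.

Cycles of a totally acyclic complex are syzygies of arbitrarily high order, so the Tor groups that
matter vanish on them, and extension of scalars along `φ` and along `π` preserves Gorenstein
projectives (`gproj_fgInduce`). The stable equivalence is `R ⊗_A -`, and `A ⊗_R -` shows that it is
essentially surjective. For Gorenstein projective `M` the unit `M → R ⊗_A M` is onto with kernel of
finite projective dimension (`gproj.finPD_kernel_unit`). Maps from Gorenstein projectives lift along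
such epimorphisms, which gives fullness and faithfulness; the same unit identifies restriction with
`R ⊗_A -` in `D_sg(R)`. The thick subcategories generated by Gorenstein projectives therefore
correspond, and so do the defect categories. -/

namespace RingExt

noncomputable section

/-! ### Acyclicity for a left adjoint, measured by Ext. -/

section ExtAcyclic

open Abelian

universe v₁ u₁ v₂ u₂ w₃ w₄

variable {C : Type u₁} [Category.{v₁} C] [Abelian C] [HasExt.{w₃} C]

/-- All the higher `Ext` groups from `N` to `Y` vanish. -/
def ExtAcyclic (Y N : C) : Prop := ∀ i, Subsingleton (Ext.{w₃} N Y (i + 1))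

theorem ExtAcyclic.of_retract {Y N N' : C} (h : ExtAcyclic Y N) (r : Retract N' N) :
    ExtAcyclic Y N' := fun i => subsingleton_of_forall_eq 0 fun x => by
  have := h i
  rw [← x.mk₀_id_comp, ← r.retract, ← Ext.mk₀_comp_mk₀, Ext.comp_assoc_of_second_deg_zero,
    Subsingleton.elim ((Ext.mk₀ r.r).comp x (zero_add _)) 0, Ext.comp_zero]

theorem ExtAcyclic.of_iso {Y N N' : C} (h : ExtAcyclic Y N) (e : N' ≅ N) : ExtAcyclic Y N' :=
  h.of_retract e.retract

theorem ExtAcyclic.of_projective (Y N : C) [Projective N] : ExtAcyclic Y N := fun _ =>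
  subsingleton_of_forall_eq 0 fun x => x.eq_zero_of_projective

theorem ExtAcyclic.of_isZero {Y N : C} (h : IsZero N) : ExtAcyclic Y N :=
  have : Projective N := h.projective
  .of_projective Y N

section ShortExact

variable {S : ShortComplex C} (hS : S.ShortExact) {Y : C}
include hS

theorem ext_subsingleton_X₂ {i : ℕ} (h₁ : Subsingleton (Ext.{w₃} S.X₁ Y i))
    (h₃ : Subsingleton (Ext.{w₃} S.X₃ Y i)) : Subsingleton (Ext.{w₃} S.X₂ Y i) :=
  subsingleton_of_forall_eq 0 fun x => by
    obtain ⟨y, rfl⟩ := Ext.contravariant_sequence_exact₂ hS _ x (Subsingleton.elim _ _)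
    rw [Subsingleton.elim y 0, Ext.comp_zero]

theorem ext_subsingleton_X₁ {i : ℕ} (h₂ : Subsingleton (Ext.{w₃} S.X₂ Y i))
    (h₃ : Subsingleton (Ext.{w₃} S.X₃ Y (i + 1))) : Subsingleton (Ext.{w₃} S.X₁ Y i) :=
  subsingleton_of_forall_eq 0 fun x => by
    obtain ⟨y, rfl⟩ := Ext.contravariant_sequence_exact₁ hS _ x (add_comm 1 i)
      (Subsingleton.elim _ _)
    rw [Subsingleton.elim y 0, Ext.comp_zero]

theorem ext_subsingleton_X₃ {i : ℕ} (h₁ : Subsingleton (Ext.{w₃} S.X₁ Y i))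
    (h₂ : Subsingleton (Ext.{w₃} S.X₂ Y (i + 1))) : Subsingleton (Ext.{w₃} S.X₃ Y (i + 1)) :=
  subsingleton_of_forall_eq 0 fun x => by
    obtain ⟨y, rfl⟩ := Ext.contravariant_sequence_exact₃ hS _ x (Subsingleton.elim _ _)
      (add_comm 1 i)
    rw [Subsingleton.elim y 0, Ext.comp_zero]

theorem ExtAcyclic.X₂ (h₁ : ExtAcyclic Y S.X₁) (h₃ : ExtAcyclic Y S.X₃) : ExtAcyclic Y S.X₂ :=
  fun i => ext_subsingleton_X₂ hS (h₁ i) (h₃ i)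

theorem ExtAcyclic.X₁ (h₂ : ExtAcyclic Y S.X₂) (h₃ : ExtAcyclic Y S.X₃) : ExtAcyclic Y S.X₁ :=
  fun i => ext_subsingleton_X₁ hS (h₂ i) (h₃ (i + 1))

theorem ExtAcyclic.exists_extension (h₃ : ExtAcyclic Y S.X₃) (f : S.X₁ ⟶ Y) :
    ∃ g : S.X₂ ⟶ Y, S.f ≫ g = f := by
  have := h₃ 0
  obtain ⟨x, hx⟩ := Ext.contravariant_sequence_exact₁ hS _ (Ext.mk₀ f) (zero_add 1)
    (Subsingleton.elim _ _)
  obtain ⟨g, rfl⟩ := Ext.homEquiv₀.symm.surjective x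
  exact ⟨g, Ext.homEquiv₀.symm.injective (by simpa using hx)⟩

theorem ext_one_subsingleton (h₂ : Subsingleton (Ext.{w₃} S.X₂ Y 1))
    (h : ∀ f : S.X₁ ⟶ Y, ∃ g : S.X₂ ⟶ Y, S.f ≫ g = f) : Subsingleton (Ext.{w₃} S.X₃ Y 1) :=
  subsingleton_of_forall_eq 0 fun x => by
    obtain ⟨y, rfl⟩ := Ext.contravariant_sequence_exact₃ hS _ x (Subsingleton.elim _ _)
      (add_comm 1 0)
    obtain ⟨f, rfl⟩ := Ext.homEquiv₀.symm.surjective y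
    obtain ⟨g, rfl⟩ := h f
    simp only [Ext.homEquiv₀_symm_apply]
    rw [← Ext.mk₀_comp_mk₀, hS.extClass_comp_assoc]

/-- The second variable of `ExtAcyclic` is shifted along a short exact sequence with injective
middle term. -/
theorem ExtAcyclic.X₃_right [Injective S.X₂] {N : C} (h : ExtAcyclic S.X₁ N) :
    ExtAcyclic S.X₃ N := fun i => subsingleton_of_forall_eq 0 fun x => by
  have := h (i + 1)
  obtain ⟨y, rfl⟩ := Ext.covariant_sequence_exact₃ _ hS x rfl (Subsingleton.elim _ _)
  rw [y.eq_zero_of_injective, Ext.zero_comp]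

end ShortExact

variable {D : Type u₂} [Category.{v₂} D] [Abelian D]
  {L : C ⥤ D} {R : D ⥤ C} (adj : L ⊣ R) {E : D}

include adj

theorem map_comp_homEquiv_symm {X X' : C} {f : X ⟶ X'} {χ : L.obj X ⟶ E} {ψ : X' ⟶ R.obj E}
    (h : f ≫ ψ = adj.homEquiv _ _ χ) : L.map f ≫ (adj.homEquiv _ _).symm ψ = χ := by
  rw [← Adjunction.homEquiv_naturality_left_symm, h, Equiv.symm_apply_apply]

/-- The left adjoint `L` preserves short exact sequences with an acyclic third term. -/
theorem map_shortExact [L.Additive] [Injective E] (hE : IsCoseparator E) {S : ShortComplex C}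
    (hS : S.ShortExact) (h₃ : ExtAcyclic (R.obj E) S.X₃) : (S.map L).ShortExact := by
  have := adj.leftAdjoint_preservesColimits
  have : PreservesFiniteColimits L := inferInstance
  obtain ⟨h, he⟩ := L.preservesFiniteColimits_iff_forall_exact_map_and_epi.1 this S hS
  -- As `E` cogenerates, it is enough that every `χ : L.obj S.X₁ ⟶ E` extends along `L.map S.f`; the
  -- adjunct of `χ` extends because `Ext¹(S.X₃, R.obj E)` vanishes.
  have : Mono (S.map L).f := Preadditive.mono_of_cancel_zero _ fun {G} g hg => by
    refine (Preadditive.isCoseparator_iff _).1 hE g fun χ => ?_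
    obtain ⟨ψ, hψ⟩ := h₃.exists_extension hS (adj.homEquiv _ _ χ)
    rw [← map_comp_homEquiv_symm adj hψ]
    exact (Category.assoc g (S.map L).f _).symm.trans ((congrArg (· ≫ _) hg).trans zero_comp)
  exact { exact := h, mono_f := this, epi_g := he }

/-- `L` preserves projectives and acyclicity passes to syzygies, so `L` carries a projective
resolution of `N` to one of `L.obj N` of the same length. -/
theorem hasProjectiveDimensionLT_leftAdjoint [EnoughProjectives C] [L.Additive]
    [R.PreservesEpimorphisms] [Injective E] (hE : IsCoseparator E) (n : ℕ) (N : C)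
    (hN : ExtAcyclic (R.obj E) N) (h : HasProjectiveDimensionLT N (n + 1)) :
    HasProjectiveDimensionLT (L.obj N) (n + 1) := by
  induction n generalizing N with
  | zero =>
    have := (projective_iff_hasProjectiveDimensionLT_one (X := N)).2 h
    have := adj.map_projective N this
    exact inferInstanceAs (HasProjectiveDimensionLT _ 1)
  | succ n ih =>
    let S := ShortComplex.mk (kernel.ι (Projective.π N)) (Projective.π N) (kernel.condition _)
    have hS : S.ShortExact := { exact := ShortComplex.exact_kernel _ }
    have : Projective (L.obj S.X₂) := adj.map_projective _ (inferInstanceAs (Projective (Projective.over N)))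
    have h₁ := ih S.X₁ (.X₁ hS (.of_projective _ (Projective.over N)) hN)
      (hS.hasProjectiveDimensionLT_X₁ (n + 1)
        (hasProjectiveDimensionLT_of_ge (Projective.over N) 1 _ (by lia)) h)
    exact (map_shortExact adj hE hS hN).hasProjectiveDimensionLT_X₃ (n + 1) h₁
      (hasProjectiveDimensionLT_of_ge (L.obj (Projective.over N)) 1 _ (by lia))

/-- On acyclic `N` the adjunction derives: `Ext(L N, Z)` is `Ext(N, R Z)`, which vanishes in
positive degrees for injective `R Z`. -/
theorem ExtAcyclic.leftAdjoint [HasExt.{w₄} D] [EnoughProjectives C] [L.Additive]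
    [R.PreservesEpimorphisms] [Injective E] (hE : IsCoseparator E) {Z : D} (hZ : Injective (R.obj Z))
    {N : C} (hN : ExtAcyclic (R.obj E) N) : ExtAcyclic Z (L.obj N) := by
  intro i
  induction i generalizing N with
  | zero =>
    let S := ShortComplex.mk (kernel.ι (Projective.π N)) (Projective.π N) (kernel.condition _)
    have hS : S.ShortExact := { exact := ShortComplex.exact_kernel _ }
    have : Projective (L.obj (Projective.over N)) := adj.map_projective _ inferInstance
    refine ext_one_subsingleton (map_shortExact adj hE hS hN)
      (ExtAcyclic.of_projective Z (L.obj (Projective.over N)) 0) fun f => ?_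
    refine ⟨(adj.homEquiv _ _).symm (Injective.factorThru (adj.homEquiv _ _ f) S.f), ?_⟩
    exact map_comp_homEquiv_symm adj (Injective.comp_factorThru _ _)
  | succ i ih =>
    let S := ShortComplex.mk (kernel.ι (Projective.π N)) (Projective.π N) (kernel.condition _)
    have hS : S.ShortExact := { exact := ShortComplex.exact_kernel _ }
    have : Projective (L.obj (Projective.over N)) := adj.map_projective _ inferInstance
    exact ext_subsingleton_X₃ (map_shortExact adj hE hS hN)
      (ih (.X₁ hS (.of_projective _ (Projective.over N)) hN))
      (ExtAcyclic.of_projective Z (L.obj (Projective.over N)) (i + 1))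

/-- For a projective resolution `P` of `N`, `Hom(P, R E) = Hom(L P, E)` and `Hom(-, E)` is exact, so
`Ext^i(N, R E)` is the dual of `L_i N`. The Tor hypothesis of the theorem enters here. -/
theorem ExtAcyclic.of_leftDerived [HasProjectiveResolutions C] [L.Additive] [Injective E] {N : C}
    (h : ∀ i, 1 ≤ i → IsZero ((L.leftDerived i).obj N)) : ExtAcyclic (R.obj E) N := by
  intro i
  let P := projectiveResolution N
  refine subsingleton_of_forall_eq 0 fun x => ?_
  obtain ⟨f, hf, rfl⟩ := P.extMk_surjective x (i + 2) rfl
  rw [P.extMk_eq_zero_iff _ _ _ _ i rfl]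
  have hz : IsZero ((((L.mapHomologicalComplex _).obj P.complex)).homology (i + 1)) :=
    (h (i + 1) (by lia)).of_iso (P.isoLeftDerivedObj L (i + 1)).symm
  have hex : (((L.mapHomologicalComplex _).obj P.complex).sc' (i + 2) (i + 1) i).Exact := by
    rw [← HomologicalComplex.exactAt_iff' _ (i + 2) (i + 1) i (by simp) (by simp)]
    exact (HomologicalComplex.exactAt_iff_isZero_homology _ _).2 hz
  obtain ⟨g, hg⟩ : ∃ g : L.obj (P.complex.X i) ⟶ E, L.map (P.complex.d (i + 1) i) ≫ g =
      (adj.homEquiv _ _).symm f := by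
    refine ⟨hex.descToInjective _ ?_, hex.comp_descToInjective _ _⟩
    change L.map (P.complex.d (i + 2) (i + 1)) ≫ _ = _
    rw [← Adjunction.homEquiv_naturality_left_symm, hf]
    exact (adj.homAddEquiv _ _).symm.map_zero
  refine ⟨adj.homEquiv _ _ g, ?_⟩
  rw [← Adjunction.homEquiv_naturality_left, hg, Equiv.apply_symm_apply]

end ExtAcyclic

/-! ### The tensor–Hom adjunction of a bimodule. -/

section Tensor

variable {k : Type w} [Field k] {R : Type u} [Ring R] [Algebra k R]

theorem rightMul_add (V : ModuleCat.{u} (Env k R)) (v v' : leftModule V) (b : R) :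
    rightMul V (v + v') b = rightMul V v b + rightMul V v' b :=
  smul_add (1 ⊗ₜ[k] MulOpposite.op b : Env k R) (show V from v) (show V from v')

theorem rightMul_smul (V : ModuleCat.{u} (Env k R)) (r : R) (v : leftModule V) (b : R) :
    rightMul V (r • v) b = r • rightMul V v b := by
  change (1 ⊗ₜ[k] MulOpposite.op b : Env k R) • ((r ⊗ₜ[k] 1 : Env k R) • (show V from v)) =
    (r ⊗ₜ[k] 1 : Env k R) • ((1 ⊗ₜ[k] MulOpposite.op b : Env k R) • (show V from v))
  rw [smul_smul, smul_smul]
  simp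

theorem rightMul_mul (V : ModuleCat.{u} (Env k R)) (v : leftModule V) (b c : R) :
    rightMul V v (b * c) = rightMul V (rightMul V v b) c := by
  change (1 ⊗ₜ[k] MulOpposite.op (b * c) : Env k R) • (show V from v) =
    (1 ⊗ₜ[k] MulOpposite.op c : Env k R) • ((1 ⊗ₜ[k] MulOpposite.op b : Env k R) • (show V from v))
  rw [smul_smul]
  simp

theorem rightMul_one (V : ModuleCat.{u} (Env k R)) (v : leftModule V) : rightMul V v 1 = v :=
  one_smul (Env k R) (show V from v)

theorem rightMul_add_right (V : ModuleCat.{u} (Env k R)) (v : leftModule V) (b c : R) :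
    rightMul V v (b + c) = rightMul V v b + rightMul V v c := by
  change (1 ⊗ₜ[k] MulOpposite.op (b + c) : Env k R) • (show V from v) = _
  rw [MulOpposite.op_add, TensorProduct.tmul_add, add_smul]
  rfl

theorem rightMul_zero (V : ModuleCat.{u} (Env k R)) (v : leftModule V) : rightMul V v 0 = 0 := by
  change (1 ⊗ₜ[k] MulOpposite.op 0 : Env k R) • (show V from v) = _
  rw [MulOpposite.op_zero, TensorProduct.tmul_zero]
  exact zero_smul (Env k R) (show V from v)

/-- Right multiplication as a linear map. -/
def rightMulHom (V : ModuleCat.{u} (Env k R)) (b : R) : leftModule V →ₗ[R] leftModule V where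
  toFun v := rightMul V v b
  map_add' v v' := rightMul_add V v v' b
  map_smul' r v := rightMul_smul V r v b

/-- The left `R`-module `Hom_R(V, Y)`, for an `R`-bimodule `V`. -/
def HomModule (V : ModuleCat.{u} (Env k R)) (Y : ModuleCat.{u} R) : Type u := leftModule V →ₗ[R] Y

instance (V : ModuleCat.{u} (Env k R)) (Y : ModuleCat.{u} R) : AddCommGroup (HomModule V Y) :=
  inferInstanceAs (AddCommGroup (leftModule V →ₗ[R] Y))

instance (V : ModuleCat.{u} (Env k R)) (Y : ModuleCat.{u} R) : Module R (HomModule V Y) where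
  smul b f := LinearMap.comp (show leftModule V →ₗ[R] Y from f) (rightMulHom V b)
  one_smul f := LinearMap.ext fun v => congrArg _ (rightMul_one V v)
  mul_smul b c f := LinearMap.ext fun v => congrArg _ (rightMul_mul V v b c)
  smul_zero _ := LinearMap.ext fun _ => rfl
  smul_add _ _ _ := LinearMap.ext fun _ => rfl
  add_smul b c f := LinearMap.ext fun v => by
    change (show leftModule V →ₗ[R] Y from f) (rightMul V v (b + c)) = _
    rw [rightMul_add_right, map_add]
    rfl
  zero_smul f := LinearMap.ext fun v => by
    change (show leftModule V →ₗ[R] Y from f) (rightMul V v 0) = _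
    rw [rightMul_zero, map_zero]
    rfl

/-- The functor `Hom_R(V, -)` on left `R`-modules, for an `R`-bimodule `V`. -/
def homFunctor (V : ModuleCat.{u} (Env k R)) : ModuleCat.{u} R ⥤ ModuleCat.{u} R where
  obj Y := ModuleCat.of R (HomModule V Y)
  map {Y Y'} g := ModuleCat.ofHom (X := HomModule V Y) (Y := HomModule V Y')
    { toFun := fun f => g.hom.comp (show leftModule V →ₗ[R] Y from f)
      map_add' := fun f f' => LinearMap.comp_add _ _ _
      map_smul' := fun b f => rfl }
  map_id _ := rfl
  map_comp _ _ := rfl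

/-- The linear map `V ⊗_R N → Y` given by a linear map `N → Hom_R(V, Y)`. -/
def tensorLift (V : ModuleCat.{u} (Env k R)) {N Y : ModuleCat.{u} R}
    (g : N →ₗ[R] HomModule V Y) : BalancedTensor V N →ₗ[R] Y :=
  (balanced V N).liftQ (TensorProduct.AlgebraTensorModule.lift (A := R)
    { toFun := fun v =>
        { toFun := fun n => (show leftModule V →ₗ[R] Y from g n) v
          map_add' := fun n n' => by rw [map_add]; rfl
          map_smul' := fun c n => by
            rw [map_zsmul]
            exact (LinearMap.smul_apply c (show leftModule V →ₗ[R] Y from g n) v) }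
      map_add' := fun v v' => LinearMap.ext fun n => map_add (show leftModule V →ₗ[R] Y from g n) v v'
      map_smul' := fun r v => LinearMap.ext fun n =>
        map_smul (show leftModule V →ₗ[R] Y from g n) r v }) (by
    refine Submodule.span_le.2 ?_
    rintro _ ⟨v, b, n, rfl⟩
    simp only [SetLike.mem_coe, LinearMap.mem_ker, map_sub,
      TensorProduct.AlgebraTensorModule.lift_tmul, sub_eq_zero]
    change (show leftModule V →ₗ[R] Y from g n) (rightMul V v b) =
      (show leftModule V →ₗ[R] Y from g (b • n)) v
    rw [map_smul]
    rfl)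

/-- The class of `v ⊗ n`. -/
def tmk (V : ModuleCat.{u} (Env k R)) {N : ModuleCat.{u} R} (v : leftModule V) (n : N) :
    BalancedTensor V N := Submodule.Quotient.mk (v ⊗ₜ[ℤ] n)

theorem tmk_rightMul (V : ModuleCat.{u} (Env k R)) {N : ModuleCat.{u} R} (v : leftModule V) (b : R)
    (n : N) : tmk V (rightMul V v b) n = tmk V v (b • n) :=
  (Submodule.Quotient.eq _).2 (Submodule.subset_span ⟨v, b, n, rfl⟩)

theorem tmk_add_left (V : ModuleCat.{u} (Env k R)) {N : ModuleCat.{u} R} (v v' : leftModule V)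
    (n : N) : tmk V (v + v') n = tmk V v n + tmk V v' n := by
  simp only [tmk, TensorProduct.add_tmul, Submodule.Quotient.mk_add]

theorem tmk_add_right (V : ModuleCat.{u} (Env k R)) {N : ModuleCat.{u} R} (v : leftModule V)
    (n n' : N) : tmk V v (n + n') = tmk V v n + tmk V v n' := by
  simp only [tmk, TensorProduct.tmul_add, Submodule.Quotient.mk_add]

theorem tmk_smul (V : ModuleCat.{u} (Env k R)) {N : ModuleCat.{u} R} (r : R) (v : leftModule V)
    (n : N) : tmk V (r • v) n = r • tmk V v n := rfl

/-- The linear map `N → Hom_R(V, Y)` given by a linear map `V ⊗_R N → Y`. -/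
def tensorCurry (V : ModuleCat.{u} (Env k R)) {N Y : ModuleCat.{u} R}
    (f : BalancedTensor V N →ₗ[R] Y) : N →ₗ[R] HomModule V Y where
  toFun n := ({ toFun := fun v => f (tmk V v n)
                map_add' := fun v v' => by rw [tmk_add_left, map_add]
                map_smul' := fun r v => map_smul f r (tmk V v n) } : leftModule V →ₗ[R] Y)
  map_add' n n' := LinearMap.ext fun v => by
    change f (tmk V v (n + n')) = _
    rw [tmk_add_right, map_add]; rfl
  map_smul' b n := LinearMap.ext fun v => by
    change f (tmk V v (b • n)) = f (tmk V (rightMul V v b) n)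
    rw [tmk_rightMul]

/-- The adjunction between `V ⊗_R -` and `Hom_R(V, -)`. -/
def tensorHomAdj (V : ModuleCat.{u} (Env k R)) : tensorFunctor V ⊣ homFunctor V :=
  Adjunction.mkOfHomEquiv
    { homEquiv := fun N Y =>
        { toFun := fun f => ModuleCat.ofHom (tensorCurry V f.hom)
          invFun := fun g => ModuleCat.ofHom (tensorLift V g.hom)
          left_inv := fun f => ModuleCat.hom_ext (balancedTensor_hom_ext fun v n => rfl)
          right_inv := fun g => rfl }
      homEquiv_naturality_left_symm := fun f g =>
        ModuleCat.hom_ext (balancedTensor_hom_ext fun v n => rfl)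
      homEquiv_naturality_right := fun f g => rfl }

/-- The map `V ⊗_R N → V' ⊗_R N` given by a map of bimodules. -/
def tensorMapLeft {V V' : ModuleCat.{u} (Env k R)} (β : V ⟶ V') (N : ModuleCat.{u} R) :
    (tensorFunctor V).obj N ⟶ (tensorFunctor V').obj N :=
  ((tensorHomAdj V).homEquiv _ _).symm (ModuleCat.ofHom (X := N)
    (Y := HomModule V ((tensorFunctor V').obj N))
    { toFun := fun n => LinearMap.comp (tensorCurry V' (Y := (tensorFunctor V').obj N)
        LinearMap.id n : leftModule V' →ₗ[R] (tensorFunctor V').obj N)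
          ((ModuleCat.restrictScalars _).map β).hom
      map_add' := fun n n' => by rw [map_add]; rfl
      map_smul' := fun b n => by
        rw [map_smul]
        refine LinearMap.ext fun v => ?_
        change tmk V' (rightMul V' (β.hom v) b) n = tmk V' (β.hom _) n
        congr 1
        exact (map_smul β.hom (1 ⊗ₜ[k] MulOpposite.op b : Env k R) (show V from v)).symm })

/-- The map `Hom_R(V', Y) → Hom_R(V, Y)` given by a map of bimodules. -/
def homMapLeft {V V' : ModuleCat.{u} (Env k R)} (β : V ⟶ V') (Y : ModuleCat.{u} R) :
    (homFunctor V').obj Y ⟶ (homFunctor V).obj Y :=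
  ModuleCat.ofHom (X := HomModule V' Y) (Y := HomModule V Y)
    { toFun := fun f => LinearMap.comp (show leftModule V' →ₗ[R] Y from f)
        ((ModuleCat.restrictScalars
          (Algebra.TensorProduct.includeLeft : R →ₐ[k] Env k R).toRingHom).map β).hom
      map_add' := fun f f' => rfl
      map_smul' := fun b f => LinearMap.ext fun v =>
        congrArg (show leftModule V' →ₗ[R] Y from f)
          (map_smul β.hom (1 ⊗ₜ[k] MulOpposite.op b : Env k R) (show V from v)).symm }

/-- Naturality of the adjunction in the bimodule: exactness questions about `- ⊗_R N` become
questions about `Hom_R(-, E)`. -/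
theorem homEquiv_tensorMapLeft {V V' : ModuleCat.{u} (Env k R)} (β : V ⟶ V') {N Y : ModuleCat.{u} R}
    (χ : (tensorFunctor V').obj N ⟶ Y) :
    (tensorHomAdj V).homEquiv _ _ (tensorMapLeft β N ≫ χ) =
      (tensorHomAdj V').homEquiv _ _ χ ≫ homMapLeft β Y := by
  rw [tensorMapLeft]
  rfl

end Tensor

/-! ### Exactness in the bimodule variable. -/

section CoseparatorTest

universe v₁ u₁

variable {C : Type u₁} [Category.{v₁} C] [Abelian C] {E : C}

/-- Short exactness can be tested on the maps to a coseparator. -/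
theorem shortExact_of_isCoseparator (hE : IsCoseparator E) (S : ShortComplex C)
    (h₁ : ∀ χ : S.X₁ ⟶ E, ∃ ψ : S.X₂ ⟶ E, S.f ≫ ψ = χ)
    (h₂ : ∀ χ : S.X₂ ⟶ E, S.f ≫ χ = 0 → ∃ ψ : S.X₃ ⟶ E, S.g ≫ ψ = χ)
    (h₃ : ∀ χ : S.X₃ ⟶ E, S.g ≫ χ = 0 → χ = 0) : S.ShortExact := by
  have hE' := (Preadditive.isCoseparator_iff _).1 hE
  refine { exact := ?_, mono_f := ?_, epi_g := ?_ }
  · rw [S.exact_iff_kernel_ι_comp_cokernel_π_zero]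
    refine hE' _ fun χ => ?_
    obtain ⟨ψ, hψ⟩ := h₂ (cokernel.π S.f ≫ χ) (by simp)
    rw [Category.assoc, ← hψ, kernel.condition_assoc, zero_comp]
  · refine Preadditive.mono_of_cancel_zero _ fun g hg => hE' g fun χ => ?_
    obtain ⟨ψ, rfl⟩ := h₁ χ
    rw [reassoc_of% hg, zero_comp]
  · refine Preadditive.epi_of_cancel_zero _ fun g hg => hE' g fun χ => h₃ _ ?_
    rw [reassoc_of% hg, zero_comp]

end CoseparatorTest

section Restriction

variable {R S : Type u} [Ring R] [Ring S] (f : R →+* S)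

instance : PreservesFiniteLimits (ModuleCat.restrictScalars.{u} f) :=
  ⟨fun _ _ _ => ⟨inferInstance⟩⟩

instance : PreservesFiniteColimits (ModuleCat.restrictScalars.{u} f) :=
  ⟨fun _ _ _ => ⟨inferInstance⟩⟩

end Restriction

section Tensor

variable {k : Type w} [Field k] {R : Type u} [Ring R] [Algebra k R]

/-- The contravariant functor `Hom_R(-, E)` is exact for injective `E`. -/
theorem homMapLeft_shortExact {S : ShortComplex (ModuleCat.{u} (Env k R))} (hS : S.ShortExact)
    (E : ModuleCat.{u} R) [Injective E] :
    (ShortComplex.mk (homMapLeft S.g E) (homMapLeft S.f E) (by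
      refine ModuleCat.hom_ext (LinearMap.ext fun f => LinearMap.ext fun v => ?_)
      change (show leftModule S.X₃ →ₗ[R] E from f) (S.g.hom (S.f.hom v)) = 0
      rw [show S.g.hom (S.f.hom v) = 0 from congrArg (fun h => h.hom (show S.X₁ from v)) S.zero]
      exact map_zero (show leftModule S.X₃ →ₗ[R] E from f))).ShortExact := by
  let F : ModuleCat.{u} (Env k R) ⥤ ModuleCat.{u} R := ModuleCat.restrictScalars
    (Algebra.TensorProduct.includeLeft : R →ₐ[k] Env k R).toRingHom
  have hF : (S.map F).ShortExact := hS.map_of_exact F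
  refine { exact := ?_, mono_f := ?_, epi_g := ?_ }
  · rw [ShortComplex.moduleCat_exact_iff]
    intro f hf
    have hf' : (S.map F).f ≫ ModuleCat.ofHom (X := leftModule S.X₂) (show leftModule S.X₂ →ₗ[R] E from f) = 0 :=
      ModuleCat.hom_ext hf
    let l := (CokernelCofork.IsColimit.desc' hF.gIsCokernel _ hf')
    exact ⟨l.1.hom, congrArg ModuleCat.Hom.hom l.2⟩
  · rw [ModuleCat.mono_iff_injective]
    intro f f' h
    have hs := (ModuleCat.epi_iff_surjective _).1 hS.epi_g
    refine LinearMap.ext fun v => ?_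
    obtain ⟨v, rfl⟩ := hs v
    exact LinearMap.congr_fun (show (LinearMap.comp (show leftModule S.X₃ →ₗ[R] E from f)
      (F.map S.g).hom) = LinearMap.comp (show leftModule S.X₃ →ₗ[R] E from f') (F.map S.g).hom
        from h) v
  · rw [ModuleCat.epi_iff_surjective]
    intro f
    have : Mono (S.map F).f := hF.mono_f
    let g : (S.map F).X₁ ⟶ E :=
      ModuleCat.ofHom (X := leftModule S.X₁) (show leftModule S.X₁ →ₗ[R] E from f)
    obtain ⟨l, hl⟩ := Injective.factors g (S.map F).f
    exact ⟨l.hom, congrArg ModuleCat.Hom.hom hl⟩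

/-- A short exact sequence of bimodules stays exact under `- ⊗_R N`, if `Tor(S.X₃, N)` vanishes. -/
theorem tensorMapLeft_shortExact {S : ShortComplex (ModuleCat.{u} (Env k R))} (hS : S.ShortExact)
    {E : ModuleCat.{u} R} [Injective E] (hE : IsCoseparator E) {N : ModuleCat.{u} R}
    (hN : ExtAcyclic ((homFunctor S.X₃).obj E) N) :
    (ShortComplex.mk (tensorMapLeft S.f N) (tensorMapLeft S.g N)
      (ModuleCat.hom_ext (balancedTensor_hom_ext fun v n => by
        change tmk S.X₃ (S.g.hom (S.f.hom v)) n = 0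
        rw [show S.g.hom (S.f.hom v) = 0 from congrArg (fun h => h.hom (show S.X₁ from v)) S.zero]
        exact (congrArg _ (TensorProduct.zero_tmul _ _)).trans
          (Submodule.Quotient.mk_zero _)))).ShortExact := by
  have h := homMapLeft_shortExact hS E
  have hm := h.mono_f
  refine shortExact_of_isCoseparator hE _ (fun χ => ?_) (fun χ hχ => ?_) (fun χ hχ => ?_)
  -- Injectivity of the first tensor map: the obstruction to lifting the adjunct of `χ` along
  -- `Hom_R(X₂, E) → Hom_R(X₁, E)` lies in `Ext¹(N, Hom_R(X₃, E))`. The other two conditions are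
  -- left exactness of `Hom_R(N, -)`.
  · have := hN 0
    obtain ⟨x, hx⟩ := Abelian.Ext.covariant_sequence_exact₃ N h
      (Abelian.Ext.mk₀ ((tensorHomAdj S.X₁).homEquiv _ _ χ)) (zero_add 1) (Subsingleton.elim _ _)
    obtain ⟨ψ, rfl⟩ := Abelian.Ext.homEquiv₀.symm.surjective x
    have hψ : ψ ≫ homMapLeft S.f E = (tensorHomAdj S.X₁).homEquiv _ _ χ :=
      Abelian.Ext.homEquiv₀.symm.injective (by simpa using hx)
    obtain ⟨ψ, rfl⟩ := ((tensorHomAdj S.X₂).homEquiv _ _).surjective ψ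
    rw [← homEquiv_tensorMapLeft] at hψ
    exact ⟨ψ, ((tensorHomAdj S.X₁).homEquiv _ _).injective hψ⟩
  · have h0 : (tensorHomAdj S.X₂).homEquiv _ _ χ ≫ homMapLeft S.f E = 0 := by
      rw [← homEquiv_tensorMapLeft]
      exact (congrArg _ hχ).trans ((tensorHomAdj S.X₁).homAddEquiv _ _).map_zero
    obtain ⟨ψ, hψ⟩ := KernelFork.IsLimit.lift' h.fIsKernel _ h0
    obtain ⟨ψ, rfl⟩ := ((tensorHomAdj S.X₃).homEquiv _ _).surjective ψ
    refine ⟨ψ, ((tensorHomAdj S.X₂).homEquiv _ _).injective ?_⟩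
    rw [homEquiv_tensorMapLeft]
    exact hψ
  · refine ((tensorHomAdj S.X₃).homEquiv _ _).injective ?_
    refine Eq.trans ?_ ((tensorHomAdj S.X₃).homAddEquiv _ _).map_zero.symm
    refine (cancel_mono (homMapLeft S.g E)).1 ?_
    rw [← homEquiv_tensorMapLeft, zero_comp]
    exact (congrArg _ hχ).trans ((tensorHomAdj S.X₂).homAddEquiv _ _).map_zero

end Tensor

/-! ### Projective bimodules over a field. -/

section Central

variable {k : Type w} [Field k] {R : Type u} [Ring R] [Algebra k R]

variable (k) in
/-- The `k`-module underlying a module over a `k`-algebra. -/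
abbrev baseModule (N : ModuleCat.{u} R) : ModuleCat.{u} k :=
  (ModuleCat.restrictScalars (algebraMap k R)).obj N

/-- Multiplication by an element of `R` on the underlying `k`-module. -/
def smulHom (N : ModuleCat.{u} R) : R →ₐ[k] Module.End k (baseModule k N) where
  toFun r :=
    { toFun := fun n => show N from r • (show N from n)
      map_add' := fun n n' => smul_add r (show N from n) (show N from n')
      map_smul' := fun c n => by
        change r • (algebraMap k R c • (show N from n)) = algebraMap k R c • (r • (show N from n))
        rw [smul_smul, smul_smul, Algebra.commutes] }
  map_one' := LinearMap.ext fun n => one_smul R (show N from n)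
  map_mul' r r' := LinearMap.ext fun n => mul_smul r r' (show N from n)
  map_zero' := LinearMap.ext fun n => zero_smul R (show N from n)
  map_add' r r' := LinearMap.ext fun n => add_smul r r' (show N from n)
  commutes' c := LinearMap.ext fun n => rfl

/-- The action of `R` on `Hom_k(N, Y)` through `Y`. -/
def homActionLeft (N Y : ModuleCat.{u} R) :
    R →ₐ[k] Module.End k (baseModule k N →ₗ[k] baseModule k Y) where
  toFun r := LinearMap.compRight k (smulHom Y r)
  map_one' := by ext; simp
  map_mul' r r' := by ext; simp
  map_zero' := by ext; simp
  map_add' r r' := by ext; simp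
  commutes' c := by ext; rfl

/-- The action of `Rᵐᵒᵖ` on `Hom_k(N, Y)` through `N`. -/
def homActionRight (N Y : ModuleCat.{u} R) :
    Rᵐᵒᵖ →ₐ[k] Module.End k (baseModule k N →ₗ[k] baseModule k Y) where
  toFun r := LinearMap.lcomp k _ (smulHom N r.unop)
  map_one' := by ext; simp
  map_mul' r r' := by ext; simp
  map_zero' := by ext; simp
  map_add' r r' := by ext; simp
  commutes' c := by ext f n; exact map_smul f c n

theorem commute_homAction (N Y : ModuleCat.{u} R) (r : R) (r' : Rᵐᵒᵖ) :
    Commute (homActionLeft (k := k) N Y r) (homActionRight N Y r') := by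
  change _ * _ = _ * _
  ext
  rfl

/-- The action of the enveloping algebra on `Hom_k(N, Y)`. -/
def envHomAction (N Y : ModuleCat.{u} R) :
    Env k R →ₐ[k] Module.End k (baseModule k N →ₗ[k] baseModule k Y) :=
  Algebra.TensorProduct.lift (homActionLeft N Y) (homActionRight N Y) (commute_homAction N Y)

theorem envHomAction_tmul (N Y : ModuleCat.{u} R) (x y : R)
    (f : baseModule k N →ₗ[k] baseModule k Y) (n : N) :
    envHomAction N Y (x ⊗ₜ[k] MulOpposite.op y) f n =
      (show Y from x • (show Y from f (show N from y • n))) := by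
  rw [envHomAction, Algebra.TensorProduct.lift_tmul]
  rfl

/-- The `R`-bimodule `Hom_k(N, Y)`. -/
def homBimodule (N Y : ModuleCat.{u} R) : ModuleCat.{u} (Env k R) :=
  (ModuleCat.restrictScalars (envHomAction (k := k) N Y).toRingHom).obj
    (ModuleCat.of _ (baseModule k N →ₗ[k] baseModule k Y))

/-- A homomorphism of bimodules, from its compatibility with pure tensors. -/
def envHom {V W : ModuleCat.{u} (Env k R)} (f : V →+ W)
    (h : ∀ (x y : R) (v : V), f ((x ⊗ₜ[k] MulOpposite.op y : Env k R) • v) =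
      (x ⊗ₜ[k] MulOpposite.op y : Env k R) • f v) : V ⟶ W :=
  ModuleCat.ofHom
    { f with
      map_smul' := fun e v => by
        change f (e • v) = e • f v
        induction e using TensorProduct.induction_on with
        | zero =>
          have h0 : (0 : Env k R) • v = 0 := zero_smul (Env k R) v
          have h1 : (0 : Env k R) • f v = 0 := zero_smul (Env k R) (f v)
          exact (congrArg f h0).trans ((map_zero f).trans h1.symm)
        | tmul x y =>
          obtain ⟨y, rfl⟩ := MulOpposite.op_surjective y
          exact h x y v
        | add e e' he he' => rw [add_smul, add_smul, ← he, ← he', map_add] }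

theorem tmk_env_smul (V : ModuleCat.{u} (Env k R)) {N : ModuleCat.{u} R} (x y : R) (v : V) (n : N) :
    tmk V (show leftModule V from (x ⊗ₜ[k] MulOpposite.op y : Env k R) • v) n =
      x • tmk V (show leftModule V from v) (y • n) := by
  refine Eq.trans ?_ (congrArg (x • ·) (tmk_rightMul V (show leftModule V from v) y n))
  refine Eq.trans (congrArg (fun w => tmk V (N := N) w n) ?_) (tmk_smul V x _ n)
  change _ = (x ⊗ₜ[k] 1 : Env k R) • ((1 ⊗ₜ[k] MulOpposite.op y : Env k R) • v)
  rw [smul_smul, Algebra.TensorProduct.tmul_mul_tmul, mul_one, one_mul]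

/-- In `R ⊗[k] Rᵐᵒᵖ` a scalar of `k` may be moved across the tensor sign, so `k` acts centrally on
every bimodule. This makes the curried maps `k`-linear. -/
theorem tmk_algebraMap_smul (V : ModuleCat.{u} (Env k R)) {N : ModuleCat.{u} R} (c : k)
    (v : leftModule V) (n : N) : tmk V v (algebraMap k R c • n) = algebraMap k R c • tmk V v n := by
  have h := tmk_env_smul V 1 (algebraMap k R c) (show V from v) n
  rw [one_smul] at h
  refine h.symm.trans (Eq.trans (congrArg (fun w => tmk V (N := N) w n) ?_) (tmk_smul V _ v n))
  change _ = (algebraMap k R c ⊗ₜ[k] 1 : Env k R) • (show V from v)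
  rw [Algebra.algebraMap_eq_smul_one, MulOpposite.op_smul, TensorProduct.tmul_smul,
    TensorProduct.smul_tmul', MulOpposite.op_one]

/-- The map of bimodules `V → Hom_k(N, Y)` given by a linear map `V ⊗_R N → Y`. -/
def bimoduleCurry {V : ModuleCat.{u} (Env k R)} {N Y : ModuleCat.{u} R}
    (χ : (tensorFunctor V).obj N ⟶ Y) : V ⟶ homBimodule (k := k) N Y :=
  envHom (W := homBimodule (k := k) N Y)
    { toFun := fun v => show baseModule k N →ₗ[k] baseModule k Y from
        { toFun := fun n => χ.hom (tmk V (show leftModule V from v) n)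
          map_add' := fun n n' =>
            (congrArg _ (tmk_add_right V (show leftModule V from v) n n')).trans (map_add χ.hom _ _)
          map_smul' := fun c n =>
            (congrArg χ.hom (tmk_algebraMap_smul V c (show leftModule V from v) n)).trans
              (map_smul χ.hom _ _) }
      map_zero' := LinearMap.ext fun n =>
        (congrArg χ.hom ((congrArg Submodule.Quotient.mk (TensorProduct.zero_tmul _ _)).trans
          (Submodule.Quotient.mk_zero _))).trans (map_zero χ.hom)
      map_add' := fun v v' => LinearMap.ext fun n =>
        (congrArg _ (tmk_add_left V (show leftModule V from v) v' n)).trans (map_add χ.hom _ _) }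
    (fun x y v => LinearMap.ext fun n => by
      refine Eq.trans ?_ (envHomAction_tmul N Y x y _ (show N from n)).symm
      exact (congrArg χ.hom (tmk_env_smul V x y v (show N from n))).trans (map_smul χ.hom _ _))

/-- The linear map `V ⊗_R N → Y` given by a map of bimodules `V → Hom_k(N, Y)`. -/
def bimoduleUncurry {V : ModuleCat.{u} (Env k R)} {N Y : ModuleCat.{u} R}
    (g : V ⟶ homBimodule (k := k) N Y) : (tensorFunctor V).obj N ⟶ Y :=
  have h (x y : R) (v : V) (n : N) : (show baseModule k N →ₗ[k] baseModule k Y from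
      g.hom ((x ⊗ₜ[k] MulOpposite.op y : Env k R) • v)) n =
        (show Y from x • (show Y from (show baseModule k N →ₗ[k] baseModule k Y from g.hom v)
          (show N from y • n))) :=
    (congrArg (fun f => (show baseModule k N →ₗ[k] baseModule k Y from f) n)
      (map_smul g.hom (x ⊗ₜ[k] MulOpposite.op y : Env k R) v)).trans (envHomAction_tmul N Y x y _ n)
  ModuleCat.ofHom (tensorLift V
    { toFun := fun n => show leftModule V →ₗ[R] Y from
        { toFun := fun v => (show baseModule k N →ₗ[k] baseModule k Y from g.hom v) n
          map_add' := fun v v' => congrArg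
            (fun f => (show baseModule k N →ₗ[k] baseModule k Y from f) n)
              (map_add g.hom (show V from v) v')
          map_smul' := fun r v => by
            refine (h r 1 v n).trans ?_
            rw [one_smul]
            rfl }
      map_add' := fun n n' => LinearMap.ext fun v =>
        map_add (show baseModule k N →ₗ[k] baseModule k Y from g.hom v) n n'
      map_smul' := fun r n => LinearMap.ext fun v =>
        ((h 1 r v n).trans (one_smul R _)).symm })

theorem bimoduleUncurry_tmk {V : ModuleCat.{u} (Env k R)} {N Y : ModuleCat.{u} R}
    (g : V ⟶ homBimodule (k := k) N Y) (v : leftModule V) (n : N) :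
    (bimoduleUncurry g).hom (tmk V v n) =
      (show baseModule k N →ₗ[k] baseModule k Y from g.hom (show V from v)) n := rfl

/-- The functoriality of the bimodule `Hom_k(N, Y)`. -/
def homBimoduleMap {N N' Y Y' : ModuleCat.{u} R} (f : N' ⟶ N) (g : Y ⟶ Y') :
    homBimodule (k := k) N Y ⟶ homBimodule (k := k) N' Y' :=
  envHom (V := homBimodule (k := k) N Y) (W := homBimodule (k := k) N' Y')
    { toFun := fun l => LinearMap.comp
        ((ModuleCat.restrictScalars (algebraMap k R)).map g).hom
          (LinearMap.comp (show baseModule k N →ₗ[k] baseModule k Y from l)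
            ((ModuleCat.restrictScalars (algebraMap k R)).map f).hom)
      map_zero' := LinearMap.ext fun n => map_zero g.hom
      map_add' := fun l l' => LinearMap.ext fun n => map_add g.hom _ _ }
    (fun x y l => LinearMap.ext fun n => by
      refine Eq.trans ?_ (envHomAction_tmul N' Y' x y _ (show N' from n)).symm
      refine (congrArg g.hom (envHomAction_tmul N Y x y _ (f.hom n))).trans ?_
      refine (map_smul g.hom x _).trans ?_
      exact congrArg (fun n => x • g.hom ((show baseModule k N →ₗ[k] baseModule k Y from l) n))
        (map_smul f.hom y (show N' from n)).symm)

/-- Over the field `k` an injection has a linear retraction, along which maps extend; the next lemma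
uses a linear section of a surjection in the same way. -/
theorem homBimoduleMap_surjective_left {N N' Y : ModuleCat.{u} R} (f : N' ⟶ N) [Mono f] :
    Epi (homBimoduleMap (k := k) f (𝟙 Y)) := by
  rw [ModuleCat.epi_iff_surjective]
  intro l
  obtain ⟨r, hr⟩ := LinearMap.exists_leftInverse_of_injective
    ((ModuleCat.restrictScalars (algebraMap k R)).map f).hom
    (LinearMap.ker_eq_bot.2 ((ModuleCat.mono_iff_injective f).1 inferInstance))
  refine ⟨show baseModule k N →ₗ[k] baseModule k Y from
    LinearMap.comp (show baseModule k N' →ₗ[k] baseModule k Y from l) r, ?_⟩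
  exact LinearMap.ext fun n => congrArg (show baseModule k N' →ₗ[k] baseModule k Y from l)
    (LinearMap.congr_fun hr n)

theorem homBimoduleMap_surjective_right {N Y Y' : ModuleCat.{u} R} (g : Y ⟶ Y') [Epi g] :
    Epi (homBimoduleMap (k := k) (𝟙 N) g) := by
  rw [ModuleCat.epi_iff_surjective]
  intro l
  obtain ⟨r, hr⟩ := LinearMap.exists_rightInverse_of_surjective
    ((ModuleCat.restrictScalars (algebraMap k R)).map g).hom
    (LinearMap.range_eq_top.2 ((ModuleCat.epi_iff_surjective g).1 inferInstance))
  refine ⟨show baseModule k N →ₗ[k] baseModule k Y from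
    LinearMap.comp r (show baseModule k N →ₗ[k] baseModule k Y' from l), ?_⟩
  exact LinearMap.ext fun n => LinearMap.congr_fun hr
    ((show baseModule k N →ₗ[k] baseModule k Y' from l) n)

/-- `Hom_R(V ⊗_R N, Y)` is `Hom(V, Hom_k(N, Y))` over the enveloping algebra, and `Hom_k(N, -)`
preserves epimorphisms, so the lifting problem is solved among bimodules. -/
instance projective_tensor (V : ModuleCat.{u} (Env k R)) [Projective V] (N : ModuleCat.{u} R) :
    Projective ((tensorFunctor V).obj N) where
  factors {Y Y'} f e he := by
    have := homBimoduleMap_surjective_right (k := k) (N := N) e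
    obtain ⟨l, hl⟩ := Projective.factors (bimoduleCurry f) (homBimoduleMap (𝟙 N) e)
    refine ⟨bimoduleUncurry l, ?_⟩
    refine ModuleCat.hom_ext (balancedTensor_hom_ext fun v n => ?_)
    change e.hom ((bimoduleUncurry l).hom (tmk V v n)) = f.hom (tmk V v n)
    rw [bimoduleUncurry_tmk]
    exact congrArg (fun h => (show baseModule k N →ₗ[k] baseModule k Y' from h.hom v) n) hl

/-- The curried identity `V → Hom_k(N, V ⊗_R N)` lifts to `Hom_k(N', V ⊗_R N)`. Uncurrying the lift
gives a retraction, so `V ⊗_R f` is even a split monomorphism. -/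
instance preservesMonomorphisms_tensor (V : ModuleCat.{u} (Env k R)) [Projective V] :
    (tensorFunctor V).PreservesMonomorphisms where
  preserves {N N'} f _ := by
    let Y := (tensorFunctor V).obj N
    have := homBimoduleMap_surjective_left (k := k) (Y := Y) f
    obtain ⟨l, hl⟩ := Projective.factors (bimoduleCurry (𝟙 Y)) (homBimoduleMap f (𝟙 Y))
    have h : (tensorFunctor V).map f ≫ bimoduleUncurry l = 𝟙 _ := by
      refine ModuleCat.hom_ext (balancedTensor_hom_ext fun v n => ?_)
      change (bimoduleUncurry l).hom (tmk V v (f.hom n)) = tmk V v n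
      rw [bimoduleUncurry_tmk]
      exact congrArg (fun h => (show baseModule k N →ₗ[k] baseModule k Y from h.hom v) n) hl
    exact (SplitMono.mk _ h).mono

end Central

/-! ### Homological dimensions of `Hom_R(V, E)` and `V ⊗_R N`. -/

section ProjectiveDimension

variable {k : Type w} [Field k] {R : Type u} [Ring R] [Algebra k R]

/-- The dual of a bimodule of finite projective dimension has finite injective dimension. -/
theorem hasInjectiveDimensionLT_homFunctor (E : ModuleCat.{u} R) [Injective E] (n : ℕ)
    (V : ModuleCat.{u} (Env k R)) (hV : HasProjectiveDimensionLT V (n + 1)) :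
    HasInjectiveDimensionLT ((homFunctor V).obj E) (n + 1) := by
  -- `Hom_R(P, -)` is right adjoint to `P ⊗_R -`, which preserves monomorphisms for projective `P`.
  have key (P : ModuleCat.{u} (Env k R)) [Projective P] : Injective ((homFunctor P).obj E) :=
    Injective.injective_of_adjoint (tensorHomAdj P) E
  induction n generalizing V with
  | zero =>
    have := (projective_iff_hasProjectiveDimensionLT_one (X := V)).2 hV
    have := key V
    exact inferInstanceAs (HasInjectiveDimensionLT _ 1)
  | succ n ih =>
    let S := ShortComplex.mk (kernel.ι (Projective.π V)) (Projective.π V) (kernel.condition _)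
    have hS : S.ShortExact := { exact := ShortComplex.exact_kernel _ }
    have := key (Projective.over V)
    exact (homMapLeft_shortExact hS E).hasInjectiveDimensionLT_X₁ (n + 1)
      (ih _ (hS.hasProjectiveDimensionLT_X₁ (n + 1)
        (hasProjectiveDimensionLT_of_ge (Projective.over V) 1 _ (by lia)) hV))
      (hasInjectiveDimensionLT_of_ge ((homFunctor (Projective.over V)).obj E) 1 _ (by lia))

/-- If `Tor(V, N)` vanishes, the projective dimension of `V ⊗_R N` is at most that of `V`. -/
theorem hasProjectiveDimensionLT_tensor {E : ModuleCat.{u} R} [Injective E] (hE : IsCoseparator E)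
    (n : ℕ) (V : ModuleCat.{u} (Env k R)) (hV : HasProjectiveDimensionLT V (n + 1))
    (N : ModuleCat.{u} R) (hN : ExtAcyclic ((homFunctor V).obj E) N) :
    HasProjectiveDimensionLT ((tensorFunctor V).obj N) (n + 1) := by
  induction n generalizing V with
  | zero =>
    have := (projective_iff_hasProjectiveDimensionLT_one (X := V)).2 hV
    exact inferInstanceAs (HasProjectiveDimensionLT _ 1)
  | succ n ih =>
    let S := ShortComplex.mk (kernel.ι (Projective.π V)) (Projective.π V) (kernel.condition _)
    have hS : S.ShortExact := { exact := ShortComplex.exact_kernel _ }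
    -- This is the middle term of `0 → Hom_R(V, E) → Hom_R(P, E) → Hom_R(ΩV, E) → 0`. Its
    -- injectivity passes the acyclicity of `N` from `V` to the syzygy bimodule `ΩV`.
    have : Injective ((homFunctor (Projective.over V)).obj E) :=
      Injective.injective_of_adjoint (tensorHomAdj (Projective.over V)) E
    exact (tensorMapLeft_shortExact hS hE hN).hasProjectiveDimensionLT_X₃ (n + 1)
      (ih _ (hS.hasProjectiveDimensionLT_X₁ (n + 1)
        (hasProjectiveDimensionLT_of_ge (Projective.over V) 1 _ (by lia)) hV)
        (ExtAcyclic.X₃_right (homMapLeft_shortExact hS E) hN))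
      (hasProjectiveDimensionLT_of_ge ((tensorFunctor (Projective.over V)).obj N) 1 _ (by lia))

end ProjectiveDimension

/-! ### Extension of scalars along a noncommutative ring map. -/

section Induction

variable {R S : Type u} [Ring R] [Ring S] (f : R →+* S)

/-- The relations `s f(r) ⊗ n = s ⊗ r n`, as an `S`-submodule of `S ⊗_ℤ N`. -/
def inducedRelations (N : ModuleCat.{u} R) : Submodule S (S ⊗[ℤ] N) :=
  Submodule.span S {t | ∃ (s : S) (r : R) (n : N), t = (s * f r) ⊗ₜ[ℤ] n - s ⊗ₜ[ℤ] (r • n)}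

/-- The extension of scalars `S ⊗_R N`. -/
abbrev Induced (N : ModuleCat.{u} R) : Type u := (S ⊗[ℤ] N) ⧸ inducedRelations f N

variable {f} in
/-- The class of `s ⊗ n`. -/
def imk {N : ModuleCat.{u} R} (s : S) (n : N) : Induced f N :=
  Submodule.Quotient.mk (s ⊗ₜ[ℤ] n)

variable {f}

theorem imk_mul {N : ModuleCat.{u} R} (s : S) (r : R) (n : N) :
    (imk (s * f r) n : Induced f N) = imk s (r • n) :=
  (Submodule.Quotient.eq _).2 (Submodule.subset_span ⟨s, r, n, rfl⟩)

theorem imk_map {N : ModuleCat.{u} R} (r : R) (n : N) :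
    (imk (f r) n : Induced f N) = imk 1 (r • n) := by
  rw [← imk_mul, one_mul]

theorem imk_add_left {N : ModuleCat.{u} R} (s s' : S) (n : N) :
    (imk (s + s') n : Induced f N) = imk s n + imk s' n := by
  simp only [imk, TensorProduct.add_tmul, Submodule.Quotient.mk_add]

theorem imk_add_right {N : ModuleCat.{u} R} (s : S) (n n' : N) :
    (imk s (n + n') : Induced f N) = imk s n + imk s n' := by
  simp only [imk, TensorProduct.tmul_add, Submodule.Quotient.mk_add]

theorem smul_imk {N : ModuleCat.{u} R} (s s' : S) (n : N) :
    s • (imk s' n : Induced f N) = imk (s * s') n := rfl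

theorem induced_induction {N : ModuleCat.{u} R} {p : Induced f N → Prop} (x : Induced f N)
    (h0 : p 0) (h : ∀ s n, p (imk s n)) (hadd : ∀ x y, p x → p y → p (x + y)) : p x := by
  obtain ⟨x, rfl⟩ := Submodule.Quotient.mk_surjective _ x
  induction x using TensorProduct.induction_on with
  | zero => exact h0
  | tmul s n => exact h s n
  | add x y hx hy => exact hadd _ _ hx hy

theorem induced_hom_ext {N : ModuleCat.{u} R} {P : Type*} [AddCommGroup P] [Module S P]
    {g h : Induced f N →ₗ[S] P} (H : ∀ n : N, g (imk 1 n) = h (imk 1 n)) : g = h := by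
  refine LinearMap.ext fun x => ?_
  refine induced_induction (p := fun x => g x = h x) x ((map_zero g).trans (map_zero h).symm) (fun s n => ?_)
    (fun x y hx hy => by rw [map_add, map_add, hx, hy])
  rw [← mul_one s, ← smul_imk, map_smul, map_smul, H]

/-- Additive maps out of `S ⊗_R N`. -/
def inducedLift {N : ModuleCat.{u} R} {P : Type*} [AddCommGroup P] (g : S →+ N →+ P)
    (hg : ∀ s r n, g (s * f r) n = g s (r • n)) : Induced f N →+ P :=
  let t : S ⊗[ℤ] N →+ P := TensorProduct.liftAddHom g (fun c s n => by rw [map_zsmul, map_zsmul, AddMonoidHom.zsmul_apply])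
  QuotientAddGroup.lift (inducedRelations f N).toAddSubgroup t (by
    -- The relations span an `S`-submodule but `t` is only additive, so the induction has to run
    -- over all multiples `s • x` at once.
    suffices h : ∀ x ∈ inducedRelations f N, ∀ s : S, t (s • x) = 0 from
      fun x hx => by simpa using h x hx 1
    intro x hx
    refine Submodule.span_induction ?_ ?_ ?_ ?_ hx
    · rintro _ ⟨s, r, n, rfl⟩ s'
      rw [smul_sub, map_sub, TensorProduct.smul_tmul', TensorProduct.smul_tmul', sub_eq_zero]
      change g (s' * (s * f r)) n = g (s' * s) (r • n)
      rw [← mul_assoc, hg]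
    · intro s
      rw [smul_zero, map_zero]
    · intro x y _ _ hx hy s
      rw [smul_add, map_add, hx, hy, add_zero]
    · intro s' x _ hx s
      rw [smul_smul, hx])

/-- The biadditive map `S × N → Y` given by an `R`-linear map `N → Y`. -/
def inducedBiadd {N : ModuleCat.{u} R} {Y : ModuleCat.{u} S}
    (g : N ⟶ (ModuleCat.restrictScalars f).obj Y) : S →+ N →+ Y :=
  let g' : N →+ Y := g.hom.toAddMonoidHom
  (AddMonoidHom.compl₂ (smulAddHom S Y) g')

/-- The `S`-linear map `S ⊗_R N → Y` given by an `R`-linear map `N → Y`. -/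
def inducedDesc {N : ModuleCat.{u} R} {Y : ModuleCat.{u} S}
    (g : N ⟶ (ModuleCat.restrictScalars f).obj Y) : Induced f N →ₗ[S] Y :=
  let l : Induced f N →+ Y := inducedLift (inducedBiadd g)
    (fun s r n => (mul_smul s (f r) (show Y from g.hom n)).trans
        (congrArg (fun y : Y => s • y) (map_smul g.hom r n).symm))
  { toFun := l
    map_add' := map_add l
    map_smul' := fun s x => by
      refine induced_induction (p := fun x => l (s • x) = s • l x) x ?_
        (fun s' n => mul_smul s s' (show Y from g.hom n)) (fun x y hx hy => ?_)
      · rw [smul_zero, map_zero, smul_zero]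
      · rw [smul_add, map_add, hx, hy, map_add, smul_add] }

variable (f)

/-- The map `N → S ⊗_R N`. -/
def inducedUnit (N : ModuleCat.{u} R) :
    N ⟶ (ModuleCat.restrictScalars f).obj (ModuleCat.of S (Induced f N)) :=
  ModuleCat.ofHom (Y := (ModuleCat.restrictScalars f).obj (ModuleCat.of S (Induced f N)))
    { toFun := fun n => (imk 1 n : Induced f N)
      map_add' := fun n n' => imk_add_right 1 n n'
      map_smul' := fun r n => (imk_map r n).symm.trans
        ((congrArg (fun s => (imk s n : Induced f N)) (mul_one (f r)).symm).trans
          (smul_imk (f r) 1 n).symm) }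

/-- Extension of scalars along a homomorphism of (noncommutative) rings. -/
def induce : ModuleCat.{u} R ⥤ ModuleCat.{u} S where
  obj N := ModuleCat.of S (Induced f N)
  map {N N'} g := ModuleCat.ofHom (inducedDesc (Y := ModuleCat.of S (Induced f N'))
    (g ≫ inducedUnit f N'))
  map_id N := ModuleCat.hom_ext (induced_hom_ext fun n => one_smul S (imk 1 n : Induced f N))
  map_comp {N N' N''} g g' := ModuleCat.hom_ext (induced_hom_ext fun n => by
    refine (one_smul S (imk 1 (g'.hom (g.hom n)) : Induced f N'')).trans ?_
    refine Eq.trans ?_ (congrArg (inducedDesc (Y := ModuleCat.of S (Induced f N''))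
      (g' ≫ inducedUnit f N'')) (one_smul S (imk 1 (g.hom n) : Induced f N'))).symm
    exact (one_smul S (imk 1 (g'.hom (g.hom n)) : Induced f N'')).symm)

theorem induce_map_imk {N N' : ModuleCat.{u} R} (g : N ⟶ N') (s : S) (n : N) :
    ((induce f).map g).hom (imk s n) = (imk s (g.hom n) : Induced f N') :=
  (smul_imk s 1 (g.hom n)).trans (congrArg (fun s => (imk s (g.hom n) : Induced f N')) (mul_one s))

/-- The adjunction between extension and restriction of scalars. -/
def induceAdj : induce f ⊣ ModuleCat.restrictScalars f :=
  Adjunction.mkOfHomEquiv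
    { homEquiv := fun N Y =>
        { toFun := fun g => inducedUnit f N ≫ (ModuleCat.restrictScalars f).map g
          invFun := fun g => ModuleCat.ofHom (inducedDesc g)
          left_inv := fun g => ModuleCat.hom_ext (induced_hom_ext fun n => one_smul S _)
          right_inv := fun g => ModuleCat.hom_ext (LinearMap.ext fun n =>
            one_smul S (show Y from g.hom n)) }
      homEquiv_naturality_left_symm := fun {N N' Y} g h =>
        ModuleCat.hom_ext (induced_hom_ext fun n => by
          refine (one_smul S (show Y from h.hom (g.hom n))).trans ?_
          refine Eq.trans ?_ (congrArg (inducedDesc h) (induce_map_imk f g 1 n)).symm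
          exact (one_smul S (show Y from h.hom (g.hom n))).symm)
      homEquiv_naturality_right := fun g h => rfl }

theorem induceAdj_unit_app (N : ModuleCat.{u} R) : (induceAdj f).unit.app N = inducedUnit f N := by
  simp only [induceAdj, Adjunction.mkOfHomEquiv_unit_app]
  rfl

instance : (induce f).Additive := (induceAdj f).left_adjoint_additive

theorem finite_induced (N : ModuleCat.{u} R) [Module.Finite R N] :
    Module.Finite S ((induce f).obj N) := by
  obtain ⟨s, hs⟩ := Module.finite_def.1 ‹Module.Finite R N›
  classical
  refine Module.finite_def.2 ⟨s.image fun n => (imk 1 n : Induced f N), ?_⟩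
  rw [eq_top_iff]
  have h1 (n : N) : (imk 1 n : Induced f N) ∈ Submodule.span S
      (s.image fun n => (imk 1 n : Induced f N) : Set (Induced f N)) := by
    have hn : n ∈ Submodule.span R (s : Set N) := hs ▸ Submodule.mem_top
    refine Submodule.span_induction (fun n hn => ?_) ?_ (fun n n' _ _ h h' => ?_)
      (fun r n _ h => ?_) hn
    · exact Submodule.subset_span (Finset.mem_coe.2 (Finset.mem_image_of_mem _ hn))
    · rw [show (imk 1 (0 : N) : Induced f N) = 0 from map_zero (inducedUnit f N).hom]
      exact Submodule.zero_mem _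
    · rw [imk_add_right]
      exact Submodule.add_mem _ h h'
    · rw [← imk_map, ← mul_one (f r), ← smul_imk]
      exact Submodule.smul_mem _ _ h
  intro x _
  refine induced_induction (p := fun x => x ∈ Submodule.span S _) x (Submodule.zero_mem _)
    (fun t n => ?_) (fun x y hx hy => Submodule.add_mem _ hx hy)
  rw [← mul_one t, ← smul_imk]
  exact Submodule.smul_mem _ _ (h1 n)

end Induction

/-! ### The induction sequence of a split extension. -/

section Split

variable {k : Type w} [Field k] {R A : Type u} [Ring R] [Algebra k R] [Ring A] [Algebra k A]
  (φ : R →ₐ[k] A) (π : A →ₐ[k] R)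

/-- The class in `A / R` of an element of `A`. -/
def quotientMk : A →+ leftModule (quotientBimodule φ) :=
  let l : bimodule φ →ₗ[Env k R] quotientBimodule φ := (LinearMap.range (bimoduleHom φ).hom).mkQ
  { toFun := l
    map_zero' := map_zero l
    map_add' := map_add l }

theorem quotientMk_map (r : R) : quotientMk φ (φ r) = 0 :=
  (Submodule.Quotient.mk_eq_zero _).2 ⟨(show bimodule (AlgHom.id k R) from (r : R)), rfl⟩

theorem quotientMk_surjective : Function.Surjective (quotientMk φ) :=
  Submodule.Quotient.mk_surjective (LinearMap.range (bimoduleHom φ).hom)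

theorem quotientMk_mul_right (a : A) (r : R) :
    quotientMk φ (a * φ r) = rightMul (quotientBimodule φ) (quotientMk φ a) r :=
  congrArg (quotientMk φ) (show a * φ r = envAction φ (1 ⊗ₜ[k] MulOpposite.op r) a by
    rw [envAction_tmul, map_one, one_mul])

theorem quotientMk_mul_left (a : A) (r : R) :
    quotientMk φ (φ r * a) = r • quotientMk φ a :=
  congrArg (quotientMk φ) (show φ r * a = envAction φ (r ⊗ₜ[k] MulOpposite.op 1) a by
    rw [envAction_tmul, map_one, mul_one])

/-- The additive map `A ⊗_R N → A / R ⊗_R N`. -/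
def inducedToTensorAdd (N : ModuleCat.{u} R) :
    Induced φ.toRingHom N →+ BalancedTensor (quotientBimodule φ) N :=
  inducedLift
    { toFun := fun a =>
        { toFun := fun n => tmk (quotientBimodule φ) (quotientMk φ a) n
          map_zero' := map_zero (tensorCurry (quotientBimodule φ)
            (Y := (tensorFunctor (quotientBimodule φ)).obj N) LinearMap.id) |> fun h =>
              congrArg (fun g : HomModule (quotientBimodule φ)
                ((tensorFunctor (quotientBimodule φ)).obj N) =>
                (show leftModule (quotientBimodule φ) →ₗ[R] _ from g) (quotientMk φ a)) h
          map_add' := fun n n' => tmk_add_right _ _ n n' }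
      map_zero' := AddMonoidHom.ext fun n => by
        refine (congrArg (fun v => tmk (quotientBimodule φ) v n) (map_zero (quotientMk φ))).trans ?_
        have := tmk_smul (quotientBimodule φ) (0 : R) 0 n
        rw [zero_smul, zero_smul] at this
        exact this
      map_add' := fun a a' => AddMonoidHom.ext fun n =>
        (congrArg (fun v => tmk (quotientBimodule φ) v n) (map_add (quotientMk φ) a a')).trans
          (tmk_add_left (quotientBimodule φ) _ _ n) }
    (fun a r n => (congrArg (fun v => tmk (quotientBimodule φ) v n)
      (quotientMk_mul_right φ a r)).trans (tmk_rightMul (quotientBimodule φ) _ r n))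

theorem inducedToTensorAdd_imk (N : ModuleCat.{u} R) (a : A) (n : N) :
    inducedToTensorAdd φ N (imk a n) = tmk (quotientBimodule φ) (quotientMk φ a) n := rfl

/-- The map `A ⊗_R N → A / R ⊗_R N`. -/
def inducedToTensor (N : ModuleCat.{u} R) :
    (ModuleCat.restrictScalars φ.toRingHom).obj ((induce φ.toRingHom).obj N) ⟶
      (tensorFunctor (quotientBimodule φ)).obj N :=
  ModuleCat.ofHom
    (X := (ModuleCat.restrictScalars φ.toRingHom).obj ((induce φ.toRingHom).obj N))
    { toFun := inducedToTensorAdd φ N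
      map_add' := map_add (inducedToTensorAdd φ N)
      map_smul' := fun r x => by
        refine induced_induction (p := fun x => inducedToTensorAdd φ N (φ r • x) =
          r • inducedToTensorAdd φ N x) x ?_ (fun a n => ?_) (fun x y hx hy => ?_)
        · rw [smul_zero, map_zero, smul_zero]
        · rw [smul_imk, inducedToTensorAdd_imk, inducedToTensorAdd_imk, quotientMk_mul_left]
          rfl
        · rw [smul_add, map_add, hx, hy, map_add, smul_add] }

theorem inducedToTensor_naturality {N N' : ModuleCat.{u} R} (g : N ⟶ N') :
    (ModuleCat.restrictScalars φ.toRingHom).map ((induce φ.toRingHom).map g) ≫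
      inducedToTensor φ N' = inducedToTensor φ N ≫ (tensorFunctor (quotientBimodule φ)).map g := by
  refine ModuleCat.hom_ext (LinearMap.ext fun x => ?_)
  let l : Induced φ.toRingHom N →+ Induced φ.toRingHom N' :=
    ((induce φ.toRingHom).map g).hom.toAddMonoidHom
  let t : BalancedTensor (quotientBimodule φ) N →+ BalancedTensor (quotientBimodule φ) N' :=
    (tensorMap (quotientBimodule φ) g).toAddMonoidHom
  change inducedToTensorAdd φ N' (l x) = t (inducedToTensorAdd φ N x)
  refine induced_induction (p := fun x => inducedToTensorAdd φ N' (l x) =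
    t (inducedToTensorAdd φ N x)) x ?_ (fun a n => ?_) (fun x y hx hy => ?_)
  · rw [map_zero, map_zero, map_zero, map_zero]
  · exact congrArg (inducedToTensorAdd φ N') (induce_map_imk _ g a n)
  · rw [map_add, map_add, map_add, map_add, hx, hy]

theorem inducedUnit_comp_inducedToTensor (N : ModuleCat.{u} R) :
    inducedUnit φ.toRingHom N ≫ inducedToTensor φ N = 0 := by
  refine ModuleCat.hom_ext (LinearMap.ext fun n => ?_)
  change inducedToTensorAdd φ N (imk 1 n) = 0
  have h : quotientMk φ 1 = 0 := by rw [← map_one φ, quotientMk_map]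
  rw [inducedToTensorAdd_imk, h]
  have := tmk_smul (quotientBimodule φ) (0 : R) 0 n
  rw [zero_smul, zero_smul] at this
  exact this

variable {φ π} (h : ∀ r, π (φ r) = r)

/-- The additive map `A / R → A` given by the splitting. -/
def quotientSection : leftModule (quotientBimodule φ) →+ A :=
  QuotientAddGroup.lift (LinearMap.range (bimoduleHom φ).hom).toAddSubgroup
    (AddMonoidHom.id A - (φ.toRingHom.comp π.toRingHom).toAddMonoidHom : A →+ A) (by
      rintro _ ⟨r, rfl⟩
      change φ (show R from r) - φ (π (φ (show R from r))) = 0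
      rw [h, sub_self])

theorem quotientSection_mk (a : A) : quotientSection h (quotientMk φ a) = a - φ (π a) := rfl

theorem quotientSection_rightMul (v : leftModule (quotientBimodule φ)) (r : R) :
    quotientSection h (rightMul _ v r) = quotientSection h v * φ r := by
  obtain ⟨a, rfl⟩ := quotientMk_surjective φ v
  rw [← quotientMk_mul_right, quotientSection_mk, quotientSection_mk, map_mul, h, map_mul, sub_mul]

/-- The retraction `A ⊗_R N → N` given by the splitting. -/
def inducedRetraction (N : ModuleCat.{u} R) : Induced φ.toRingHom N →+ N :=
  inducedLift ((smulAddHom R N).comp π.toRingHom.toAddMonoidHom) (fun a r n => by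
    change π (a * φ r) • n = π a • r • n
    rw [map_mul, h, mul_smul])

theorem inducedRetraction_imk (N : ModuleCat.{u} R) (a : A) (n : N) :
    inducedRetraction h N (imk a n) = π a • n := rfl

/-- The additive map `A / R ⊗_R N → A ⊗_R N` given by the splitting. -/
def tensorToInduced (N : ModuleCat.{u} R) :
    BalancedTensor (quotientBimodule φ) N →+ Induced φ.toRingHom N :=
  QuotientAddGroup.lift (balanced (quotientBimodule φ) N).toAddSubgroup
    (TensorProduct.map (quotientSection h).toIntLinearMap LinearMap.id |>.toAddMonoidHom |>
      (Submodule.mkQ (inducedRelations φ.toRingHom N)).toAddMonoidHom.comp) (by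
    intro x hx
    change Submodule.mkQ _ (TensorProduct.map (quotientSection h).toIntLinearMap LinearMap.id x) = 0
    have key (r : R) (y : leftModule (quotientBimodule φ) ⊗[ℤ] N) :
        TensorProduct.map (quotientSection h).toIntLinearMap LinearMap.id (r • y) =
          φ r • TensorProduct.map (quotientSection h).toIntLinearMap LinearMap.id y := by
      induction y using TensorProduct.induction_on with
      | zero => rw [smul_zero, map_zero, smul_zero]
      | tmul v n =>
        obtain ⟨a, rfl⟩ := quotientMk_surjective φ v
        rw [TensorProduct.smul_tmul', ← quotientMk_mul_left]
        change (φ r * a - φ (π (φ r * a))) ⊗ₜ[ℤ] n = (φ r * (a - φ (π a))) ⊗ₜ[ℤ] n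
        rw [map_mul, h, map_mul, mul_sub]
      | add y y' hy hy' => rw [smul_add, map_add, hy, hy', map_add, smul_add]
    refine Submodule.span_induction ?_ ?_ ?_ ?_ (show x ∈ Submodule.span R _ from hx)
    · rintro _ ⟨v, r, n, rfl⟩
      rw [map_sub, map_sub, sub_eq_zero]
      change (imk (quotientSection h (rightMul _ v r)) n : Induced φ.toRingHom N) =
        imk (quotientSection h v) (r • n)
      rw [quotientSection_rightMul]
      exact imk_mul (f := φ.toRingHom) _ r n
    · rw [map_zero, map_zero]
    · intro x y _ _ hx hy
      rw [map_add, map_add, hx, hy, add_zero]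
    · intro r x _ hx
      rw [key, map_smul, hx, smul_zero])

theorem tensorToInduced_tmk (N : ModuleCat.{u} R) (v : leftModule (quotientBimodule φ)) (n : N) :
    tensorToInduced h N (tmk _ v n) = imk (quotientSection h v) n := rfl

/-- On generators this is `a ⊗ n = (a - φ (π a)) ⊗ n + 1 ⊗ π(a) n`, the decomposition of `A ⊗_R N`
given by the splitting. Exactness in the middle is read off from it. -/
theorem tensorToInduced_inducedToTensor (N : ModuleCat.{u} R) (x : Induced φ.toRingHom N) :
    tensorToInduced h N (inducedToTensorAdd φ N x) = x - imk 1 (inducedRetraction h N x) := by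
  have h0 : (imk 1 (0 : N) : Induced φ.toRingHom N) = 0 := map_zero (inducedUnit φ.toRingHom N).hom
  refine induced_induction (p := fun x => tensorToInduced h N (inducedToTensorAdd φ N x) =
    x - imk 1 (inducedRetraction h N x)) x ?_ (fun a n => ?_) (fun x y hx hy => ?_)
  · rw [map_zero, map_zero, map_zero, h0, sub_zero]
  · rw [inducedToTensorAdd_imk, tensorToInduced_tmk, quotientSection_mk, inducedRetraction_imk,
      ← imk_map, eq_sub_iff_add_eq]
    refine (imk_add_left _ _ n).symm.trans ?_
    exact congrArg (fun a => (imk a n : Induced φ.toRingHom N)) (sub_add_cancel a (φ (π a)))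
  · rw [map_add, map_add, hx, hy, map_add, imk_add_right]
    abel

variable (φ) in
/-- The sequence `0 → N → A ⊗_R N → A / R ⊗_R N → 0`. -/
abbrev inducedSequence (N : ModuleCat.{u} R) : ShortComplex (ModuleCat.{u} R) :=
  ShortComplex.mk _ _ (inducedUnit_comp_inducedToTensor φ N)

-- The retraction `a ⊗ n ↦ π(a) n` of the unit makes the sequence exact for every `N`, with no Tor
-- condition.
include h in
theorem inducedSequence_shortExact (N : ModuleCat.{u} R) : (inducedSequence φ N).ShortExact := by
  refine ShortComplex.ShortExact.mk' ?_ ?_ ?_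
  · rw [ShortComplex.moduleCat_exact_iff]
    intro x hx
    refine ⟨inducedRetraction h N x, ?_⟩
    have := tensorToInduced_inducedToTensor h N x
    rw [show inducedToTensorAdd φ N x = 0 from hx, map_zero] at this
    exact (sub_eq_zero.1 this.symm).symm
  · refine (ModuleCat.mono_iff_injective _).2 fun n n' hn => ?_
    have := congrArg (inducedRetraction h N) (show (imk 1 n : Induced φ.toRingHom N) = imk 1 n'
      from hn)
    rwa [inducedRetraction_imk, inducedRetraction_imk, map_one, one_smul, one_smul] at this
  · refine (ModuleCat.epi_iff_surjective _).2 fun x => ?_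
    obtain ⟨x, rfl⟩ := Submodule.Quotient.mk_surjective _ x
    induction x using TensorProduct.induction_on with
    | zero => exact ⟨0, map_zero _⟩
    | tmul v n =>
      obtain ⟨a, rfl⟩ := quotientMk_surjective φ v
      exact ⟨(imk a n : Induced φ.toRingHom N), rfl⟩
    | add x y hx hy =>
      obtain ⟨x', hx'⟩ := hx
      obtain ⟨y', hy'⟩ := hy
      exact ⟨x' + y', (map_add _ x' y').trans (congrArg₂ (· + ·) hx' hy')⟩

end Split

/-! ### Finite projective dimension and dimension shifting. -/

section FiniteProjectiveDimension

universe v₀ u₀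

variable {C : Type u₀} [Category.{v₀} C] [Abelian C]

/-- Objects of finite projective dimension. -/
def FinPD (X : C) : Prop := ∃ n : ℕ, HasProjectiveDimensionLT X (n + 1)

theorem FinPD.of_projective (X : C) [Projective X] : FinPD X :=
  ⟨0, inferInstanceAs (HasProjectiveDimensionLT X 1)⟩

theorem FinPD.of_isZero {X : C} (h : IsZero X) : FinPD X :=
  have := h.projective
  .of_projective X

theorem FinPD.of_retract {X Y : C} (h : FinPD Y) (r : Retract X Y) : FinPD X := by
  obtain ⟨n, hn⟩ := h
  exact ⟨n, r.hasProjectiveDimensionLT (n + 1)⟩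

theorem FinPD.of_iso {X Y : C} (h : FinPD Y) (e : X ≅ Y) : FinPD X := h.of_retract e.retract

section
variable {S : ShortComplex C} (hS : S.ShortExact)
include hS

theorem FinPD.X₂ (h₁ : FinPD S.X₁) (h₃ : FinPD S.X₃) : FinPD S.X₂ := by
  obtain ⟨n, hn⟩ := h₁
  obtain ⟨m, hm⟩ := h₃
  exact ⟨max n m, hS.hasProjectiveDimensionLT_X₂ _
    (hasProjectiveDimensionLT_of_ge S.X₁ (n + 1) _ (by lia))
    (hasProjectiveDimensionLT_of_ge S.X₃ (m + 1) _ (by lia))⟩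

theorem FinPD.X₁ (h₂ : FinPD S.X₂) (h₃ : FinPD S.X₃) : FinPD S.X₁ := by
  obtain ⟨n, hn⟩ := h₂
  obtain ⟨m, hm⟩ := h₃
  exact ⟨max n m, hS.hasProjectiveDimensionLT_X₁ _
    (hasProjectiveDimensionLT_of_ge S.X₂ (n + 1) _ (by lia))
    (hasProjectiveDimensionLT_of_ge S.X₃ (m + 1) _ (by lia))⟩

theorem FinPD.X₃ (h₁ : FinPD S.X₁) (h₂ : FinPD S.X₂) : FinPD S.X₃ := by
  obtain ⟨n, hn⟩ := h₁
  obtain ⟨m, hm⟩ := h₂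
  exact ⟨max n m + 1, hS.hasProjectiveDimensionLT_X₃ _
    (hasProjectiveDimensionLT_of_ge S.X₁ (n + 1) _ (by lia))
    (hasProjectiveDimensionLT_of_ge S.X₂ (m + 1) _ (by lia))⟩

end

/-- Dimension shifting: `(S j).X₃` is a `j`-th syzygy of `(S 0).X₃` with respect to `Y`-acyclic
middle terms. -/
theorem ext_subsingleton_iterate_syzygy [HasExt.{v₀} C] {S : ℕ → ShortComplex C}
    (hS : ∀ j, (S j).ShortExact) (e : ∀ j, (S j).X₁ ≅ (S (j + 1)).X₃) {Y : C}
    (hY : ∀ j, ExtAcyclic Y (S j).X₂) (i j : ℕ)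
    (h : Subsingleton (Abelian.Ext (S 0).X₃ Y (i + 1 + j))) :
    Subsingleton (Abelian.Ext (S j).X₃ Y (i + 1)) := by
  induction j generalizing i with
  | zero => exact h
  | succ j ih =>
    have h' := ih (i + 1) (by rwa [show i + 1 + 1 + j = i + 1 + (j + 1) by lia])
    have := ext_subsingleton_X₁ (hS j) (hY j i) h'
    refine subsingleton_of_forall_eq 0 fun x => ?_
    rw [← x.mk₀_id_comp, ← (e j).inv_hom_id, ← Abelian.Ext.mk₀_comp_mk₀,
      Abelian.Ext.comp_assoc_of_second_deg_zero,
      Subsingleton.elim ((Abelian.Ext.mk₀ (e j).hom).comp x (zero_add _)) 0, Abelian.Ext.comp_zero]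

end FiniteProjectiveDimension

section LeftAdjoint

universe v₁ u₁ v₂ u₂ v₃ u₃

variable {C : Type u₁} [Category.{v₁} C] [Abelian C] [HasExt.{v₁} C] [EnoughProjectives C]
  {D : Type u₂} [Category.{v₂} D] {L : C ⥤ D} {R : D ⥤ C} (adj : L ⊣ R)

-- A map `S.X₁ ⟶ R.obj E` extends to `S.X₂` because its adjunct extends along the monomorphism
-- `L.map S.f` into the injective `E`. This kills `Ext¹`; higher degrees follow by shifting. It
-- transfers acyclicity for `V ⊗_R -` to acyclicity for `A ⊗_R -`.
include adj in
theorem ExtAcyclic.of_mono_map {E : D} [Injective E] {Y : C}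
    (hL : ∀ {S : ShortComplex C}, S.ShortExact → ExtAcyclic Y S.X₃ → Mono (L.map S.f)) {N : C}
    (hN : ExtAcyclic Y N) : ExtAcyclic (R.obj E) N := by
  intro i
  induction i generalizing N with
  | zero =>
    let S := ShortComplex.mk (kernel.ι (Projective.π N)) (Projective.π N) (kernel.condition _)
    have hS : S.ShortExact := { exact := ShortComplex.exact_kernel _ }
    refine ext_one_subsingleton hS (ExtAcyclic.of_projective _ (Projective.over N) 0) fun f => ?_
    have := hL hS hN
    refine ⟨adj.homEquiv _ _ (Injective.factorThru ((adj.homEquiv _ _).symm f) (L.map S.f)), ?_⟩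
    rw [← Adjunction.homEquiv_naturality_left, Injective.comp_factorThru, Equiv.apply_symm_apply]
  | succ i ih =>
    let S := ShortComplex.mk (kernel.ι (Projective.π N)) (Projective.π N) (kernel.condition _)
    have hS : S.ShortExact := { exact := ShortComplex.exact_kernel _ }
    exact ext_subsingleton_X₃ hS (ih (.X₁ hS (.of_projective _ (Projective.over N)) hN))
      (ExtAcyclic.of_projective _ (Projective.over N) (i + 1))

/-- The kernel of a retraction of a monomorphism is its cokernel. -/
theorem exists_iso_kernel_of_retraction {C : Type u₁} [Category.{v₁} C] [Abelian C]
    {S S' : ShortComplex C} (hS : S.ShortExact) (hS' : S'.ShortExact) (e₂ : S.X₂ ≅ S'.X₂)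
    (h : IsIso (S.f ≫ e₂.hom ≫ S'.g)) : Nonempty (S'.X₁ ≅ S.X₃) := by
  have := hS.mono_f
  have := hS.epi_g
  have := hS'.mono_f
  have := hS'.epi_g
  let c := inv (S.f ≫ e₂.hom ≫ S'.g)
  -- The idempotent that kills the image of `S.f` and projects onto the kernel of the retraction. It
  -- factors through the cokernel `S.X₃` on one side and through `S'.X₁` on the other.
  let p : S.X₂ ⟶ S.X₂ := 𝟙 _ - e₂.hom ≫ S'.g ≫ c ≫ S.f
  have hc : (S.f ≫ e₂.hom ≫ S'.g) ≫ c = 𝟙 _ := IsIso.hom_inv_id _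
  have hc' : c ≫ (S.f ≫ e₂.hom ≫ S'.g) = 𝟙 _ := IsIso.inv_hom_id _
  have hp : S.f ≫ p = 0 := by
    simp only [p, Preadditive.comp_sub, Category.comp_id]
    simp only [Category.assoc] at hc
    rw [reassoc_of% hc, sub_self]
  have hp' : (p ≫ e₂.hom) ≫ S'.g = 0 := by
    simp only [p, Preadditive.sub_comp, Category.id_comp, Category.assoc]
    rw [show e₂.hom ≫ S'.g ≫ c ≫ S.f ≫ e₂.hom ≫ S'.g = e₂.hom ≫ S'.g ≫ (c ≫ S.f ≫ e₂.hom ≫ S'.g) from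
      rfl, hc', Category.comp_id, sub_self]
  let d := hS.exact.desc p hp
  have hd : S.g ≫ d = p := hS.exact.g_desc p hp
  have hde : (d ≫ e₂.hom) ≫ S'.g = 0 := by
    rw [← cancel_epi S.g, ← Category.assoc, ← Category.assoc, hd, hp', comp_zero]
  let l := hS'.exact.lift (d ≫ e₂.hom) hde
  have hl : l ≫ S'.f = d ≫ e₂.hom := hS'.exact.lift_f _ hde
  refine ⟨⟨S'.f ≫ e₂.inv ≫ S.g, l, ?_, ?_⟩⟩
  · rw [← cancel_mono S'.f]
    simp only [Category.assoc, hl, Category.id_comp]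
    rw [reassoc_of% hd]
    simp [p]
  · rw [← cancel_epi S.g, reassoc_of% hl, Iso.hom_inv_id_assoc, reassoc_of% hd]
    simp [p]

end LeftAdjoint

/-! ### Injective coseparators and finitely generated projectives. -/

section Coseparator

variable (R : Type u) [Ring R]

theorem exists_injective_coseparator :
    ∃ E : ModuleCat.{u} R, Injective E ∧ IsCoseparator E :=
  Abelian.has_injective_coseparator _ (isSeparator_separator (ModuleCat.{u} R))

/-- An injective coseparator in the category of `R`-modules. -/
def injectiveCoseparator : ModuleCat.{u} R := (exists_injective_coseparator R).choose

instance : Injective (injectiveCoseparator R) := (exists_injective_coseparator R).choose_spec.1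

theorem isCoseparator_injectiveCoseparator : IsCoseparator (injectiveCoseparator R) :=
  (exists_injective_coseparator R).choose_spec.2

variable {R}

theorem exists_retract_free (M : ModuleCat.{u} R) [Module.Finite R M] [Module.Projective R M] :
    ∃ n : ℕ, Nonempty (Retract M (ModuleCat.of R (Fin n → R))) := by
  obtain ⟨n, f, hf⟩ := Module.Finite.exists_fin' R M
  obtain ⟨s, hs⟩ := Module.projective_lifting_property f LinearMap.id hf
  exact ⟨n, ⟨⟨ModuleCat.ofHom s, ModuleCat.ofHom f, ModuleCat.hom_ext hs⟩⟩⟩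

/-- The sequence `0 → R → Rⁿ⁺¹ → Rⁿ → 0`. -/
def freeSequence (R : Type u) [Ring R] (n : ℕ) : ShortComplex (ModuleCat.{u} R) :=
  ShortComplex.mk (X₁ := ModuleCat.of R R) (X₂ := ModuleCat.of R (Fin (n + 1) → R))
    (X₃ := ModuleCat.of R (Fin n → R))
    (ModuleCat.ofHom (LinearMap.single R (fun _ => R) 0))
    (ModuleCat.ofHom (LinearMap.funLeft R R Fin.succ)) (ModuleCat.hom_ext (LinearMap.ext fun x => funext fun i => by
      simp [LinearMap.funLeft]
      rfl))

theorem freeSequence_shortExact (n : ℕ) : (freeSequence R n).ShortExact := by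
  refine ShortComplex.ShortExact.mk' ?_ ?_ ?_
  · rw [ShortComplex.moduleCat_exact_iff]
    intro (x : Fin (n + 1) → R) hx
    refine ⟨x 0, ?_⟩
    change (Pi.single 0 (x 0) : Fin (n + 1) → R) = x
    funext i
    refine Fin.cases ?_ (fun i => ?_) i
    · simp
    · have : x i.succ = 0 := congrFun (show (fun i : Fin n => x i.succ) = 0 from hx) i
      simp [this]
  · exact (ModuleCat.mono_iff_injective _).2 (Pi.single_injective (M := fun _ => R) 0)
  · exact (ModuleCat.epi_iff_surjective _).2
      (LinearMap.funLeft_surjective_of_injective R R _ (Fin.succ_injective n))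

/-- Finitely generated projectives are retracts of `Rⁿ`, which is built from `R` by split sequences.
Asking only for split sequences makes the principle usable with functors that are merely additive.
-/
theorem finite_projective_induction {P : ModuleCat.{u} R → Prop} (h0 : ∀ M, IsZero M → P M)
    (hR : P (ModuleCat.of R R))
    (hext : ∀ S : ShortComplex (ModuleCat.{u} R), S.Splitting → P S.X₁ → P S.X₃ → P S.X₂)
    (hret : ∀ {M N : ModuleCat.{u} R}, Retract M N → P N → P M)
    (M : ModuleCat.{u} R) [Module.Finite R M] [Module.Projective R M] : P M := by
  have key (n : ℕ) : P (ModuleCat.of R (Fin n → R)) := by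
    induction n with
    | zero => exact h0 _ (ModuleCat.isZero_of_subsingleton _)
    | succ n ih => 
      have : Projective (freeSequence R n).X₃ :=
        ModuleCat.projective_of_free (Pi.basisFun R (Fin n))
      exact hext _ (freeSequence_shortExact n).splittingOfProjective hR ih
  obtain ⟨n, ⟨r⟩⟩ := exists_retract_free M
  exact hret r (key n)

end Coseparator

/-! ### Iterated acyclicity and tensor nilpotency. -/

section TensorAcyclic

variable {k : Type w} [Field k] {R : Type u} [Ring R] [Algebra k R] (V : ModuleCat.{u} (Env k R))

instance : (tensorFunctor V).IsLeftAdjoint := (tensorHomAdj V).isLeftAdjoint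

/-- The dual `Hom_R(V, E)` of a bimodule, for an injective coseparator `E`. -/
abbrev dualModule : ModuleCat.{u} R := (homFunctor V).obj (injectiveCoseparator R)

/-- `V ⊗_R -` is acyclic on `N`, on `V ⊗_R N`, and so on, for `n` times. -/
def TensorAcyclic : ℕ → ModuleCat.{u} R → Prop
  | 0, _ => True
  | n + 1, N => ExtAcyclic (dualModule V) N ∧ TensorAcyclic n ((tensorFunctor V).obj N)

/-- The iterated functor `V^{⊗ n} ⊗_R -`. -/
def tensorIterate : ℕ → ModuleCat.{u} R ⥤ ModuleCat.{u} R
  | 0 => 𝟭 _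
  | n + 1 => tensorFunctor V ⋙ tensorIterate n

variable {V}

theorem TensorAcyclic.of_retract {n : ℕ} {N N' : ModuleCat.{u} R} (h : TensorAcyclic V n N)
    (r : Retract N' N) : TensorAcyclic V n N' := by
  induction n generalizing N N' with
  | zero => trivial
  | succ n ih => exact ⟨h.1.of_retract r, ih h.2 (r.map (tensorFunctor V))⟩

theorem TensorAcyclic.of_iso {n : ℕ} {N N' : ModuleCat.{u} R} (h : TensorAcyclic V n N)
    (e : N' ≅ N) : TensorAcyclic V n N' := h.of_retract e.retract

theorem TensorAcyclic.of_isZero {n : ℕ} {N : ModuleCat.{u} R} (h : IsZero N) :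
    TensorAcyclic V n N := by
  induction n generalizing N with
  | zero => trivial
  | succ n ih => exact ⟨.of_isZero h, ih ((tensorFunctor V).map_isZero h)⟩

theorem ExtAcyclic.map_tensorFunctor {S : ShortComplex (ModuleCat.{u} R)} (hS : S.ShortExact)
    (h : ExtAcyclic (dualModule V) S.X₃) : (S.map (tensorFunctor V)).ShortExact :=
  map_shortExact (tensorHomAdj V) (isCoseparator_injectiveCoseparator R) hS h

theorem TensorAcyclic.X₂ {n : ℕ} {S : ShortComplex (ModuleCat.{u} R)} (hS : S.ShortExact)
    (h₁ : TensorAcyclic V n S.X₁) (h₃ : TensorAcyclic V n S.X₃) : TensorAcyclic V n S.X₂ := by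
  induction n generalizing S with
  | zero => trivial
  | succ n ih => exact ⟨.X₂ hS h₁.1 h₃.1, ih (h₃.1.map_tensorFunctor hS) h₁.2 h₃.2⟩

/-- Since `Hom_R(V, E)` has injective dimension at most `d`, syzygies are acyclic from the `d`-th
on. From there `V ⊗_R -` keeps the sequences exact, and the argument restarts on the tensored
sequences; `n` rounds cost `n * d` steps. -/
theorem TensorAcyclic.of_syzygy {d : ℕ} (hd : HasInjectiveDimensionLT (dualModule V) (d + 1))
    (n : ℕ) {S : ℕ → ShortComplex (ModuleCat.{u} R)} (hS : ∀ j, (S j).ShortExact)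
    (e : ∀ j, (S j).X₁ ≅ (S (j + 1)).X₃) (hF : ∀ m j, TensorAcyclic V m (S j).X₂) (j : ℕ)
    (hj : n * d ≤ j) : TensorAcyclic V n (S j).X₃ := by
  induction n generalizing S j with
  | zero => trivial
  | succ n ih =>
    have h1 (j : ℕ) (hj : d ≤ j) : ExtAcyclic (dualModule V) (S j).X₃ := fun i =>
      ext_subsingleton_iterate_syzygy hS e (fun j => (hF 1 j).1) i j
        (HasInjectiveDimensionLT.subsingleton (dualModule V) (d + 1) _ (by lia) _)
    rw [add_mul, one_mul] at hj
    refine ⟨h1 j (by lia), ?_⟩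
    obtain ⟨j, rfl⟩ : ∃ j', j = j' + d := ⟨j - d, by lia⟩
    exact ih (S := fun j => (S (j + d)).map (tensorFunctor V))
      (fun j => (h1 (j + d) (by lia)).map_tensorFunctor (hS _))
      (fun j => (tensorFunctor V).mapIso (e (j + d) ≪≫ eqToIso (by congr 2; lia)))
      (fun m j => (hF (m + 1) (j + d)).2) j (by lia)

instance (n : ℕ) : (tensorIterate V n).Additive := by
  induction n with
  | zero => exact inferInstanceAs (𝟭 (ModuleCat.{u} R)).Additive
  | succ n ih => exact inferInstanceAs (tensorFunctor V ⋙ tensorIterate V n).Additive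

instance (n : ℕ) : (tensorIterate V n).PreservesEpimorphisms := by
  induction n with
  | zero => exact inferInstanceAs (𝟭 (ModuleCat.{u} R)).PreservesEpimorphisms
  | succ n ih => exact inferInstanceAs (tensorFunctor V ⋙ tensorIterate V n).PreservesEpimorphisms

theorem tensorIterate_obj_tensorPower (i j : ℕ) :
    (tensorIterate V j).obj (tensorPower V i) = tensorPower V (i + j) := by
  induction j generalizing i with
  | zero => rfl
  | succ j ih =>
    refine (ih (i + 1)).trans ?_
    rw [show i + 1 + j = i + (j + 1) by lia]

/-- Tensoring preserves the surjection `Rⁿ → N`, and its value on `Rⁿ` is built from `V^{⊗ p} = 0`.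
-/
theorem isZero_tensorIterate {p : ℕ} (hp : IsZero (tensorPower V p)) (N : ModuleCat.{u} R)
    [Module.Finite R N] : IsZero ((tensorIterate V p).obj N) := by
  obtain ⟨n, f, hf⟩ := Module.Finite.exists_fin' R N
  have : Epi (ModuleCat.ofHom f) := (ModuleCat.epi_iff_surjective _).2 hf
  refine IsZero.of_epi ((tensorIterate V p).map (ModuleCat.ofHom f)) ?_
  refine finite_projective_induction (P := fun N => IsZero ((tensorIterate V p).obj N))
    (fun M hM => (tensorIterate V p).map_isZero hM) ?_ (fun S hS h₁ h₃ => ?_)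
    (fun r h => h.of_mono (r.map (tensorIterate V p)).i) _
  · refine (hp.of_iso (eqToIso ?_))
    exact (tensorIterate_obj_tensorPower 0 p).trans (by rw [zero_add])
  · have s := hS.map (tensorIterate V p)
    refine (IsZero.iff_id_eq_zero _).2 (s.id.symm.trans ?_)
    have h1 : s.r = 0 := h₁.eq_of_tgt _ _
    have h3 : s.s = 0 := h₃.eq_of_src _ _
    rw [h1, h3, zero_comp, comp_zero, add_zero]
    rfl

end TensorAcyclic

/-! ### Modules over a tensor nilpotent split extension. -/

section Splitting

variable {k : Type w} [Field k] {R A : Type u} [Ring R] [Algebra k R] [Ring A] [Algebra k A]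
  (φ : R →ₐ[k] A) (π : A →ₐ[k] R)

/-- A split extension of algebras `R → A` for which `A / R` is tensor nilpotent, has finite
projective dimension as a bimodule, and has vanishing higher `Tor` with its tensor powers. -/
structure TensorNilpotentSplitting : Prop where
  split (r : R) : π (φ r) = r
  finPD : FinPD (quotientBimodule φ)
  acyclic (j : ℕ) :
    ExtAcyclic (dualModule (quotientBimodule φ)) (tensorPower (quotientBimodule φ) j)
  nilpotent : ∃ p, IsZero (tensorPower (quotientBimodule φ) p)

theorem TensorNilpotentSplitting.mk' (split : ∀ r, π (φ r) = r)
    (hpd : ∃ n : ℕ, HasProjectiveDimensionLE (quotientBimodule φ) n)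
    (hp : ∃ p, IsZero (tensorPower (quotientBimodule φ) p))
    (htor : ∀ i j : ℕ, 1 ≤ i → 1 ≤ j →
      IsZero (Tor (quotientBimodule φ) i (tensorPower (quotientBimodule φ) j))) :
    TensorNilpotentSplitting φ π where
  split := split
  finPD := hpd
  nilpotent := hp
  acyclic j := by
    cases j with
    -- The Tor hypothesis starts at `j = 1`; the zeroth tensor power is `R`, which is projective.
    | zero =>
      have : Projective (ModuleCat.of R R) := ModuleCat.projective_of_free (Module.Basis.singleton Unit R)
      exact ExtAcyclic.of_projective _ (ModuleCat.of R R)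
    | succ j => exact .of_leftDerived (tensorHomAdj _) fun i hi => htor i (j + 1) hi (by lia)

variable {φ π} (H : TensorNilpotentSplitting φ π)

include H

theorem TensorNilpotentSplitting.tensorAcyclic_projective (n : ℕ) (N : ModuleCat.{u} R)
    [Module.Finite R N] [Module.Projective R N] : TensorAcyclic (quotientBimodule φ) n N := by
  have key (j : ℕ) : TensorAcyclic (quotientBimodule φ) n (tensorPower (quotientBimodule φ) j) := by
    induction n generalizing j with
    | zero => trivial
    | succ n ih => exact ⟨H.acyclic j, ih (j + 1)⟩
  exact finite_projective_induction (P := TensorAcyclic (quotientBimodule φ) n)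
    (fun M hM => .of_isZero hM) (key 0) (fun S hS h₁ h₃ => .X₂ hS.shortExact h₁ h₃)
    (fun r h => h.of_retract r) N

theorem TensorNilpotentSplitting.finPD_tensor {N : ModuleCat.{u} R}
    (hN : ExtAcyclic (dualModule (quotientBimodule φ)) N) :
    FinPD ((tensorFunctor (quotientBimodule φ)).obj N) := by
  obtain ⟨n, hn⟩ := H.finPD
  exact ⟨n, hasProjectiveDimensionLT_tensor (isCoseparator_injectiveCoseparator R) n _ hn N hN⟩

/-- A four-lemma chase in the ladder of sequences `0 → X → A ⊗_R X → V ⊗_R X → 0`: the maps induced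
by `S.f` on both ends are monomorphisms. -/
theorem TensorNilpotentSplitting.mono_induce_map {S : ShortComplex (ModuleCat.{u} R)}
    (hS : S.ShortExact) (h : ExtAcyclic (dualModule (quotientBimodule φ)) S.X₃) :
    Mono ((induce φ.toRingHom).map S.f) := by
  have hT := h.map_tensorFunctor hS
  have := hS.mono_f
  have hf : Mono ((tensorFunctor (quotientBimodule φ)).map S.f) := hT.mono_f
  have h₁ := inducedSequence_shortExact H.split S.X₁
  have h₂ := inducedSequence_shortExact H.split S.X₂
  have hu := h₂.mono_f
  have hu' := h₁.mono_f
  have : Mono ((ModuleCat.restrictScalars φ.toRingHom).map ((induce φ.toRingHom).map S.f)) :=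
    Preadditive.mono_of_cancel_zero _ fun {G} g hg => by
      have h0 : g ≫ inducedToTensor φ S.X₁ = 0 := by
        rw [← cancel_mono ((tensorFunctor (quotientBimodule φ)).map S.f), Category.assoc,
          ← inducedToTensor_naturality, ← Category.assoc, hg, zero_comp, zero_comp]
      obtain ⟨l, hl⟩ : ∃ l, l ≫ (induceAdj φ.toRingHom).unit.app S.X₁ = g :=
        ⟨h₁.exact.lift g h0, by rw [induceAdj_unit_app]; exact h₁.exact.lift_f g h0⟩
      have hl' : (l ≫ S.f) ≫ (inducedSequence φ S.X₂).f = 0 := by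
        have h3 := (induceAdj φ.toRingHom).unit.naturality S.f
        rw [← hl, Category.assoc] at hg
        have h4 := (congrArg (l ≫ ·) h3).trans hg
        rw [induceAdj_unit_app] at h4
        exact (Category.assoc _ _ _).trans h4
      rw [← hl, zero_of_comp_mono S.f (zero_of_comp_mono _ hl'), zero_comp]
  exact (ModuleCat.restrictScalars φ.toRingHom).mono_of_mono_map this

/-- As a right module `A` is an extension of `V` by `R`, so vanishing of Tor with `V` implies it for
`A`. The conclusion is the dual form of the vanishing of `Tor^R(A, N)`. -/
theorem TensorNilpotentSplitting.extAcyclic_restrict {N : ModuleCat.{u} R}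
    (hN : ExtAcyclic (dualModule (quotientBimodule φ)) N) :
    ExtAcyclic ((ModuleCat.restrictScalars φ.toRingHom).obj (injectiveCoseparator A)) N :=
  .of_mono_map (induceAdj φ.toRingHom) (fun hS h => H.mono_induce_map hS h) hN

theorem TensorNilpotentSplitting.finPD_induce {N : ModuleCat.{u} R}
    (hN : ExtAcyclic (dualModule (quotientBimodule φ)) N) (h : FinPD N) :
    FinPD ((induce φ.toRingHom).obj N) := by
  obtain ⟨n, hn⟩ := h
  exact ⟨n, hasProjectiveDimensionLT_leftAdjoint (induceAdj φ.toRingHom)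
    (isCoseparator_injectiveCoseparator A) n N (H.extAcyclic_restrict hN) hn⟩

omit H in
/-- The sequence `0 → K → A ⊗_R M → M → 0`. -/
abbrev counitSequence (f : R →+* A) (M : ModuleCat.{u} A) : ShortComplex (ModuleCat.{u} A) :=
  ShortComplex.mk (kernel.ι ((induceAdj f).counit.app M)) ((induceAdj f).counit.app M)
    (kernel.condition _)

omit H in
theorem counitSequence_shortExact (f : R →+* A) (M : ModuleCat.{u} A) :
    (counitSequence f M).ShortExact where
  exact := ShortComplex.exact_kernel _
  epi_g := inferInstanceAs (Epi ((induceAdj f).counit.app M))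

/-- Over `R` the counit `A ⊗_R M → M` is a retraction of the unit, so its kernel is the cokernel `V
⊗_R M` of the unit. -/
theorem TensorNilpotentSplitting.exists_iso_restrict_kernel (M : ModuleCat.{u} A) :
    Nonempty ((ModuleCat.restrictScalars φ.toRingHom).obj (counitSequence φ.toRingHom M).X₁ ≅
      (tensorFunctor (quotientBimodule φ)).obj ((ModuleCat.restrictScalars φ.toRingHom).obj M)) := by
  refine exists_iso_kernel_of_retraction (inducedSequence_shortExact H.split _)
    ((counitSequence_shortExact φ.toRingHom M).map_of_exact
      (ModuleCat.restrictScalars φ.toRingHom)) (Iso.refl _) ?_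
  have := (induceAdj φ.toRingHom).right_triangle_components M
  rw [induceAdj_unit_app] at this
  have h : inducedUnit φ.toRingHom ((ModuleCat.restrictScalars φ.toRingHom).obj M) ≫ 𝟙 _ ≫
    (ModuleCat.restrictScalars φ.toRingHom).map ((induceAdj φ.toRingHom).counit.app M) = 𝟙 _ := by
    rw [Category.id_comp]; exact this
  exact (congrArg IsIso h).mpr inferInstance

/-- A module over `A` has finite projective dimension if it does over `R` and is acyclic. -/
theorem TensorNilpotentSplitting.finPD_of_tensorAcyclic (n : ℕ) (M : ModuleCat.{u} A)
    (hM : TensorAcyclic (quotientBimodule φ) n ((ModuleCat.restrictScalars φ.toRingHom).obj M))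
    (hn : IsZero ((tensorIterate (quotientBimodule φ) n).obj
      ((ModuleCat.restrictScalars φ.toRingHom).obj M)))
    (h : FinPD ((ModuleCat.restrictScalars φ.toRingHom).obj M)) : FinPD M := by
  induction n generalizing M with
  | zero =>
    refine .of_isZero ?_
    have : Subsingleton ((ModuleCat.restrictScalars φ.toRingHom).obj M) :=
      ModuleCat.subsingleton_of_isZero hn
    have : Subsingleton M := this
    exact ModuleCat.isZero_of_subsingleton M
  | succ n ih =>
    -- The kernel `K` of the counit restricts to `V ⊗_R M`: it needs one tensor factor fewer to
    -- vanish, and its projective dimension over `R` is finite by acyclicity of `M`.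
    obtain ⟨e⟩ := H.exists_iso_restrict_kernel M
    have hK := ih (counitSequence φ.toRingHom M).X₁ (hM.2.of_iso e)
      (hn.of_iso ((tensorIterate (quotientBimodule φ) n).mapIso e)) ((H.finPD_tensor hM.1).of_iso e)
    exact .X₃ (counitSequence_shortExact φ.toRingHom M) hK (H.finPD_induce hM.1 h)

/-- It suffices to treat `A`, a retract of `A ⊗_R R`, which over `R` is an extension of `V ⊗_R R` by
`R`. -/
theorem TensorNilpotentSplitting.restrict_projective (Q : ModuleCat.{u} A)
    [Module.Finite A Q] [Module.Projective A Q] :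
    FinPD ((ModuleCat.restrictScalars φ.toRingHom).obj Q) ∧ ∀ n, TensorAcyclic
      (quotientBimodule φ) n ((ModuleCat.restrictScalars φ.toRingHom).obj Q) := by
  refine finite_projective_induction (P := fun Q =>
    FinPD ((ModuleCat.restrictScalars φ.toRingHom).obj Q) ∧ ∀ n, TensorAcyclic
      (quotientBimodule φ) n ((ModuleCat.restrictScalars φ.toRingHom).obj Q))
    (fun M hM => ?_) ?_ (fun S hS h₁ h₃ => ?_) (fun r h => ?_) Q
  · have := (ModuleCat.restrictScalars φ.toRingHom).map_isZero hM
    exact ⟨.of_isZero this, fun n => .of_isZero this⟩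
  · let l : Induced φ.toRingHom (ModuleCat.of R R) →ₗ[A] A :=
      inducedDesc (N := ModuleCat.of R R) (Y := ModuleCat.of A A) (ModuleCat.ofHom
        (Y := (ModuleCat.restrictScalars φ.toRingHom).obj (ModuleCat.of A A))
        (LinearMap.toSpanSingleton R
          ((ModuleCat.restrictScalars φ.toRingHom).obj (ModuleCat.of A A)) (1 : A)))
    let r : Retract (ModuleCat.of A A) ((induce φ.toRingHom).obj (ModuleCat.of R R)) :=
      { i := ModuleCat.ofHom (LinearMap.toSpanSingleton A (Induced φ.toRingHom (ModuleCat.of R R))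
          (imk 1 (1 : R)))
        r := ModuleCat.ofHom l
        retract := ModuleCat.hom_ext (LinearMap.ext_ring (by
          refine (congrArg l
            (one_smul A (imk 1 (1 : R) : Induced φ.toRingHom (ModuleCat.of R R)))).trans ?_
          change (1 : A) • (φ 1 * 1) = 1
          rw [map_one, one_smul, mul_one])) }
    have hR : Projective (ModuleCat.of R R) :=
      ModuleCat.projective_of_free (Module.Basis.singleton Unit R)
    have hS := inducedSequence_shortExact H.split (ModuleCat.of R R)
    have ht (n : ℕ) := H.tensorAcyclic_projective n (ModuleCat.of R R)
    exact ⟨(FinPD.X₂ hS (.of_projective (ModuleCat.of R R)) (H.finPD_tensor (ht 1).1)).of_retract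
      (r.map (ModuleCat.restrictScalars φ.toRingHom)), fun n => (TensorAcyclic.X₂ hS (ht n)
      (ht (n + 1)).2).of_retract (r.map (ModuleCat.restrictScalars φ.toRingHom))⟩
  · have := (hS.map (ModuleCat.restrictScalars φ.toRingHom)).shortExact
    exact ⟨.X₂ this h₁.1 h₃.1, fun n => .X₂ this (h₁.2 n) (h₃.2 n)⟩
  · have r' := r.map (ModuleCat.restrictScalars φ.toRingHom)
    exact ⟨h.1.of_retract r', fun n => (h.2 n).of_retract r'⟩

end Splitting

/-! ### Triangulated functors and Verdier quotients. -/

section VerdierQuotient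

universe v₁ u₁ v₂ u₂

variable {C : Type u₁} [Category.{v₁} C] [HasZeroObject C] [HasShift C ℤ] [Preadditive C]
  [∀ n : ℤ, (shiftFunctor C n).Additive] [Pretriangulated C]
  {D : Type u₂} [Category.{v₂} D] [HasZeroObject D] [HasShift D ℤ] [Preadditive D]
  [∀ n : ℤ, (shiftFunctor D n).Additive] [Pretriangulated D]

/-- A triangulated functor with a section that is surjective on objects is an equivalence. -/
theorem isEquivalence_of_section (G : C ⥤ D) [G.CommShift ℤ] [G.IsTriangulated] (S : D ⥤ C)
    [S.EssSurj] [S.PreservesZeroMorphisms] (e : S ⋙ G ≅ 𝟭 D) : G.IsEquivalence := by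
  -- Up to isomorphism every object is a value of `S`, so a map is lifted by conjugating with `e`
  -- and applying `S`.
  have hfull : G.Full := ⟨fun {X Y} f => by
    let a := S.objObjPreimageIso X
    let b := S.objObjPreimageIso Y
    let f' := e.inv.app _ ≫ G.map a.hom ≫ f ≫ G.map b.inv ≫ e.hom.app _
    refine ⟨a.inv ≫ S.map f' ≫ b.hom, ?_⟩
    have h := e.hom.naturality f'
    have h' : G.map (S.map f') = e.hom.app _ ≫ f' ≫ e.inv.app _ := by
      rw [← cancel_mono (e.hom.app (S.objPreimage Y)), Category.assoc, Category.assoc,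
        Iso.inv_hom_id_app, Category.comp_id]
      exact h
    rw [G.map_comp, G.map_comp, h']
    simp [f', ← G.map_comp_assoc, ← G.map_comp]⟩
  have hess : G.EssSurj := ⟨fun Y => ⟨S.obj Y, ⟨e.app Y⟩⟩⟩
  -- With `X ≅ S Y`, vanishing of `G X ≅ Y` forces `X` to vanish; taking cones, `G` reflects
  -- isomorphisms.
  have hzero (X : C) (hX : IsZero (G.obj X)) : IsZero X :=
    (S.map_isZero ((hX.of_iso (G.mapIso (S.objObjPreimageIso X))).of_iso
      (e.symm.app (S.objPreimage X)))).of_iso (S.objObjPreimageIso X).symm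
  have hiso {X Y : C} (f : X ⟶ Y) (hf : IsIso (G.map f)) : IsIso f := by
    obtain ⟨Z, g, h, hT⟩ := distinguished_cocone_triangle f
    exact (Triangle.isZero₃_iff_isIso₁ _ hT).1
      (hzero _ ((Triangle.isZero₃_iff_isIso₁ _ (G.map_distinguished _ hT)).2 hf))
  have hfaithful : G.Faithful := by
    have key {X Y : C} (f : X ⟶ Y) (hf : G.map f = 0) : f = 0 := by
      obtain ⟨Z, g, h, hT⟩ := distinguished_cocone_triangle f
      -- A full conservative triangulated functor is faithful: if `G f = 0`, the next map `G g` of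
      -- the triangle has a retraction. By fullness it lifts to `t`, and `g ≫ t` is invertible, so
      -- `f ≫ g = 0` gives `f = 0`.
      obtain ⟨s, hs⟩ := Triangle.yoneda_exact₂ _ (G.map_distinguished _ hT) (𝟙 (G.obj Y))
        ((congrArg (· ≫ _) hf).trans zero_comp)
      obtain ⟨t, rfl⟩ : ∃ t : Z ⟶ Y, G.map t = s := G.map_surjective s
      have : IsIso (g ≫ t) := hiso _ (by
        rw [G.map_comp, show G.map g ≫ G.map t = 𝟙 _ from hs.symm]
        infer_instance)
      have hfg : f ≫ g = 0 := comp_distTriang_mor_zero₁₂ _ hT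
      rw [← cancel_mono (g ≫ t), reassoc_of% hfg, zero_comp, zero_comp]
    exact ⟨fun {X Y f g} h => sub_eq_zero.1 (key _ (by rw [G.map_sub, h, sub_self]))⟩
  exact { }

variable [IsTriangulated C] [IsTriangulated D]
  (F : C ⥤ D) [F.CommShift ℤ] [F.IsTriangulated]
  {P : ObjectProperty C} {Q : ObjectProperty D} [P.IsTriangulated] [Q.IsTriangulated]
  [Q.IsClosedUnderIsomorphisms] (h : P ≤ Q.inverseImage F)

/-- A triangulated functor, as a morphism of localizers. -/
def verdierLocalizer : LocalizerMorphism P.trW Q.trW where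
  functor := F
  map _ _ f hf := (Q.inverseImage_trW_iff F f).1 (ObjectProperty.trW_monotone h f hf)

/-- The functor induced on Verdier quotients by a triangulated functor. -/
def verdierMap : P.trW.Localization ⥤ Q.trW.Localization :=
  (verdierLocalizer F h).localizedFunctor P.trW.Q Q.trW.Q

instance : (verdierLocalizer F h).functor.CommShift ℤ := inferInstanceAs (F.CommShift ℤ)

instance : (verdierMap F h).CommShift ℤ :=
  inferInstanceAs (((verdierLocalizer F h).localizedFunctor P.trW.Q Q.trW.Q).CommShift ℤ)

/-- The compatibility of `verdierMap` with the quotient functors. -/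
def verdierMapIso : P.trW.Q ⋙ verdierMap F h ≅ F ⋙ Q.trW.Q :=
  (CatCommSq.iso (verdierLocalizer F h).functor P.trW.Q Q.trW.Q
    ((verdierLocalizer F h).localizedFunctor P.trW.Q Q.trW.Q)).symm

instance : NatTrans.CommShift (verdierMapIso F h).hom ℤ := by
  have : NatTrans.CommShift (verdierMapIso F h).symm.hom ℤ :=
    inferInstanceAs (NatTrans.CommShift (CatCommSq.iso (verdierLocalizer F h).functor P.trW.Q Q.trW.Q
      ((verdierLocalizer F h).localizedFunctor P.trW.Q Q.trW.Q)).hom ℤ)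
  exact inferInstanceAs (NatTrans.CommShift (verdierMapIso F h).symm.inv ℤ)

instance : (verdierMap F h).IsTriangulated := by
  have : P.trW.Q.mapArrow.EssSurj := Localization.essSurj_mapArrow P.trW.Q P.trW
  have : NatTrans.CommShift (verdierMapIso F h).symm.hom ℤ :=
    inferInstanceAs (NatTrans.CommShift (verdierMapIso F h).inv ℤ)
  exact Functor.isTriangulated_of_precomp_iso (verdierMapIso F h)

theorem verdierMap_isEquivalence [F.IsEquivalence] (h' : Q.inverseImage F ≤ P) :
    (verdierMap F h).IsEquivalence := by
  have : (verdierLocalizer F h).functor.IsEquivalence := inferInstanceAs F.IsEquivalence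
  have : (verdierLocalizer F h).IsInduced := ⟨MorphismProperty.ext _ _ fun X Y f =>
    ⟨fun hf => ObjectProperty.trW_monotone h' f ((Q.inverseImage_trW_iff F f).2 hf),
      fun hf => (verdierLocalizer F h).map f hf⟩⟩
  have := (verdierLocalizer F h).isLocalizedEquivalence_of_isInduced
  exact inferInstanceAs
    ((verdierLocalizer F h).localizedFunctor P.trW.Q Q.trW.Q).IsEquivalence

end VerdierQuotient

/-! ### Finitely generated modules and perfect complexes. -/

section FinitelyGenerated

variable (R : Type u) [Ring R] [IsNoetherianRing R]

/-- The inclusion of finitely generated modules in all modules. -/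
abbrev toModule : FGModuleCat.{u} R ⥤ ModuleCat.{u} R := forget₂ (FGModuleCat.{u} R) (ModuleCat.{u} R)

variable {R}

/-- `Rⁿ` as a finitely generated module. -/
abbrev fgFree (R : Type u) [Ring R] (n : ℕ) : FGModuleCat.{u} R := FGModuleCat.of R (Fin n → R)

theorem exists_epi_free (M : FGModuleCat.{u} R) : ∃ (n : ℕ) (f : fgFree R n ⟶ M), Epi f := by
  obtain ⟨n, f, hf⟩ := Module.Finite.exists_fin' R M
  refine ⟨n, FGModuleCat.ofHom f, ?_⟩
  have : Epi ((toModule R).map (FGModuleCat.ofHom f)) := (ModuleCat.epi_iff_surjective _).2 hf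
  exact (toModule R).epi_of_epi_map this

theorem module_projective_of_retract {X Y : FGModuleCat.{u} R} (r : Retract X Y)
    [Module.Projective R Y] : Module.Projective R X :=
  Module.Projective.of_split r.i.hom.hom r.r.hom.hom
    (LinearMap.ext fun x => congrArg (fun h : X ⟶ X => h.hom.hom x) r.retract)

theorem module_projective_of_projective (X : FGModuleCat.{u} R) [Projective X] :
    Module.Projective R X := by
  obtain ⟨n, f, _⟩ := exists_epi_free X
  exact module_projective_of_retract
    (Y := fgFree R n) ⟨Projective.factorThru (𝟙 X) f, f, Projective.factorThru_comp _ _⟩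

theorem projective_toModule_obj (X : FGModuleCat.{u} R) [h : Module.Projective R X] :
    Projective ((toModule R).obj X) :=
  (IsProjective.iff_projective (X : Type u)).1 h

instance : EnoughProjectives (FGModuleCat.{u} R) where
  presentation M := by
    obtain ⟨n, f, _⟩ := exists_epi_free M
    have : Module.Projective R (fgFree R n) := inferInstanceAs (Module.Projective R (Fin n → R))
    exact ⟨{ p := fgFree R n, projective := projective_of_module _, f := f }⟩

/-- The sequence `0 → ΩM → P → M → 0`. -/
abbrev syzygySequence (M : FGModuleCat.{u} R) : ShortComplex (FGModuleCat.{u} R) :=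
  ShortComplex.mk (kernel.ι (Projective.π M)) (Projective.π M) (kernel.condition _)

theorem syzygySequence_shortExact (M : FGModuleCat.{u} R) : (syzygySequence M).ShortExact where
  exact := ShortComplex.exact_kernel _

instance (M : FGModuleCat.{u} R) :
    Module.Projective R (Projective.over (C := FGModuleCat.{u} R) M : FGModuleCat.{u} R) :=
  module_projective_of_projective _

theorem shortExact_toModule {S : ShortComplex (FGModuleCat.{u} R)} (hS : S.ShortExact) :
    (S.map (toModule R)).ShortExact := hS.map_of_exact (toModule R)

section DerivedCategory

variable [HasDerivedCategory.{w₁} (FGModuleCat.{u} R)]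

/-- A bounded complex as an object of the bounded derived category. -/
def boundedObj (K : CochainComplex (FGModuleCat.{u} R) ℤ) (a b : ℤ) (ha : K.IsStrictlyGE a)
    (hb : K.IsStrictlyLE b) : Db R :=
  ⟨DerivedCategory.Q.obj K, ⟨a, K, Iso.refl _, ha⟩, ⟨b, K, Iso.refl _, hb⟩⟩

/-- The bounded derived category is full, so a triangle with bounded vertices descends to it; the
compatibility of the inclusion with shifts corrects the third map. -/
theorem exists_distinguished_of_iso {T : Triangle (DerivedCategory (FGModuleCat.{u} R))}
    (hT : T ∈ distTriang _) {X₁ X₂ X₃ : Db R} (e₁ : X₁.obj ≅ T.obj₁) (e₂ : X₂.obj ≅ T.obj₂)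
    (e₃ : X₃.obj ≅ T.obj₃) :
    ∃ (f : X₁ ⟶ X₂) (g : X₂ ⟶ X₃) (h : X₃ ⟶ X₁⟦(1 : ℤ)⟧), Triangle.mk f g h ∈ distTriang (Db R) ∧
      f.hom = e₁.hom ≫ T.mor₁ ≫ e₂.inv ∧ g.hom = e₂.hom ≫ T.mor₂ ≫ e₃.inv := by
  let ι := DerivedCategory.Bounded.ι (C := FGModuleCat.{u} R)
  let f : X₁ ⟶ X₂ := ι.preimage (e₁.hom ≫ T.mor₁ ≫ e₂.inv)
  let g : X₂ ⟶ X₃ := ι.preimage (e₂.hom ≫ T.mor₂ ≫ e₃.inv)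
  let h : X₃ ⟶ X₁⟦(1 : ℤ)⟧ :=
    ι.preimage (e₃.hom ≫ T.mor₃ ≫ e₁.inv⟦(1 : ℤ)⟧' ≫ (ι.commShiftIso (1 : ℤ)).inv.app X₁)
  have hf : ι.map f = e₁.hom ≫ T.mor₁ ≫ e₂.inv := ι.map_preimage _
  have hg : ι.map g = e₂.hom ≫ T.mor₂ ≫ e₃.inv := ι.map_preimage _
  have hh : ι.map h = _ := ι.map_preimage _
  refine ⟨f, g, h, ?_, hf, hg⟩
  rw [← ι.map_distinguished_iff]
  refine isomorphic_distinguished _ hT _ (Triangle.isoMk _ _ e₁ e₂ e₃ ?_ ?_ ?_)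
  · change ι.map f ≫ e₂.hom = e₁.hom ≫ T.mor₁
    rw [hf]; simp
  · change ι.map g ≫ e₃.hom = e₂.hom ≫ T.mor₂
    rw [hg]; simp
  · change (ι.map h ≫ (ι.commShiftIso (1 : ℤ)).hom.app X₁) ≫ e₁.hom⟦(1 : ℤ)⟧' = e₃.hom ≫ T.mor₃
    rw [hh]
    have h1 : e₁.inv⟦(1 : ℤ)⟧' ≫ e₁.hom⟦(1 : ℤ)⟧' = 𝟙 _ := by
      rw [← CategoryTheory.Functor.map_comp, e₁.inv_hom_id, CategoryTheory.Functor.map_id]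
    have h2 := (ι.commShiftIso (1 : ℤ)).inv_hom_id_app X₁
    rw [Category.assoc, Category.assoc, Category.assoc, Category.assoc]
    refine congrArg (e₃.hom ≫ ·) (Eq.trans (congrArg (T.mor₃ ≫ ·) ?_) (Category.comp_id _))
    refine Eq.trans (congrArg (e₁.inv⟦(1 : ℤ)⟧' ≫ ·) ?_) h1
    exact (Category.assoc _ _ _).symm.trans ((congrArg (· ≫ e₁.hom⟦(1 : ℤ)⟧') h2).trans
      (Category.id_comp _))

theorem exists_stalk_triangle {S : ShortComplex (FGModuleCat.{u} R)} (hS : S.ShortExact) :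
    ∃ h, Triangle.mk ((stalk R).map S.f) ((stalk R).map S.g) h ∈ distTriang (Db R) := by
  obtain ⟨f, g, h, hT, hf, hg⟩ := exists_distinguished_of_iso hS.singleTriangle_distinguished
    (X₁ := (stalk R).obj S.X₁) (X₂ := (stalk R).obj S.X₂) (X₃ := (stalk R).obj S.X₃)
    (Iso.refl _) (Iso.refl _) (Iso.refl _)
  have hf' : f = (stalk R).map S.f := DerivedCategory.Bounded.ι.map_injective (
    hf.trans ((Category.id_comp _).trans (Category.comp_id _)))
  have hg' : g = (stalk R).map S.g := DerivedCategory.Bounded.ι.map_injective (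
    hg.trans ((Category.id_comp _).trans (Category.comp_id _)))
  subst hf' hg'
  exact ⟨h, hT⟩

theorem exists_distinguished_of_shortExact
    {S : ShortComplex (CochainComplex (FGModuleCat.{u} R) ℤ)} (hS : S.ShortExact) {X₁ X₂ X₃ : Db R}
    (e₁ : X₁.obj ≅ DerivedCategory.Q.obj S.X₁) (e₂ : X₂.obj ≅ DerivedCategory.Q.obj S.X₂)
    (e₃ : X₃.obj ≅ DerivedCategory.Q.obj S.X₃) :
    ∃ (f : X₁ ⟶ X₂) (g : X₂ ⟶ X₃) (h : X₃ ⟶ X₁⟦(1 : ℤ)⟧),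
      Triangle.mk f g h ∈ distTriang (Db R) := by
  obtain ⟨f, g, h, hT, -⟩ := exists_distinguished_of_iso
    (DerivedCategory.triangleOfSES_distinguished hS) e₁ e₂ e₃
  exact ⟨f, g, h, hT⟩

/-- The stalk complexes in degree `b` are the shifts of those in degree zero. -/
def stalkShiftIso (M : FGModuleCat.{u} R) (b : ℤ) (X : Db R)
    (e : X.obj ≅ (DerivedCategory.singleFunctor (FGModuleCat.{u} R) b).obj M) :
    X ≅ ((stalk R).obj M)⟦-b⟧ :=
  DerivedCategory.Bounded.ι.preimageIso (e ≪≫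
    (((DerivedCategory.singleFunctors (FGModuleCat.{u} R)).shiftIso (-b) b 0 (by lia)).app M).symm ≪≫
    ((DerivedCategory.Bounded.ι (C := FGModuleCat.{u} R)).commShiftIso (-b)).symm.app
      ((stalk R).obj M))

/-- The inclusion of the last term of a bounded above complex. -/
def lastTerm {K : CochainComplex (FGModuleCat.{u} R) ℤ} (b : ℤ) (hb : K.IsStrictlyLE b)
    {P : FGModuleCat.{u} R} (p : P ⟶ K.X b) :
    (HomologicalComplex.single (FGModuleCat.{u} R) (ComplexShape.up ℤ) b).obj P ⟶ K :=
  HomologicalComplex.mkHomFromSingle p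
    (fun j hj => (K.isZero_of_isStrictlyLE b j (by simp at hj; lia)).eq_of_tgt _ _)

theorem lastTerm_f {K : CochainComplex (FGModuleCat.{u} R) ℤ} (b : ℤ) (hb : K.IsStrictlyLE b)
    {P : FGModuleCat.{u} R} (p : P ⟶ K.X b) : (lastTerm b hb p).f b =
      (HomologicalComplex.singleObjXSelf (ComplexShape.up ℤ) b P).hom ≫ p :=
  HomologicalComplex.mkHomFromSingle_f _ _

/-- The triangulated subcategory of perfect complexes is generated by the finitely generated
projective modules. -/
theorem perfect_le {P : ObjectProperty (Db R)} [P.IsTriangulated] [P.IsClosedUnderIsomorphisms]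
    (hP : ∀ Q : FGModuleCat.{u} R, Module.Projective R Q → P ((stalk R).obj Q)) : perfect R ≤ P := by
  -- Induction on the number `n` of degrees in `[b + 1 - n, b]`; for `n = 0` the complex is zero.
  have key (n : ℕ) : ∀ (b : ℤ) (K : CochainComplex (FGModuleCat.{u} R) ℤ)
      (ha : K.IsStrictlyGE (b + 1 - n)) (hb : K.IsStrictlyLE b),
      (∀ i, Module.Projective R (K.X i)) → P (boundedObj K _ b ha hb) := by
    induction n with
    | zero =>
      intro b K ha hb hK
      have hz (i : ℤ) : IsZero (K.X i) := by
        by_cases hi : i ≤ b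
        · exact K.isZero_of_isStrictlyGE (b + 1 - (0 : ℕ)) i (by push_cast; lia)
        · exact K.isZero_of_isStrictlyLE b i (by lia)
      have hK : IsZero K := by
        rw [IsZero.iff_id_eq_zero]
        exact HomologicalComplex.hom_ext _ _ fun i => (hz i).eq_of_src _ _
      exact P.prop_of_isZero ((IsZero.iff_id_eq_zero _).2
        (DerivedCategory.Bounded.ι.map_injective ((DerivedCategory.Q.map_isZero hK).eq_of_src _ _)))
    | succ n ih =>
      intro b K ha hb hK
      -- Brutal truncation: the last term is a subcomplex, and the quotient agrees with `K` below
      -- degree `b`.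
      let j := lastTerm b hb (𝟙 (K.X b))
      have hj : IsIso (j.f b) := by
        rw [lastTerm_f, Category.comp_id]
        infer_instance
      have hz (i : ℤ) (hi : i ≠ b) : IsZero (((HomologicalComplex.single (FGModuleCat.{u} R)
          (ComplexShape.up ℤ) b).obj (K.X b)).X i) :=
        HomologicalComplex.isZero_single_obj_X _ _ _ _ hi
      have : ∀ i, Mono (j.f i) := fun i => by
        by_cases hi : i = b
        · subst hi; infer_instance
        · exact ⟨fun g h _ => (hz i hi).eq_of_tgt _ _⟩
      have : Mono j := HomologicalComplex.mono_of_mono_f _ inferInstance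
      let S := ShortComplex.mk j (cokernel.π j) (cokernel.condition j)
      have hS : S.ShortExact := { exact := ShortComplex.exact_cokernel _ }
      have hSi (i : ℤ) := hS.map_of_exact
        (HomologicalComplex.eval (FGModuleCat.{u} R) (ComplexShape.up ℤ) i)
      have h₁ (i : ℤ) (hi : i ≠ b) : IsIso (S.g.f i) :=
        (hSi i).isIso_g_iff.2 (hz i hi)
      have h₂ : IsZero (S.X₃.X b) := (hSi b).isIso_f_iff.1 hj
      have ha' : CochainComplex.IsStrictlyGE S.X₃ (b - 1 + 1 - n) := by
        rw [CochainComplex.isStrictlyGE_iff]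
        intro i hi
        by_cases hib : i = b
        · rwa [hib]
        · have := h₁ i hib
          exact (K.isZero_of_isStrictlyGE (b + 1 - (n + 1 : ℕ)) i (by push_cast; lia)).of_iso
            (asIso (S.g.f i)).symm
      have hb' : CochainComplex.IsStrictlyLE S.X₃ (b - 1) := by
        rw [CochainComplex.isStrictlyLE_iff]
        intro i hi
        by_cases hib : i = b
        · rwa [hib]
        · have := h₁ i hib
          exact (K.isZero_of_isStrictlyLE b i (by lia)).of_iso (asIso (S.g.f i)).symm
      have h₃ := ih (b - 1) S.X₃ ha' hb' fun i => by
        by_cases hib : i = b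
        · exact module_projective_of_isZero (by rwa [hib])
        · have := h₁ i hib
          exact module_projective_of_iso (asIso (S.g.f i)) (hK i)
      let X₁ : Db R := ((stalk R).obj (K.X b))⟦-b⟧
      let e₁ : X₁.obj ≅ DerivedCategory.Q.obj S.X₁ :=
        ((DerivedCategory.Bounded.ι (C := FGModuleCat.{u} R)).commShiftIso (-b)).app
          ((stalk R).obj (K.X b)) ≪≫
        ((DerivedCategory.singleFunctors (FGModuleCat.{u} R)).shiftIso (-b) b 0 (by lia)).app (K.X b)
      obtain ⟨f, g, h, hT⟩ := exists_distinguished_of_shortExact hS (X₁ := X₁)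
        (X₂ := boundedObj K _ b ha hb) (X₃ := boundedObj S.X₃ _ _ ha' hb') e₁
        (Iso.refl _) (Iso.refl _)
      exact P.ext_of_isTriangulatedClosed₂ _ hT (P.le_shift (-b) _ (hP _ (hK b))) h₃
  rintro X ⟨K, ⟨⟨a, ha⟩, ⟨b, hb⟩, hK⟩, ⟨e⟩⟩
  have ha' : K.IsStrictlyGE (b + 1 - (b + 1 - a).toNat) :=
    K.isStrictlyGE_of_ge _ a (by lia)
  exact P.prop_of_iso (DerivedCategory.Bounded.ι.preimageIso (X := boundedObj K _ b ha' hb) (Y := X) e.symm)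
    (key _ b K ha' hb hK)

/-- Projective dimension is measured among all modules, but the syzygies stay finitely generated, so
the induction runs through the triangles of the syzygy sequences. -/
theorem perfect_stalk_of_finPD (M : FGModuleCat.{u} R) (h : FinPD ((toModule R).obj M)) :
    perfect R ((stalk R).obj M) := by
  obtain ⟨n, hn⟩ := h
  induction n generalizing M with
  | zero =>
    have : Projective ((toModule R).obj M) := (projective_iff_hasProjectiveDimensionLT_one).2 hn
    have : Module.Projective R M := (IsProjective.iff_projective (M : Type u)).2 this
    exact perfect_stalk R M
  | succ n ih =>
    have hS := syzygySequence_shortExact M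
    have := projective_toModule_obj (Projective.over M)
    have h₁ := ih _ ((shortExact_toModule hS).hasProjectiveDimensionLT_X₁ (n + 1)
      (hasProjectiveDimensionLT_of_ge ((toModule R).obj (Projective.over M)) 1 _ (by lia)) hn)
    obtain ⟨h, hT⟩ := exists_stalk_triangle hS
    exact (perfect R).ext_of_isTriangulatedClosed₃ _ hT h₁ (perfect_stalk R (Projective.over M))

theorem isIso_toDsg_map {S : ShortComplex (FGModuleCat.{u} R)} (hS : S.ShortExact)
    (h : FinPD ((toModule R).obj S.X₁)) : IsIso ((toDsg R).map ((stalk R).map S.g)) := by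
  obtain ⟨h', hT⟩ := exists_stalk_triangle hS
  exact Localization.inverts (toDsg R) (perfect R).trW _
    (ObjectProperty.trW.mk' _ hT (perfect_stalk_of_finPD _ h))

end DerivedCategory

end FinitelyGenerated

/-! ### Objects of the singularity category. -/

section SingularityCategory

variable {R : Type u} [Ring R] [IsNoetherianRing R] [HasDerivedCategory.{w₁} (FGModuleCat.{u} R)]

theorem isIso_toDsg_map₂ {T : Triangle (Db R)} (hT : T ∈ distTriang _) (h : perfect R T.obj₁) :
    IsIso ((toDsg R).map T.mor₂) :=
  Localization.inverts (toDsg R) (perfect R).trW _ (ObjectProperty.trW.mk' _ hT h)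

/-- The first syzygy. -/
abbrev syzygy (M : FGModuleCat.{u} R) : FGModuleCat.{u} R := kernel (Projective.π M)

/-- The middle term of `0 → ΩM → P → M → 0` dies in `D_sg`, so `M` becomes `(ΩM)[1]`. Modules may
thus be replaced by arbitrarily high syzygies. -/
theorem exists_iso_syzygy (M : FGModuleCat.{u} R) (n : ℤ) :
    Nonempty ((toDsg R).obj (((stalk R).obj M)⟦n⟧) ≅
      (toDsg R).obj (((stalk R).obj (syzygy M))⟦1 + n⟧)) := by
  obtain ⟨h, hT⟩ := exists_stalk_triangle (syzygySequence_shortExact M)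
  have : IsIso ((toDsg R).map h) := isIso_toDsg_map₂ (rot_of_distTriang _ hT)
    (perfect_stalk R (Projective.over (C := FGModuleCat.{u} R) M))
  let e : (toDsg R).obj ((stalk R).obj M) ≅ (toDsg R).obj (((stalk R).obj (syzygy M))⟦(1 : ℤ)⟧) :=
    asIso ((toDsg R).map h)
  exact ⟨((toDsg R).commShiftIso n).app _ ≪≫ (shiftFunctor (Dsg R) n).mapIso e ≪≫
    (((toDsg R).commShiftIso n).app _).symm ≪≫
    (toDsg R).mapIso ((shiftFunctorAdd (Db R) 1 n).app ((stalk R).obj (syzygy M))).symm⟩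

theorem exists_iso_syzygy_iterate (M : FGModuleCat.{u} R) (n : ℤ) (j : ℕ) :
    ∃ m : ℤ, Nonempty ((toDsg R).obj (((stalk R).obj M)⟦n⟧) ≅
      (toDsg R).obj (((stalk R).obj (syzygy^[j] M))⟦m⟧)) := by
  induction j generalizing M n with
  | zero => exact ⟨n, ⟨Iso.refl _⟩⟩
  | succ j ih =>
    obtain ⟨e⟩ := exists_iso_syzygy M n
    obtain ⟨m, ⟨e'⟩⟩ := ih (syzygy M) (1 + n)
    exact ⟨m, ⟨e ≪≫ e'⟩⟩

/-- Coning off a projective that surjects onto the last term does not change the object of `D_sg`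
and removes the top cohomology. The complex shortens until its cohomology sits in a single degree.
-/
theorem exists_iso_stalk_shift (X : Db R) : ∃ (M : FGModuleCat.{u} R) (n : ℤ),
    Nonempty ((toDsg R).obj X ≅ (toDsg R).obj (((stalk R).obj M)⟦n⟧)) := by
  have key (n : ℕ) : ∀ (b : ℤ) (K : CochainComplex (FGModuleCat.{u} R) ℤ)
      (ha : K.IsStrictlyGE (b - n)) (hb : K.IsStrictlyLE b) (X : Db R)
      (_ : X.obj ≅ DerivedCategory.Q.obj K), ∃ (M : FGModuleCat.{u} R) (n : ℤ),
        Nonempty ((toDsg R).obj X ≅ (toDsg R).obj (((stalk R).obj M)⟦n⟧)) := by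
    induction n with
    | zero =>
      intro b K ha hb X e
      have ha' : K.IsStrictlyGE b := K.isStrictlyGE_of_ge _ (b - (0 : ℕ)) (by push_cast; lia)
      obtain ⟨M, ⟨f⟩⟩ := DerivedCategory.exists_iso_singleFunctor_obj_of_isGE_of_isLE
        (DerivedCategory.Q.obj K) b
      exact ⟨M, -b, ⟨(toDsg R).mapIso (stalkShiftIso M b X (e ≪≫ f))⟩⟩
    | succ n ih =>
      intro b K ha hb X e
      let φ := lastTerm b hb (Projective.π (K.X b))
      let C := CochainComplex.mappingCone φ
      have hP : CochainComplex.IsStrictlyGE ((HomologicalComplex.single (FGModuleCat.{u} R)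
          (ComplexShape.up ℤ) b).obj (Projective.over (K.X b))) b :=
        inferInstanceAs (CochainComplex.IsStrictlyGE ((CochainComplex.singleFunctor _ b).obj _) b)
      have hP' : CochainComplex.IsStrictlyLE ((HomologicalComplex.single (FGModuleCat.{u} R)
          (ComplexShape.up ℤ) b).obj (Projective.over (K.X b))) b :=
        inferInstanceAs (CochainComplex.IsStrictlyLE ((CochainComplex.singleFunctor _ b).obj _) b)
      have hC : C.IsStrictlyGE (b - 1 - n) := by
        rw [CochainComplex.isStrictlyGE_iff]
        intro i hi
        rw [CochainComplex.mappingCone.isZero_X_iff]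
        exact ⟨CochainComplex.isZero_of_isStrictlyGE _ b _ (by lia),
          K.isZero_of_isStrictlyGE (b - (n + 1 : ℕ)) _ (by push_cast; lia)⟩
      have hCb : C.IsStrictlyLE b := by
        rw [CochainComplex.isStrictlyLE_iff]
        intro i hi
        rw [CochainComplex.mappingCone.isZero_X_iff]
        exact ⟨CochainComplex.isZero_of_isStrictlyLE _ b _ (by lia),
          K.isZero_of_isStrictlyLE b _ (by lia)⟩
      -- Restricted to the summand `P` of `C.X (b - 1)`, the last differential is the surjection of
      -- `P` onto `K.X b`.
      have hepi : Epi (C.d (b - 1) b) := by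
        have h1 := CochainComplex.mappingCone.inl_v_d φ b (b - 1) (b + 1) (by lia) (by lia)
        have h2 : ((HomologicalComplex.single (FGModuleCat.{u} R)
          (ComplexShape.up ℤ) b).obj (Projective.over (K.X b))).d b (b + 1) = 0 :=
          HomologicalComplex.single_obj_d _ _ _ _ _
        have h2' := (congrArg (· ≫ (CochainComplex.mappingCone.inl φ).v (b + 1) b (by lia)) h2).trans
          zero_comp
        have h3 : (CochainComplex.mappingCone.inl φ).v b (b - 1) (by lia) ≫ C.d (b - 1) b =
          φ.f b ≫ (CochainComplex.mappingCone.inr φ).f b :=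
          h1.trans ((congrArg (_ - ·) h2').trans (sub_zero _))
        have h4 : Epi (φ.f b) := by
          rw [lastTerm_f]
          infer_instance
        have h5 : Epi ((CochainComplex.mappingCone.inr φ).f b) := by
          refine (Preadditive.epi_iff_cancel_zero _).2 fun Z g hg => ?_
          exact CochainComplex.mappingCone.ext_from φ (b + 1) b rfl
            ((CochainComplex.isZero_of_isStrictlyLE _ b (b + 1) (by lia)).eq_of_src _ _)
            (hg.trans comp_zero.symm)
        have : Epi (φ.f b ≫ (CochainComplex.mappingCone.inr φ).f b) := inferInstance
        rw [← h3] at this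
        exact epi_of_epi ((CochainComplex.mappingCone.inl φ).v b (b - 1) _) _
      have hle : C.IsLE (b - 1) := by
        rw [CochainComplex.isLE_iff]
        intro i hi
        by_cases hib : i = b
        · subst hib
          rw [HomologicalComplex.exactAt_iff' C (i - 1) i (i + 1) (by simp) (by simp)]
          refine (ShortComplex.exact_iff_epi _ ?_).2 hepi
          exact (C.isZero_of_isStrictlyLE i (i + 1) (by lia)).eq_of_tgt _ _
        · exact ShortComplex.exact_of_isZero_X₂ _ (C.isZero_of_isStrictlyLE b i (by lia))
      -- The cone still has a term in degree `b`; a quasi-isomorphic complex in `[b - 1 - n, b - 1]`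
      -- replaces it.
      obtain ⟨K', ha', hb', ⟨e'⟩⟩ := DerivedCategory.exists_iso_Q_obj_of_isGE_of_isLE
        (DerivedCategory.Q.obj C) (b - 1 - n) (b - 1)
      let X₁ : Db R := ((stalk R).obj (Projective.over (K.X b)))⟦-b⟧
      let e₁ : X₁.obj ≅ DerivedCategory.Q.obj ((HomologicalComplex.single (FGModuleCat.{u} R)
          (ComplexShape.up ℤ) b).obj (Projective.over (K.X b))) :=
        ((DerivedCategory.Bounded.ι (C := FGModuleCat.{u} R)).commShiftIso (-b)).app
          ((stalk R).obj (Projective.over (K.X b))) ≪≫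
        ((DerivedCategory.singleFunctors (FGModuleCat.{u} R)).shiftIso (-b) b 0 (by lia)).app
          (Projective.over (K.X b))
      obtain ⟨f, g, h, hT, -⟩ := exists_distinguished_of_iso
        (DerivedCategory.mappingCone_triangle_distinguished φ) (X₁ := X₁)
        (X₂ := X) (X₃ := boundedObj C _ _ hC hCb) e₁ e (Iso.refl _)
      have : IsIso ((toDsg R).map g) := isIso_toDsg_map₂ hT ((perfect R).le_shift (-b) _
        (perfect_stalk R (Projective.over (C := FGModuleCat.{u} R) (K.X b))))
      obtain ⟨M, m, ⟨e''⟩⟩ := ih (b - 1) K' ha' hb' (boundedObj C _ _ hC hCb) e'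
      exact ⟨M, m, ⟨asIso ((toDsg R).map g) ≪≫ e''⟩⟩
  obtain ⟨X, ⟨a, ha⟩, ⟨b, hb⟩⟩ := X
  have ha : X.IsGE a := ha
  have hb : X.IsLE b := hb
  obtain ⟨K, ha', hb', ⟨e⟩⟩ := DerivedCategory.exists_iso_Q_obj_of_isGE_of_isLE X a b
  have ha'' : K.IsStrictlyGE (b - (b - a).toNat) := K.isStrictlyGE_of_ge _ a (by lia)
  exact key _ b K ha'' hb' _ e

end SingularityCategory

/-! ### Restriction and induction on derived and finitely generated levels. -/

section DerivedFunctors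

universe v₁ u₁ v₂ u₂ w₃ w₄

/-- A natural isomorphism between an endofunctor and the identity extends to complexes. -/
def mapHomologicalComplexIsoId {C : Type u₁} [Category.{v₁} C] [Preadditive C] [HasZeroObject C]
    {D : Type u₂} [Category.{v₂} D] [Preadditive D] [HasZeroObject D] (F : C ⥤ D) (G : D ⥤ C)
    [F.Additive] [G.Additive] (e : F ⋙ G ≅ 𝟭 C) :
    F.mapHomologicalComplex (ComplexShape.up ℤ) ⋙ G.mapHomologicalComplex (ComplexShape.up ℤ) ≅
      𝟭 (CochainComplex C ℤ) :=
  Functor.mapHomologicalComplexCompIso e _ ≪≫ Functor.mapHomologicalComplexIdIso C _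

/-- The functors on derived categories that are induced by a functor with an exact section. -/
def mapDerivedCategoryIsoId {C : Type u₁} [Category.{v₁} C] [Abelian C] [HasDerivedCategory.{w₃} C]
    {D : Type u₂} [Category.{v₂} D] [Abelian D] [HasDerivedCategory.{w₄} D] (F : C ⥤ D) (G : D ⥤ C)
    [F.Additive] [G.Additive] [PreservesFiniteLimits F] [PreservesFiniteColimits F]
    [PreservesFiniteLimits G] [PreservesFiniteColimits G] (e : F ⋙ G ≅ 𝟭 C) :
    F.mapDerivedCategory ⋙ G.mapDerivedCategory ≅ 𝟭 (DerivedCategory C) :=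
  Localization.liftNatIso DerivedCategory.Q (HomologicalComplex.quasiIso C (ComplexShape.up ℤ))
    (DerivedCategory.Q ⋙ F.mapDerivedCategory ⋙ G.mapDerivedCategory) (DerivedCategory.Q ⋙ 𝟭 _) _ _
    ((Functor.associator _ _ _).symm ≪≫ Functor.isoWhiskerRight F.mapDerivedCategoryFactors _ ≪≫
      Functor.associator _ _ _ ≪≫ Functor.isoWhiskerLeft _ G.mapDerivedCategoryFactors ≪≫
      (Functor.associator _ _ _).symm ≪≫
      Functor.isoWhiskerRight (mapHomologicalComplexIsoId F G e) DerivedCategory.Q ≪≫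
      Functor.leftUnitor _ ≪≫ (Functor.rightUnitor _).symm)

end DerivedFunctors

section Restriction

variable {k : Type w} [Field k] {R A : Type u} [Ring R] [Ring A] [Algebra k R] [Algebra k A]
  [Module.Finite k R] [Module.Finite k A] [IsNoetherianRing R] [IsNoetherianRing A]

/-- Restriction along `A → R` and then along its section `R → A`. -/
def restrictSectionIso {φ : R →ₐ[k] A} {π : A →ₐ[k] R} (h : ∀ r, π (φ r) = r) :
    restrict π ⋙ restrict φ ≅ 𝟭 (FGModuleCat.{u} R) :=
  NatIso.ofComponents (fun N =>
    let X := (restrict φ).obj ((restrict π).obj N)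
    let l : X ≃ₗ[R] N :=
      { toFun := fun n => n
        invFun := fun n => n
        left_inv := fun _ => rfl
        right_inv := fun _ => rfl
        map_add' := fun _ _ => rfl
        map_smul' := fun r n => congrArg (fun r : R => r • (show N from n)) (h r) }
    { hom := ObjectProperty.homMk (ModuleCat.ofHom (X := X) (Y := N) l.toLinearMap)
      inv := ObjectProperty.homMk (ModuleCat.ofHom (X := N) (Y := X) l.symm.toLinearMap)
      hom_inv_id := rfl
      inv_hom_id := rfl }) (fun f => rfl)

variable [HasDerivedCategory.{w₁} (FGModuleCat.{u} R)] [HasDerivedCategory.{w₂} (FGModuleCat.{u} A)]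

/-- Restriction of scalars commutes with stalk complexes. -/
def stalkRestrictIso (φ : R →ₐ[k] A) : stalk A ⋙ restrictDb φ ≅ restrict φ ⋙ stalk R :=
  Functor.fullyFaithfulCancelRight DerivedCategory.Bounded.ι
    (show stalk A ⋙ restrictDb φ ⋙ DerivedCategory.Bounded.ι ≅
      restrict φ ⋙ stalk R ⋙ DerivedCategory.Bounded.ι from
        (restrict φ).mapDerivedCategorySingleFunctor 0)

/-- Restriction on bounded derived categories along `A → R` and then along its section `R → A`. -/
def restrictDbSectionIso {φ : R →ₐ[k] A} {π : A →ₐ[k] R} (h : ∀ r, π (φ r) = r) :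
    restrictDb π ⋙ restrictDb φ ≅ 𝟭 (Db R) :=
  Functor.fullyFaithfulCancelRight DerivedCategory.Bounded.ι
    (show restrictDb π ⋙ restrictDb φ ⋙ DerivedCategory.Bounded.ι ≅
      𝟭 (Db R) ⋙ DerivedCategory.Bounded.ι from
        Functor.isoWhiskerLeft DerivedCategory.Bounded.ι
          (mapDerivedCategoryIsoId _ _ (restrictSectionIso h)))

end Restriction

theorem unit_comp_map_homEquiv_symm {C : Type*} [Category* C] {D : Type*} [Category* D]
    {F : C ⥤ D} {G : D ⥤ C} (adj : F ⊣ G) {X : C} {Y : D} (a : X ⟶ G.obj Y) :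
    adj.unit.app X ≫ G.map ((adj.homEquiv X Y).symm a) = a :=
  (adj.homEquiv_unit ..).symm.trans ((adj.homEquiv X Y).apply_symm_apply a)

section FinitelyGeneratedInduction

variable {k : Type w} [Field k] {R A : Type u} [Ring R] [Ring A] [Algebra k R] [Algebra k A]

/-- Extension of scalars of finitely generated modules. -/
def fgInduce (φ : R →ₐ[k] A) : FGModuleCat.{u} R ⥤ FGModuleCat.{u} A :=
  ObjectProperty.lift _ ((ModuleCat.isFG R).ι ⋙ induce φ.toRingHom)
    (fun N => have : Module.Finite R N.obj := N.property; finite_induced φ.toRingHom N.obj)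

variable [Module.Finite k A]

/-- The adjunction between extension and restriction of scalars of finitely generated modules. -/
def fgInduceAdj (φ : R →ₐ[k] A) : fgInduce φ ⊣ restrict φ :=
  (induceAdj φ.toRingHom).restrictFullyFaithful (ModuleCat.isFG R).fullyFaithfulι
    (ModuleCat.isFG A).fullyFaithfulι (Iso.refl _) (Iso.refl _)

theorem fgInduceAdj_unit_app_hom (φ : R →ₐ[k] A) (N : FGModuleCat.{u} R) :
    ((fgInduceAdj φ).unit.app N).hom = inducedUnit φ.toRingHom N.obj := by
  have := (induceAdj φ.toRingHom).map_restrictFullyFaithful_unit_app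
    (ModuleCat.isFG R).fullyFaithfulι (ModuleCat.isFG A).fullyFaithfulι
    (L := fgInduce φ) (R := restrict φ) (Iso.refl _) (Iso.refl _) N
  refine this.trans ?_
  rw [induceAdj_unit_app]
  rfl

instance (φ : R →ₐ[k] A) : (restrict φ).Faithful where
  map_injective h := ObjectProperty.hom_ext _
    ((ModuleCat.restrictScalars φ.toRingHom).map_injective (congrArg (fun f => f.hom) h))

variable [IsNoetherianRing R] [IsNoetherianRing A]

instance (φ : R →ₐ[k] A) : (fgInduce φ).Additive := (fgInduceAdj φ).left_adjoint_additive

theorem projective_fgInduce (φ : R →ₐ[k] A) (Q : FGModuleCat.{u} R) [Module.Projective R Q] :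
    Module.Projective A ((fgInduce φ).obj Q) := by
  have := projective_of_module Q
  have := (fgInduceAdj φ).map_projective Q this
  exact module_projective_of_projective _

theorem shortExact_restrict (φ : R →ₐ[k] A) {S : ShortComplex (FGModuleCat.{u} A)}
    (hS : S.ShortExact) :
    ((S.map (toModule A)).map (ModuleCat.restrictScalars φ.toRingHom)).ShortExact :=
  (shortExact_toModule hS).map_of_exact _

end FinitelyGeneratedInduction

/-! ### The singular equivalence. -/

section SingularEquivalence

variable {k : Type w} [Field k] {R A : Type u} [Ring R] [Ring A] [Algebra k R] [Algebra k A]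
  [Module.Finite k A] [IsNoetherianRing R] [IsNoetherianRing A]
  {φ : R →ₐ[k] A} {π : A →ₐ[k] R} (H : TensorNilpotentSplitting φ π)

include H

theorem TensorNilpotentSplitting.finPD_of_isZero_tensorPower {p : ℕ}
    (hp : IsZero (tensorPower (quotientBimodule φ) p)) (M : FGModuleCat.{u} A)
    (hM : TensorAcyclic (quotientBimodule φ) p ((toModule R).obj ((restrict φ).obj M)))
    (h : FinPD ((toModule R).obj ((restrict φ).obj M))) : FinPD ((toModule A).obj M) := by
  have : Module.Finite R ((toModule R).obj ((restrict φ).obj M)) := ((restrict φ).obj M).property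
  exact H.finPD_of_tensorAcyclic p ((toModule A).obj M) hM
    (isZero_tensorIterate hp ((toModule R).obj ((restrict φ).obj M))) h

/-- Restricted to `R`, the syzygies over `A` are syzygies relative to restricted projectives, and
these are acyclic to all orders. -/
theorem TensorNilpotentSplitting.exists_tensorAcyclic_syzygy (M : FGModuleCat.{u} A) (n : ℕ) :
    ∃ j : ℕ, TensorAcyclic (quotientBimodule φ) n
      ((toModule R).obj ((restrict φ).obj (syzygy^[j] M))) := by
  obtain ⟨d, hd⟩ := H.finPD
  have := hasInjectiveDimensionLT_homFunctor (injectiveCoseparator R) d _ hd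
  refine ⟨n * d, TensorAcyclic.of_syzygy this n
    (S := fun j => ((syzygySequence (syzygy^[j] M)).map (toModule A)).map
      (ModuleCat.restrictScalars φ.toRingHom))
    (fun j => shortExact_restrict φ (syzygySequence_shortExact _))
    (fun j => ((toModule A) ⋙ (ModuleCat.restrictScalars φ.toRingHom)).mapIso
      (eqToIso (Function.iterate_succ_apply' syzygy j M).symm)) (fun m j => ?_) (n * d) le_rfl⟩
  have : Module.Finite A
      ((toModule A).obj (Projective.over (C := FGModuleCat.{u} A) (syzygy^[j] M))) :=
    (Projective.over (C := FGModuleCat.{u} A) (syzygy^[j] M)).property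
  have : Module.Projective A
      ((toModule A).obj (Projective.over (C := FGModuleCat.{u} A) (syzygy^[j] M))) :=
    module_projective_of_projective (Projective.over (C := FGModuleCat.{u} A) (syzygy^[j] M))
  exact (H.restrict_projective
    ((toModule A).obj (Projective.over (C := FGModuleCat.{u} A) (syzygy^[j] M)))).2 m

theorem TensorNilpotentSplitting.finPD_restrict_projective (Q : FGModuleCat.{u} A)
    [hQ : Module.Projective A Q] : FinPD ((toModule R).obj ((restrict φ).obj Q)) := by
  have : Module.Finite A ((toModule A).obj Q) := Q.property
  have : Module.Projective A ((toModule A).obj Q) := hQ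
  exact (H.restrict_projective ((toModule A).obj Q)).1

/-- Finitely generated modules over `A` of finite projective dimension over `R` have finite
projective dimension. -/
theorem TensorNilpotentSplitting.finPD_of_restrict (M : FGModuleCat.{u} A)
    (h : FinPD ((toModule R).obj ((restrict φ).obj M))) : FinPD ((toModule A).obj M) := by
  obtain ⟨p, hp⟩ := H.nilpotent
  -- The nilpotency argument applies to the `j`-th syzygy; the induction then climbs back to `M`.
  obtain ⟨j, hj⟩ := H.exists_tensorAcyclic_syzygy M p
  induction j generalizing M with
  | zero => exact H.finPD_of_isZero_tensorPower hp M hj h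
  | succ j ih =>
    have hS := syzygySequence_shortExact M
    have h₁ := ih (syzygy M) (FinPD.X₁ (shortExact_restrict φ hS)
      (H.finPD_restrict_projective (Projective.over (C := FGModuleCat.{u} A) M)) h) hj
    have := projective_toModule_obj (Projective.over (C := FGModuleCat.{u} A) M)
    exact FinPD.X₃ (shortExact_toModule hS) h₁
      (.of_projective ((toModule A).obj (Projective.over (C := FGModuleCat.{u} A) M)))

/-- Restricting further along `φ` returns the projective `Q`, and finiteness over `R` implies
finiteness over `A`. -/
theorem TensorNilpotentSplitting.finPD_restrict_section_projective [Module.Finite k R]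
    (Q : FGModuleCat.{u} R) [Module.Projective R Q] :
    FinPD ((toModule A).obj ((restrict π).obj Q)) := by
  have := projective_toModule_obj Q
  exact H.finPD_of_restrict _ ((FinPD.of_projective ((toModule R).obj Q)).of_iso
    ((toModule R).mapIso ((restrictSectionIso H.split).app Q)))

/-- If a map `A ⊗_R N → Y` is an isomorphism on `N`, then its kernel has finite projective
dimension. -/
theorem TensorNilpotentSplitting.finPD_kernel {p : ℕ}
    (hp : IsZero (tensorPower (quotientBimodule φ) p)) {N : FGModuleCat.{u} R}
    (hN : TensorAcyclic (quotientBimodule φ) (p + 1) ((toModule R).obj N)) {Y : FGModuleCat.{u} A}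
    (g : (fgInduce φ).obj N ⟶ Y) (hg : IsIso ((fgInduceAdj φ).unit.app N ≫ (restrict φ).map g)) :
    Epi g ∧ FinPD ((toModule A).obj (kernel g)) := by
  have : Epi ((restrict φ).map g) := epi_of_epi ((fgInduceAdj φ).unit.app N) _
  have hepi : Epi g := (restrict φ).epi_of_epi_map this
  let S := ShortComplex.mk (kernel.ι g) g (kernel.condition g)
  have hS : S.ShortExact := { exact := ShortComplex.exact_kernel _ }
  obtain ⟨e⟩ := exists_iso_kernel_of_retraction (inducedSequence_shortExact H.split N.obj)
    (shortExact_restrict φ hS) (Iso.refl _) (by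
      have h1 : IsIso ((toModule R).map ((fgInduceAdj φ).unit.app N ≫ (restrict φ).map g)) :=
        inferInstance
      rw [Functor.map_comp] at h1
      have h2 : (toModule R).map ((fgInduceAdj φ).unit.app N) = inducedUnit φ.toRingHom N.obj :=
        fgInduceAdj_unit_app_hom φ N
      rw [h2] at h1
      refine (congrArg IsIso ?_).mpr h1
      exact congrArg _ (Category.id_comp _))
  exact ⟨hepi, H.finPD_of_isZero_tensorPower hp _ (hN.2.of_iso e) ((H.finPD_tensor hN.1).of_iso e)⟩

variable [Module.Finite k R]
  [HasDerivedCategory.{w₁} (FGModuleCat.{u} R)] [HasDerivedCategory.{w₂} (FGModuleCat.{u} A)]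

theorem TensorNilpotentSplitting.perfect_le : perfect A ≤ (perfect R).inverseImage (restrictDb φ) :=
  RingExt.perfect_le fun Q _ => (perfect R).prop_of_iso ((stalkRestrictIso φ).app Q).symm
    (perfect_stalk_of_finPD _ (H.finPD_restrict_projective Q))

theorem TensorNilpotentSplitting.perfect_le_section :
    perfect R ≤ (perfect A).inverseImage (restrictDb π) :=
  RingExt.perfect_le fun Q _ => (perfect A).prop_of_iso ((stalkRestrictIso π).app Q).symm
    (perfect_stalk_of_finPD _ (H.finPD_restrict_section_projective Q))

/-- The functor `D_sg(A) ⥤ D_sg(R)` induced by restriction of scalars. -/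
abbrev TensorNilpotentSplitting.restrictDsg : Dsg A ⥤ Dsg R :=
  verdierMap (restrictDb φ) H.perfect_le

/-- The functor `D_sg(R) ⥤ D_sg(A)` induced by restriction of scalars. -/
abbrev TensorNilpotentSplitting.sectionDsg : Dsg R ⥤ Dsg A :=
  verdierMap (restrictDb π) H.perfect_le_section

/-- The composition `D_sg(R) ⥤ D_sg(A) ⥤ D_sg(R)` is the identity. -/
def TensorNilpotentSplitting.sectionDsgIso : H.sectionDsg ⋙ H.restrictDsg ≅ 𝟭 (Dsg R) :=
  Localization.liftNatIso (toDsg R) (perfect R).trW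
    (toDsg R ⋙ H.sectionDsg ⋙ H.restrictDsg) (toDsg R ⋙ 𝟭 _) _ _
    ((Functor.associator _ _ _).symm ≪≫ Functor.isoWhiskerRight (verdierMapIso _ _) _ ≪≫
      Functor.associator _ _ _ ≪≫ Functor.isoWhiskerLeft _ (verdierMapIso _ _) ≪≫
      (Functor.associator _ _ _).symm ≪≫
      Functor.isoWhiskerRight (restrictDbSectionIso H.split) (toDsg R) ≪≫
      Functor.leftUnitor _ ≪≫ (Functor.rightUnitor _).symm)

/-- `A ⊗_R M` maps to `M` by the counit, and to `M` with the action through `π` by the adjunct of an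
isomorphism. Each map is an isomorphism on the copy of `M` in `A ⊗_R M`, so its kernel has finite
projective dimension and it becomes invertible in `D_sg(A)`. -/
theorem TensorNilpotentSplitting.exists_iso_section_stalk {p : ℕ}
    (hp : IsZero (tensorPower (quotientBimodule φ) p)) (M : FGModuleCat.{u} A)
    (hM : TensorAcyclic (quotientBimodule φ) (p + 1) ((toModule R).obj ((restrict φ).obj M))) :
    Nonempty ((toDsg A).obj ((stalk A).obj M) ≅
      H.sectionDsg.obj ((toDsg R).obj ((stalk R).obj ((restrict φ).obj M)))) := by
  have key {Y : FGModuleCat.{u} A} (g : (fgInduce φ).obj ((restrict φ).obj M) ⟶ Y)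
      (hg : IsIso ((fgInduceAdj φ).unit.app _ ≫ (restrict φ).map g)) :
      IsIso ((toDsg A).map ((stalk A).map g)) := by
    obtain ⟨_, h⟩ := H.finPD_kernel hp hM g hg
    exact isIso_toDsg_map (S := ShortComplex.mk (kernel.ι g) g (kernel.condition g))
      { exact := ShortComplex.exact_kernel _ } h
  have h₁ := key ((fgInduceAdj φ).counit.app M) 
    ((congrArg IsIso ((fgInduceAdj φ).right_triangle_components M)).mpr (IsIso.id _))
  let a : (restrict φ).obj M ⟶ (restrict φ).obj ((restrict π).obj ((restrict φ).obj M)) :=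
    (restrictSectionIso H.split).inv.app ((restrict φ).obj M)
  have h₂ := key (((fgInduceAdj φ).homEquiv _ _).symm a) 
    ((congrArg IsIso (unit_comp_map_homEquiv_symm (fgInduceAdj φ) a)).mpr inferInstance)
  exact ⟨(asIso ((toDsg A).map ((stalk A).map ((fgInduceAdj φ).counit.app M)))).symm ≪≫
    asIso ((toDsg A).map ((stalk A).map (((fgInduceAdj φ).homEquiv _ _).symm a))) ≪≫
    (toDsg A).mapIso ((stalkRestrictIso π).symm.app ((restrict φ).obj M)) ≪≫
    (verdierMapIso (restrictDb π) H.perfect_le_section).symm.app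
      ((stalk R).obj ((restrict φ).obj M))⟩

/-- Up to a shift, every object is the stalk of a syzygy high enough to be acyclic, hence lies in
the image. -/
theorem TensorNilpotentSplitting.sectionDsg_essSurj : H.sectionDsg.EssSurj := ⟨fun X => by
  have := Localization.essSurj (toDsg A) (perfect A).trW
  obtain ⟨M, n, ⟨e⟩⟩ := exists_iso_stalk_shift ((toDsg A).objPreimage X)
  obtain ⟨p, hp⟩ := H.nilpotent
  obtain ⟨j, hj⟩ := H.exists_tensorAcyclic_syzygy M (p + 1)
  obtain ⟨m, ⟨e'⟩⟩ := exists_iso_syzygy_iterate M n j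
  obtain ⟨e''⟩ := H.exists_iso_section_stalk hp _ hj
  exact ⟨_, ⟨(H.sectionDsg.commShiftIso m).app _ ≪≫ (shiftFunctor (Dsg A) m).mapIso e''.symm ≪≫
    (((toDsg A).commShiftIso m).app _).symm ≪≫ e'.symm ≪≫ e.symm ≪≫
    (toDsg A).objObjPreimageIso X⟩⟩⟩

theorem TensorNilpotentSplitting.restrictDsg_isEquivalence : H.restrictDsg.IsEquivalence := by
  have := H.sectionDsg_essSurj
  have : H.sectionDsg.PreservesZeroMorphisms :=
    (verdierMap (restrictDb π) H.perfect_le_section).preservesZeroMorphisms_of_additive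
  exact isEquivalence_of_section H.restrictDsg H.sectionDsg H.sectionDsgIso

end SingularEquivalence

/-! ### Images of acyclic complexes, cycle by cycle. -/

section CycleSequences

universe v₁ u₁ v₂ u₂

variable {C : Type u₁} [Category.{v₁} C] [Abelian C] {D : Type u₂} [Category.{v₂} D] [Abelian D]
  (K : CochainComplex C ℤ)

/-- The sequence `0 → Zⁿ → Kⁿ → Zⁿ⁺¹ → 0`, where `Z` are the cycles of `K`. -/
abbrev cycleSequence (n : ℤ) : ShortComplex C :=
  ShortComplex.mk (X₁ := kernel (K.d n (n + 1))) (X₂ := K.X n)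
    (X₃ := kernel (K.d (n + 1) (n + 1 + 1))) (kernel.ι _)
    (kernel.lift _ (K.d n (n + 1)) (K.d_comp_d _ _ _))
    (by rw [← cancel_mono (kernel.ι _), Category.assoc, kernel.lift_ι, kernel.condition, zero_comp])

theorem cycleSequence_g_ι (n : ℤ) :
    (cycleSequence K n).g ≫ (cycleSequence K (n + 1)).f = K.d n (n + 1) := kernel.lift_ι _ _ _

variable {K}

theorem cycleSequence_shortExact (hK : K.Acyclic) (n : ℤ) : (cycleSequence K n).ShortExact where
  mono_f := inferInstanceAs (Mono (kernel.ι _))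
  epi_g := ((HomologicalComplex.exactAt_iff' K n (n + 1) (n + 1 + 1) (by simp) (by simp)).1
    (hK (n + 1))).epi_kernelLift
  exact := by
    let τ : cycleSequence K n ⟶ ShortComplex.mk _ _ (kernel.condition (K.d n (n + 1))) :=
      { τ₁ := 𝟙 _
        τ₂ := 𝟙 _
        τ₃ := kernel.ι _
        comm₁₂ := (Category.id_comp _).trans (Category.comp_id _).symm
        comm₂₃ := (Category.id_comp _).trans (cycleSequence_g_ι K n).symm }
    have : Epi τ.τ₁ := inferInstanceAs (Epi (𝟙 _))
    have : IsIso τ.τ₂ := inferInstanceAs (IsIso (𝟙 _))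
    have : Mono τ.τ₃ := inferInstanceAs (Mono (kernel.ι _))
    exact (ShortComplex.exact_iff_of_epi_of_isIso_of_mono τ).2 (ShortComplex.exact_kernel _)

variable (F : C ⥤ D) [F.Additive] (h : ∀ n, ((cycleSequence K n).map F).ShortExact)
include h

/-- The image complex is spliced from the exact images of the cycle sequences; replacing the left
term along an epimorphism and the right term along a monomorphism does not affect exactness. -/
theorem acyclic_mapHomologicalComplex :
    ((F.mapHomologicalComplex (ComplexShape.up ℤ)).obj K).Acyclic := by
  intro i
  obtain ⟨n, rfl⟩ : ∃ n, i = n + 1 := ⟨i - 1, by lia⟩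
  rw [HomologicalComplex.exactAt_iff' _ n (n + 1) (n + 1 + 1) (by simp) (by simp)]
  let T₁ := (cycleSequence K (n + 1)).map F
  have hd : K.d n (n + 1) ≫ (cycleSequence K (n + 1)).g = 0 := by
    have := (h (n + 1)).mono_f
    rw [← cycleSequence_g_ι, Category.assoc, ShortComplex.zero, comp_zero]
  let T₂ := ShortComplex.mk (F.map (K.d n (n + 1))) (F.map (cycleSequence K (n + 1)).g)
    (by rw [← F.map_comp, hd, F.map_zero])
  let τ : T₂ ⟶ T₁ :=
    { τ₁ := F.map (cycleSequence K n).g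
      τ₂ := 𝟙 _
      τ₃ := 𝟙 _
      comm₁₂ := ((F.map_comp _ _).symm.trans (congrArg F.map (cycleSequence_g_ι K n))).trans
        (Category.comp_id _).symm
      comm₂₃ := (Category.id_comp _).trans (Category.comp_id _).symm }
  have : Epi τ.τ₁ := (h n).epi_g
  have : IsIso τ.τ₂ := inferInstanceAs (IsIso (𝟙 _))
  have : Mono τ.τ₃ := inferInstanceAs (Mono (𝟙 _))
  have hT₂ : T₂.Exact := (ShortComplex.exact_iff_of_epi_of_isIso_of_mono τ).2 (h (n + 1)).exact
  let τ' : T₂ ⟶ ((F.mapHomologicalComplex (ComplexShape.up ℤ)).obj K).sc' n (n + 1) (n + 1 + 1) :=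
    { τ₁ := 𝟙 _
      τ₂ := 𝟙 _
      τ₃ := F.map (cycleSequence K (n + 1 + 1)).f
      comm₁₂ := (Category.id_comp _).trans (Category.comp_id _).symm
      comm₂₃ := (Category.id_comp _).trans
        ((F.map_comp _ _).symm.trans (congrArg F.map (cycleSequence_g_ι K (n + 1)))).symm }
  have : Epi τ'.τ₁ := inferInstanceAs (Epi (𝟙 _))
  have : IsIso τ'.τ₂ := inferInstanceAs (IsIso (𝟙 _))
  have : Mono τ'.τ₃ := (h (n + 1 + 1)).mono_f
  exact (ShortComplex.exact_iff_of_epi_of_isIso_of_mono τ').1 hT₂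

theorem exists_iso_kernel_mapHomologicalComplex (n : ℤ) :
    Nonempty (F.obj (kernel (K.d n (n + 1))) ≅
      kernel (((F.mapHomologicalComplex (ComplexShape.up ℤ)).obj K).d n (n + 1))) := by
  have := (h n).mono_f
  have hk := isKernelCompMono (h n).exact.fIsKernel
    (F.map (kernel.ι (K.d (n + 1) (n + 1 + 1))))
    (hg := (h (n + 1)).mono_f)
    (h := ((F.mapHomologicalComplex (ComplexShape.up ℤ)).obj K).d n (n + 1))
    ((F.map_comp _ _).symm.trans (congrArg F.map (cycleSequence_g_ι K n))).symm
  exact ⟨hk.conePointUniqueUpToIso (limit.isLimit _)⟩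

end CycleSequences

/-! ### Complete resolutions and finite projective dimension. -/

section TotallyAcyclic

variable {R : Type u} [Ring R] [IsNoetherianRing R]
  {P : CochainComplex (FGModuleCat.{u} R) ℤ} (hP : IsTotallyAcyclic P)
include hP

/-- `Hom(P, Z)` is exact for a complete resolution `P` and `Z` of finite projective dimension. -/
theorem IsTotallyAcyclic.hom_exact_of_finPD {Z : FGModuleCat.{u} R}
    (hZ : FinPD ((toModule R).obj Z)) {i j l : ℤ} (hij : i + 1 = j) (hjl : j + 1 = l)
    (f : P.X j ⟶ Z) (hf : P.d i j ≫ f = 0) : ∃ g : P.X l ⟶ Z, P.d j l ≫ g = f := by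
  obtain ⟨n, hn⟩ := hZ
  induction n generalizing Z i j l with
  | zero =>
    have : Projective ((toModule R).obj Z) := (projective_iff_hasProjectiveDimensionLT_one).2 hn
    exact hP.hom_exact Z ((IsProjective.iff_projective (Z : Type u)).2 this) i j l hij hjl f hf
  | succ n ih =>
    have hS := syzygySequence_shortExact Z
    have hS' := shortExact_toModule hS
    have := hS.mono_f
    have := projective_toModule_obj (Projective.over (C := FGModuleCat.{u} R) Z)
    have hK := hS'.hasProjectiveDimensionLT_X₁ (n + 1) (hasProjectiveDimensionLT_of_ge
      ((toModule R).obj (Projective.over (C := FGModuleCat.{u} R) Z)) 1 _ (by lia)) hn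
    have := hP.projective j
    have := projective_of_module (P.X j)
    have := hS.epi_g
    let f' : P.X j ⟶ (syzygySequence Z).X₂ := Projective.factorThru f (syzygySequence Z).g
    have hf' : f' ≫ (syzygySequence Z).g = f := Projective.factorThru_comp _ _
    have hdf : (P.d i j ≫ f') ≫ (syzygySequence Z).g = 0 := by rw [Category.assoc, hf', hf]
    have hk : hS.exact.lift _ hdf ≫ (syzygySequence Z).f = P.d i j ≫ f' := hS.exact.lift_f _ _
    -- The lift `f'` of `f` to the projective cover need not be a cocycle, but `P.d i j ≫ f'` lands
    -- in the syzygy. By induction it is the differential of some `h'`, and subtracting `h'` makes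
    -- `f'` a cocycle with projective values.
    obtain ⟨h', hh'⟩ := ih (i := i - 1) (by lia) hij (hS.exact.lift _ hdf) (by
      rw [← cancel_mono (syzygySequence Z).f, Category.assoc, hk, P.d_comp_d_assoc, zero_comp,
        zero_comp]) hK
    obtain ⟨g, hg⟩ := hP.hom_exact (syzygySequence Z).X₂
      (inferInstanceAs (Module.Projective R (Projective.over (C := FGModuleCat.{u} R) Z :
        FGModuleCat.{u} R))) i j l hij hjl (f' - h' ≫ (syzygySequence Z).f) (by
      rw [Preadditive.comp_sub, reassoc_of% hh', hk, sub_self])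
    have hz : (h' ≫ (syzygySequence Z).f) ≫ (syzygySequence Z).g = 0 :=
      (Category.assoc _ _ _).trans ((congrArg (h' ≫ ·) (syzygySequence Z).zero).trans comp_zero)
    exact ⟨g ≫ (syzygySequence Z).g, by
      rw [reassoc_of% hg, Preadditive.sub_comp, hf', hz, sub_zero]⟩

/-- Precomposed with the epimorphism from `P.X (n - 1)` onto the cycles, `f` becomes a cocycle of
`Hom(P, Z)`, and hence a coboundary. -/
theorem IsTotallyAcyclic.exists_extension {Z : FGModuleCat.{u} R}
    (hZ : FinPD ((toModule R).obj Z)) (n : ℤ) (f : kernel (P.d n (n + 1)) ⟶ Z) :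
    ∃ g : P.X n ⟶ Z, kernel.ι (P.d n (n + 1)) ≫ g = f := by
  obtain ⟨m, rfl⟩ : ∃ m, n = m + 1 := ⟨n - 1, by lia⟩
  have hS := cycleSequence_shortExact hP.acyclic m
  have := hS.epi_g
  have hd := cycleSequence_g_ι P m
  have : Mono (cycleSequence P (m + 1)).f := (cycleSequence_shortExact hP.acyclic (m + 1)).mono_f
  obtain ⟨g, hg⟩ := hP.hom_exact_of_finPD hZ (sub_add_cancel m 1) rfl
    ((cycleSequence P m).g ≫ f) (by
      have : P.d (m - 1) m ≫ (cycleSequence P m).g = 0 := by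
        rw [← cancel_mono (cycleSequence P (m + 1)).f, Category.assoc, hd, P.d_comp_d, zero_comp]
      exact (Category.assoc _ _ _).symm.trans ((congrArg (· ≫ f) this).trans zero_comp))
  refine ⟨g, (cancel_epi (cycleSequence P m).g).1 ?_⟩
  exact (Category.assoc _ _ _).symm.trans ((congrArg (· ≫ g) hd).trans hg)

/-- This is `Ext¹(cycles, kernel q) = 0`. A lift exists on the projective `P.X (n - 1)`; its
restriction to the preceding cycles has values in `kernel q`, and extending that restriction
corrects the lift so that it descends. -/
theorem IsTotallyAcyclic.exists_lift {Y Z : FGModuleCat.{u} R} (q : Y ⟶ Z) [Epi q]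
    (hq : FinPD ((toModule R).obj (kernel q))) (n : ℤ) (f : kernel (P.d n (n + 1)) ⟶ Z) :
    ∃ g : kernel (P.d n (n + 1)) ⟶ Y, g ≫ q = f := by
  obtain ⟨m, rfl⟩ : ∃ m, n = m + 1 := ⟨n - 1, by lia⟩
  have hS := cycleSequence_shortExact hP.acyclic m
  have := hS.epi_g
  have := hP.projective m
  have := projective_of_module (P.X m)
  let S := cycleSequence P m
  let f' : S.X₂ ⟶ Y := Projective.factorThru (P := P.X m) (S.g ≫ f) q
  have hf' : f' ≫ q = S.g ≫ f := Projective.factorThru_comp _ _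
  have h0 : (S.f ≫ f') ≫ q = 0 := by
    rw [Category.assoc, hf']
    exact (Category.assoc _ _ _).symm.trans ((congrArg (· ≫ f) S.zero).trans zero_comp)
  obtain ⟨g', hg'⟩ : ∃ g' : S.X₂ ⟶ kernel q, S.f ≫ g' = kernel.lift q (S.f ≫ f') h0 :=
    hP.exists_extension hq m _
  have h1 : S.f ≫ (f' - g' ≫ kernel.ι q) = 0 := by
    rw [Preadditive.comp_sub, reassoc_of% hg', kernel.lift_ι, sub_self]
  refine ⟨hS.exact.desc _ h1, (cancel_epi S.g).1 ?_⟩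
  have h2 : S.g ≫ hS.exact.desc _ h1 = f' - g' ≫ kernel.ι q := hS.exact.g_desc _ _
  rw [reassoc_of% h2, Preadditive.sub_comp, hf', Category.assoc, kernel.condition, comp_zero,
    sub_zero]

omit hP

theorem gproj.exists_extension {M : FGModuleCat.{u} R} (hM : gproj R M) :
    ∃ (P : FGModuleCat.{u} R) (_ : Module.Projective R P) (ι : M ⟶ P),
      ∀ {Z : FGModuleCat.{u} R}, FinPD ((toModule R).obj Z) → ∀ f : M ⟶ Z,
        ∃ g : P ⟶ Z, ι ≫ g = f := by
  obtain ⟨P, hP, ⟨e⟩⟩ := hM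
  refine ⟨P.X 0, hP.projective 0, e.hom ≫ kernel.ι _, fun {Z} hZ f => ?_⟩
  obtain ⟨g, hg⟩ := hP.exists_extension hZ 0 (e.inv ≫ f)
  exact ⟨g, (Category.assoc _ _ _).trans ((congrArg (e.hom ≫ ·) hg).trans (e.hom_inv_id_assoc f))⟩

theorem gproj.exists_lift {M : FGModuleCat.{u} R} (hM : gproj R M) {Y Z : FGModuleCat.{u} R}
    (q : Y ⟶ Z) [Epi q] (hq : FinPD ((toModule R).obj (kernel q))) (f : M ⟶ Z) :
    ∃ g : M ⟶ Y, g ≫ q = f := by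
  obtain ⟨P, hP, ⟨e⟩⟩ := hM
  obtain ⟨g, hg⟩ := hP.exists_lift q hq 0 (e.inv ≫ f)
  exact ⟨e.hom ≫ g, (Category.assoc _ _ _).trans
    ((congrArg (e.hom ≫ ·) hg).trans (e.hom_inv_id_assoc f))⟩

end TotallyAcyclic

/-! ### Gorenstein projectives under extension of scalars. -/

section Sequences

variable {k : Type w} [Field k] {R : Type u} [Ring R] [Algebra k R]

/-- Reindexing of a sequence of short exact sequences. -/
def sequenceIso {C : Type*} [Category* C] [HasZeroMorphisms C] {S : ℤ → ShortComplex C}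
    (e : ∀ n, (S (n + 1)).X₁ ≅ (S n).X₃) (c : ℤ) (j : ℕ) :
    (S (c - j)).X₁ ≅ (S (c - (j + 1 : ℕ))).X₃ :=
  eqToIso (congrArg (fun i => (S i).X₁) (by push_cast; lia)) ≪≫ e (c - (j + 1 : ℕ))

/-- In a sequence infinite to the right, each term is an `m * d`-th syzygy of a later one. -/
theorem tensorAcyclic_of_sequence {V : ModuleCat.{u} (Env k R)} (hV : FinPD V)
    {S : ℤ → ShortComplex (ModuleCat.{u} R)} (hS : ∀ n, (S n).ShortExact)
    (e : ∀ n, (S (n + 1)).X₁ ≅ (S n).X₃) (hF : ∀ n m, TensorAcyclic V m (S n).X₂) (n : ℤ) (m : ℕ) :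
    TensorAcyclic V m (S n).X₃ := by
  obtain ⟨d, hd⟩ := hV
  have := TensorAcyclic.of_syzygy (hasInjectiveDimensionLT_homFunctor (injectiveCoseparator R) d _ hd)
    m (S := fun j => S (n + (m * d : ℕ) - j)) (fun j => hS _) (fun j => sequenceIso e _ j)
    (fun m j => hF _ m) (m * d) le_rfl
  simpa only [add_sub_cancel_right] using this

/-- Each term is a `p`-th syzygy of a later one, so uniform vanishing above degree `p` improves to
vanishing in all positive degrees. -/
theorem extAcyclic_of_sequence {S : ℤ → ShortComplex (ModuleCat.{u} R)}
    (hS : ∀ n, (S n).ShortExact) (e : ∀ n, (S (n + 1)).X₁ ≅ (S n).X₃) {Y : ModuleCat.{u} R}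
    (hY : ∀ n, ExtAcyclic Y (S n).X₂) (p : ℕ)
    (h : ∀ n i, Subsingleton (Abelian.Ext (S n).X₃ Y (i + 1 + p))) (n : ℤ) :
    ExtAcyclic Y (S n).X₃ := by
  intro i
  have := ext_subsingleton_iterate_syzygy (S := fun j => S (n + p - j)) (fun j => hS _)
    (fun j => sequenceIso e _ j) (fun j => hY _) i p (h _ i)
  simpa only [add_sub_cancel_right] using this

end Sequences

theorem exists_extension_leftAdjoint {C : Type*} [Category* C] [Preadditive C] {D : Type*}
    [Category* D] [Preadditive D] {F : C ⥤ D} {G : D ⥤ C} (adj : F ⊣ G) [F.Additive] {X Y Z : C}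
    (d : X ⟶ Y) (d' : Y ⟶ Z) {Q : D}
    (h : ∀ f : Y ⟶ G.obj Q, d ≫ f = 0 → ∃ g : Z ⟶ G.obj Q, d' ≫ g = f)
    (f : F.obj Y ⟶ Q) (hf : F.map d ≫ f = 0) : ∃ g : F.obj Z ⟶ Q, F.map d' ≫ g = f := by
  obtain ⟨g, hg⟩ := h (adj.homEquiv _ _ f) (by
    rw [← adj.homEquiv_naturality_left, hf]
    exact (adj.homAddEquiv _ _).map_zero)
  exact ⟨(adj.homEquiv _ _).symm g, by
    rw [← adj.homEquiv_naturality_left_symm, hg, Equiv.symm_apply_apply]⟩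

section GorensteinProjective

variable {k : Type w} [Field k] {R A : Type u} [Ring R] [Ring A] [Algebra k R] [Algebra k A]
  [Module.Finite k A] [IsNoetherianRing R] [IsNoetherianRing A]

theorem shortExact_fgInduce (φ : R →ₐ[k] A) {S : ShortComplex (FGModuleCat.{u} R)}
    (hS : S.ShortExact) (h : ExtAcyclic ((ModuleCat.restrictScalars φ.toRingHom).obj
      (injectiveCoseparator A)) ((toModule R).obj S.X₃)) : (S.map (fgInduce φ)).ShortExact := by
  have h'' : ((S.map (toModule R)).map (induce φ.toRingHom)).ShortExact :=
    map_shortExact (induceAdj φ.toRingHom) (isCoseparator_injectiveCoseparator A)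
      (shortExact_toModule hS) h
  have h' : ((S.map (fgInduce φ)).map (toModule A)).ShortExact := h''
  exact
    { exact := (ShortComplex.exact_map_iff_of_faithful _ (toModule A)).1 h'.exact
      mono_f := (toModule A).mono_of_mono_map h'.mono_f
      epi_g := (toModule A).epi_of_epi_map h'.epi_g }

/-- Extension of scalars preserves Gorenstein projective modules if it is exact on them and if
restriction of scalars sends projective modules to modules of finite projective dimension. -/
theorem gproj_fgInduce (φ : R →ₐ[k] A)
    (h : ∀ (P : CochainComplex (FGModuleCat.{u} R) ℤ) (_ : IsTotallyAcyclic P) (n : ℤ),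
      ExtAcyclic ((ModuleCat.restrictScalars φ.toRingHom).obj (injectiveCoseparator A))
        ((toModule R).obj (kernel (P.d n (n + 1)))))
    (h' : ∀ (Q : FGModuleCat.{u} A) [Module.Projective A Q],
      FinPD ((toModule R).obj ((restrict φ).obj Q)))
    {M : FGModuleCat.{u} R} (hM : gproj R M) : gproj A ((fgInduce φ).obj M) := by
  obtain ⟨P, hP, ⟨e⟩⟩ := hM
  have hS (n : ℤ) : ((cycleSequence P n).map (fgInduce φ)).ShortExact :=
    shortExact_fgInduce φ (cycleSequence_shortExact hP.acyclic n) (h P hP (n + 1))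
  obtain ⟨e'⟩ := exists_iso_kernel_mapHomologicalComplex (fgInduce φ) hS 0
  refine ⟨((fgInduce φ).mapHomologicalComplex (ComplexShape.up ℤ)).obj P, ⟨fun n => ?_,
    acyclic_mapHomologicalComplex (fgInduce φ) hS, fun Q hQ i j l hij hjl f hf => ?_⟩,
    ⟨(fgInduce φ).mapIso e ≪≫ e'⟩⟩
  · have := hP.projective n
    exact projective_fgInduce φ (P.X n)
  · exact exists_extension_leftAdjoint (fgInduceAdj φ) (P.d i j) (P.d j l)
      (fun f hf => hP.hom_exact_of_finPD (h' Q) hij hjl f hf) f hf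

variable {φ : R →ₐ[k] A} {π : A →ₐ[k] R} (H : TensorNilpotentSplitting φ π)
include H

theorem TensorNilpotentSplitting.gproj_induce {N : FGModuleCat.{u} R} (hN : gproj R N) :
    gproj A ((fgInduce φ).obj N) := by
  refine gproj_fgInduce φ (fun P hP n => H.extAcyclic_restrict ?_)
    (fun Q _ => H.finPD_restrict_projective Q) hN
  obtain ⟨m, rfl⟩ : ∃ m, n = m + 1 := ⟨n - 1, by lia⟩
  refine (tensorAcyclic_of_sequence H.finPD (S := fun n => (cycleSequence P n).map (toModule R))
    (fun n => shortExact_toModule (cycleSequence_shortExact hP.acyclic n)) (fun n => Iso.refl _)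
    (fun n j => ?_) m 1).1
  have : Module.Projective R ((toModule R).obj (P.X n)) := hP.projective n
  have : Module.Finite R ((toModule R).obj (P.X n)) := (P.X n).property
  exact H.tensorAcyclic_projective j ((toModule R).obj (P.X n))

theorem IsTotallyAcyclic.tensorAcyclic_restrict {P : CochainComplex (FGModuleCat.{u} A) ℤ}
    (hP : IsTotallyAcyclic P) (n : ℤ) (j : ℕ) : TensorAcyclic (quotientBimodule φ) j
      ((toModule R).obj ((restrict φ).obj (kernel (P.d n (n + 1))))) := by
  obtain ⟨m, rfl⟩ : ∃ m, n = m + 1 := ⟨n - 1, by lia⟩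
  refine tensorAcyclic_of_sequence H.finPD
    (S := fun n => ((cycleSequence P n).map (toModule A)).map
      (ModuleCat.restrictScalars φ.toRingHom))
    (fun n => shortExact_restrict φ (cycleSequence_shortExact hP.acyclic n)) (fun n => Iso.refl _)
    (fun n j => ?_) m j
  have : Module.Projective A ((toModule A).obj (P.X n)) := hP.projective n
  have : Module.Finite A ((toModule A).obj (P.X n)) := (P.X n).property
  exact (H.restrict_projective ((toModule A).obj (P.X n))).2 j

theorem gproj.tensorAcyclic_restrict {M : FGModuleCat.{u} A} (hM : gproj A M) (j : ℕ) :
    TensorAcyclic (quotientBimodule φ) j ((toModule R).obj ((restrict φ).obj M)) := by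
  obtain ⟨P, hP, ⟨e⟩⟩ := hM
  exact (hP.tensorAcyclic_restrict H 0 j).of_iso ((restrict φ ⋙ toModule R).mapIso e)

/-- Modules induced from `R` are acyclic with respect to injective modules over `R`. -/
theorem TensorNilpotentSplitting.extAcyclic_induce {N : ModuleCat.{u} R}
    (hN : ExtAcyclic (dualModule (quotientBimodule φ)) N) :
    ExtAcyclic ((ModuleCat.restrictScalars π.toRingHom).obj (injectiveCoseparator R))
      ((induce φ.toRingHom).obj N) := by
  -- As `π ∘ φ` is the identity, restricting along `φ` returns the injective `R`-module itself.
  have h : (ModuleCat.restrictScalars φ.toRingHom).obj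
      ((ModuleCat.restrictScalars π.toRingHom).obj (injectiveCoseparator R)) ≅
      injectiveCoseparator R :=
    ((ModuleCat.restrictScalarsComp φ.toRingHom π.toRingHom).symm.app _) ≪≫
      (ModuleCat.restrictScalarsId' (π.toRingHom.comp φ.toRingHom)
        (RingHom.ext H.split)).app _
  exact ExtAcyclic.leftAdjoint (induceAdj φ.toRingHom) (isCoseparator_injectiveCoseparator A)
    (Injective.of_iso h.symm inferInstance) (H.extAcyclic_restrict hN)

/-- Iterating the counit resolves `M` by modules induced from `R`, which are acyclic for the
coefficient module. The kernel is zero after `n` steps, as it restricts to `V^{⊗ n} ⊗_R M`. -/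
theorem TensorNilpotentSplitting.ext_subsingleton_of_tensorAcyclic (n : ℕ) (M : ModuleCat.{u} A)
    (hM : TensorAcyclic (quotientBimodule φ) n ((ModuleCat.restrictScalars φ.toRingHom).obj M))
    (hn : IsZero ((tensorIterate (quotientBimodule φ) n).obj
      ((ModuleCat.restrictScalars φ.toRingHom).obj M))) (i : ℕ) :
    Subsingleton (Abelian.Ext M ((ModuleCat.restrictScalars π.toRingHom).obj
      (injectiveCoseparator R)) (i + 1 + n)) := by
  induction n generalizing M with
  | zero =>
    have : Subsingleton ((ModuleCat.restrictScalars φ.toRingHom).obj M) :=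
      ModuleCat.subsingleton_of_isZero hn
    have : Subsingleton M := this
    exact ExtAcyclic.of_isZero (ModuleCat.isZero_of_subsingleton M) i
  | succ n ih =>
    obtain ⟨e⟩ := H.exists_iso_restrict_kernel M
    have hK := ih (counitSequence φ.toRingHom M).X₁ (hM.2.of_iso e)
      (hn.of_iso ((tensorIterate (quotientBimodule φ) n).mapIso e))
    exact ext_subsingleton_X₃ (counitSequence_shortExact φ.toRingHom M) hK
      (H.extAcyclic_induce hM.1 (i + 1 + n))

/-- The dual form of the vanishing of `Tor^A(R, -)` on cycles, which makes `R ⊗_A -` exact on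
Gorenstein projectives. Nilpotency bounds the degree and the two-sided complex removes the bound. -/
theorem IsTotallyAcyclic.extAcyclic {P : CochainComplex (FGModuleCat.{u} A) ℤ}
    (hP : IsTotallyAcyclic P) (n : ℤ) :
    ExtAcyclic ((ModuleCat.restrictScalars π.toRingHom).obj (injectiveCoseparator R))
      ((toModule A).obj (kernel (P.d n (n + 1)))) := by
  obtain ⟨m, rfl⟩ : ∃ m, n = m + 1 := ⟨n - 1, by lia⟩
  obtain ⟨p, hp⟩ := H.nilpotent
  refine extAcyclic_of_sequence (S := fun n => (cycleSequence P n).map (toModule A))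
    (fun n => shortExact_toModule (cycleSequence_shortExact hP.acyclic n)) (fun n => Iso.refl _)
    (fun n => ?_) p (fun n i => ?_) m
  · have := hP.projective n
    have := projective_toModule_obj (P.X n)
    exact .of_projective _ ((toModule A).obj (P.X n))
  · have : Module.Finite R ((toModule R).obj ((restrict φ).obj
      (kernel (P.d (n + 1) (n + 1 + 1))))) := ((restrict φ).obj _).property
    exact H.ext_subsingleton_of_tensorAcyclic p _ (hP.tensorAcyclic_restrict H (n + 1) p)
      (isZero_tensorIterate hp ((toModule R).obj ((restrict φ).obj
        (kernel (P.d (n + 1) (n + 1 + 1)))))) i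

theorem gproj.extAcyclic {M : FGModuleCat.{u} A} (hM : gproj A M) :
    ExtAcyclic ((ModuleCat.restrictScalars π.toRingHom).obj (injectiveCoseparator R))
      ((toModule A).obj M) := by
  obtain ⟨P, hP, ⟨e⟩⟩ := hM
  exact (hP.extAcyclic H 0).of_iso ((toModule A).mapIso e)

variable [Module.Finite k R]

theorem TensorNilpotentSplitting.gproj_induce_section {M : FGModuleCat.{u} A} (hM : gproj A M) :
    gproj R ((fgInduce π).obj M) :=
  gproj_fgInduce π (fun P hP n => hP.extAcyclic H n)
    (fun Q _ => H.finPD_restrict_section_projective Q) hM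

end GorensteinProjective

/-! ### Composing the two extensions of scalars. -/

section Adjunctions

universe v₁ u₁ v₂ u₂

variable {C : Type u₁} [Category.{v₁} C] {D : Type u₂} [Category.{v₂} D]
  {F₁ : C ⥤ D} {G₁ : D ⥤ C} (adj₁ : F₁ ⊣ G₁) {F₂ : D ⥤ C} {G₂ : C ⥤ D} (adj₂ : F₂ ⊣ G₂)
  (ρ : G₂ ⋙ G₁ ≅ 𝟭 C)

/-- The composition of the left adjoints is the identity if that of the right adjoints is. -/
def leftAdjointIsoId : 𝟭 C ≅ F₁ ⋙ F₂ :=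
  Adjunction.leftAdjointUniq Adjunction.id ((adj₁.comp adj₂).ofNatIsoRight ρ)

theorem leftAdjointIsoId_hom_app (X : C) : (leftAdjointIsoId adj₁ adj₂ ρ).hom.app X =
    adj₁.unit.app X ≫ G₁.map (adj₂.unit.app (F₁.obj X)) ≫ ρ.hom.app (F₂.obj (F₁.obj X)) := by
  have h := Adjunction.unit_leftAdjointUniq_hom_app Adjunction.id
    ((adj₁.comp adj₂).ofNatIsoRight ρ) X
  refine ((Category.id_comp _).symm.trans h).trans ?_
  rw [← Adjunction.homEquiv_id, Adjunction.homEquiv_ofNatIsoRight_apply, Adjunction.homEquiv_id,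
    Adjunction.comp_unit_app, Category.assoc]
  rfl

/-- Under `M ≅ R ⊗_A (A ⊗_R M)`, the image of the counit `A ⊗_R M → M` is the unit `M → R ⊗_A M`
restricted to `R`. -/
theorem leftAdjointIsoId_hom_app_comp (Y : D) :
    (leftAdjointIsoId adj₁ adj₂ ρ).hom.app (G₁.obj Y) ≫ F₂.map (adj₁.counit.app Y) =
      G₁.map (adj₂.unit.app Y) ≫ ρ.hom.app (F₂.obj Y) := by
  have h₁ := ρ.hom.naturality (F₂.map (adj₁.counit.app Y))
  have h₂ := congrArg G₁.map (adj₂.unit.naturality (adj₁.counit.app Y))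
  dsimp at h₁ h₂
  rw [G₁.map_comp, G₁.map_comp] at h₂
  rw [leftAdjointIsoId_hom_app, Category.assoc, Category.assoc, ← h₁, ← reassoc_of% h₂]
  exact adj₁.right_triangle_components_assoc Y _

end Adjunctions

/-! ### The stable equivalence. -/

section StableCategory

variable {R : Type u} [Ring R] [IsNoetherianRing R]

instance : Congruence (stableRel R) where
  comp_left := by
    rintro X Y Z f g g' ⟨P, hP, a, b, h⟩
    refine ⟨P, hP, f.hom ≫ a, b, ?_⟩
    rw [Category.assoc, ← h]
    exact (Preadditive.comp_sub _ _ _).symm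
  comp_right := by
    rintro X Y Z f f' g ⟨P, hP, a, b, h⟩
    refine ⟨P, hP, a, b ≫ g.hom, ?_⟩
    rw [← Category.assoc, ← h]
    exact (Preadditive.sub_comp _ _ _).symm
  equivalence :=
    { refl := fun f => ⟨0, module_projective_of_isZero (isZero_zero _), 0, 0, by simp⟩
      symm := by
        rintro f g ⟨P, hP, a, b, h⟩
        exact ⟨P, hP, -a, b, by rw [Preadditive.neg_comp, ← h, neg_sub]⟩
      trans := by
        rintro f g h ⟨P, hP, a, b, e⟩ ⟨P', hP', a', b', e'⟩
        refine ⟨P ⊞ P', module_projective_biprod P P', biprod.lift a a', biprod.desc b b', ?_⟩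
        rw [biprod.lift_desc, ← e, ← e', sub_add_sub_cancel] }

end StableCategory

section StableEquivalence

variable {k : Type w} [Field k] {R A : Type u} [Ring R] [Ring A] [Algebra k R] [Algebra k A]
  [Module.Finite k R] [Module.Finite k A] [IsNoetherianRing R] [IsNoetherianRing A]
  {φ : R →ₐ[k] A} {π : A →ₐ[k] R} (H : TensorNilpotentSplitting φ π)

include H

/-- Apply `R ⊗_A -` to `0 → K → A ⊗_R M → M → 0`. The sequence stays exact by acyclicity of `M`, its
middle term is `M` over `R`, and its epimorphism is the restricted unit. The kernel `R ⊗_A K` has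
finite projective dimension because `K` does and is acyclic. -/
theorem gproj.finPD_restrict_kernel_unit {M : FGModuleCat.{u} A} (hM : gproj A M) :
    Epi ((fgInduceAdj π).unit.app M) ∧ FinPD ((toModule R).obj
      ((restrict φ).obj (kernel ((fgInduceAdj π).unit.app M)))) := by
  obtain ⟨p, hp⟩ := H.nilpotent
  let c := (fgInduceAdj φ).counit.app M
  let u := (fgInduceAdj π).unit.app M
  obtain ⟨hc, hK⟩ := H.finPD_kernel hp (hM.tensorAcyclic_restrict H (p + 1)) c
    ((congrArg IsIso ((fgInduceAdj φ).right_triangle_components M)).mpr (IsIso.id _))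
  let S := ShortComplex.mk (kernel.ι c) c (kernel.condition c)
  have hS : S.ShortExact := { exact := ShortComplex.exact_kernel _ }
  have hI : (S.map (fgInduce π)).ShortExact := shortExact_fgInduce π hS (hM.extAcyclic H)
  have hfin : FinPD ((toModule R).obj ((fgInduce π).obj (kernel c))) := by
    obtain ⟨n, hn⟩ := hK
    exact ⟨n, hasProjectiveDimensionLT_leftAdjoint (induceAdj π.toRingHom)
      (isCoseparator_injectiveCoseparator R) n _ (.X₁ (shortExact_toModule hS)
        (H.extAcyclic_induce (hM.tensorAcyclic_restrict H 1).1) (hM.extAcyclic H)) hn⟩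
  have hcomm := leftAdjointIsoId_hom_app_comp (fgInduceAdj φ) (fgInduceAdj π)
    (restrictSectionIso H.split) M
  let e := (leftAdjointIsoId (fgInduceAdj φ) (fgInduceAdj π)
    (restrictSectionIso H.split)).app ((restrict φ).obj M)
  let e' := (restrictSectionIso H.split).app ((fgInduce π).obj M)
  have hcomm' : (restrict φ).map u ≫ e'.hom = e.hom ≫ (fgInduce π).map c := hcomm.symm
  have hepi : Epi ((restrict φ).map u) := by
    have : Epi ((fgInduce π).map c) := hI.epi_g
    have : Epi ((restrict φ).map u ≫ e'.hom) := by
      rw [hcomm']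
      infer_instance
    have h : (restrict φ).map u = ((restrict φ).map u ≫ e'.hom) ≫ e'.inv := by simp
    rw [h]
    infer_instance
  have := hI.mono_f
  let e₁ : (restrict φ).obj (kernel u) ≅ (fgInduce π).obj (kernel c) :=
    PreservesKernel.iso (restrict φ) u ≪≫ kernel.mapIso _ _ e e' hcomm' ≪≫
      (limit.isLimit _).conePointUniqueUpToIso hI.exact.fIsKernel
  exact ⟨(restrict φ).epi_of_epi_map hepi, hfin.of_iso ((toModule R).mapIso e₁)⟩

theorem gproj.finPD_kernel_unit {M : FGModuleCat.{u} A} (hM : gproj A M) :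
    FinPD ((toModule A).obj (kernel ((fgInduceAdj π).unit.app M))) :=
  H.finPD_of_restrict _ (hM.finPD_restrict_kernel_unit H).2

/-- The adjunct of `f` lifts along the unit of `M'`, an epimorphism whose kernel has finite
projective dimension. -/
theorem gproj.exists_fgInduce_map_eq {M M' : FGModuleCat.{u} A} (hM : gproj A M) (hM' : gproj A M')
    (f : (fgInduce π).obj M ⟶ (fgInduce π).obj M') : ∃ g : M ⟶ M', (fgInduce π).map g = f := by
  have := (hM'.finPD_restrict_kernel_unit H).1
  obtain ⟨g, hg⟩ := hM.exists_lift ((fgInduceAdj π).unit.app M') (hM'.finPD_kernel_unit H)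
    ((fgInduceAdj π).homEquiv _ _ f)
  refine ⟨g, ((fgInduceAdj π).homEquiv _ _).injective (Eq.trans ?_ hg)⟩
  exact ((fgInduceAdj π).homEquiv_unit ..).trans ((fgInduceAdj π).unit.naturality g).symm

/-- Maps between Gorenstein projective modules factor through a projective module if this holds
after extension of scalars. -/
theorem gproj.exists_factorization {M M' : FGModuleCat.{u} A} (hM : gproj A M) (hM' : gproj A M')
    (g : M ⟶ M') {Q : FGModuleCat.{u} R} [Module.Projective R Q] (a : (fgInduce π).obj M ⟶ Q)
    (b : Q ⟶ (fgInduce π).obj M') (h : (fgInduce π).map g = a ≫ b) :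
    ∃ (P : FGModuleCat.{u} A) (_ : Module.Projective A P) (a' : M ⟶ P) (b' : P ⟶ M'),
      g = a' ≫ b' := by
  have := (hM'.finPD_restrict_kernel_unit H).1
  obtain ⟨P, hP, ι, hι⟩ := hM.exists_extension
  have := projective_of_module P
  let u' : M' ⟶ (restrict π).obj ((fgInduce π).obj M') := (fgInduceAdj π).unit.app M'
  have hu : g ≫ u' = (fgInduceAdj π).homEquiv _ _ a ≫ (restrict π).map b := by
    rw [← Adjunction.homEquiv_naturality_right, ← h]
    exact ((fgInduceAdj π).unit.naturality g).trans ((fgInduceAdj π).homEquiv_unit ..).symm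
  -- Through `π` the projective `Q` has finite projective dimension over `A`, so the adjunct of `a`
  -- extends over `ι`.
  obtain ⟨a', ha'⟩ := hι (H.finPD_restrict_section_projective Q) ((fgInduceAdj π).homEquiv _ _ a)
  let c : P ⟶ M' := Projective.factorThru (a' ≫ (restrict π).map b) u'
  have hc : c ≫ u' = a' ≫ (restrict π).map b := Projective.factorThru_comp _ _
  have h0 : (g - ι ≫ c) ≫ u' = 0 := by
    rw [Preadditive.sub_comp, hu, Category.assoc, hc, reassoc_of% ha', sub_self]
  -- What remains of `g` takes values in the kernel of the unit, again of finite projective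
  -- dimension, so it factors through the same `ι`.
  obtain ⟨d, hd⟩ := hι (hM'.finPD_kernel_unit H) (kernel.lift u' _ h0)
  refine ⟨P, hP, ι, c + d ≫ kernel.ι u', ?_⟩
  rw [Preadditive.comp_add, reassoc_of% hd, kernel.lift_ι, add_sub_cancel]

/-- Extension of scalars `Gproj A ⥤ Gproj R`. -/
abbrev TensorNilpotentSplitting.gprojInduce : Gproj A ⥤ Gproj R :=
  (gproj R).lift ((gproj A).ι ⋙ fgInduce π) (fun M => H.gproj_induce_section M.property)

/-- Extension of scalars on the stable categories of Gorenstein projective modules. -/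
def TensorNilpotentSplitting.stableInduce : StableGproj A ⥤ StableGproj R :=
  CategoryTheory.Quotient.lift (stableRel A)
    (H.gprojInduce ⋙ CategoryTheory.Quotient.functor (stableRel R)) (by
      rintro X Y f g ⟨P, _, a, b, h⟩
      refine CategoryTheory.Quotient.sound _ ⟨(fgInduce π).obj P, projective_fgInduce π P,
        (fgInduce π).map a, (fgInduce π).map b, ?_⟩
      rw [← CategoryTheory.Functor.map_comp, ← h]
      exact (Functor.map_sub (fgInduce π)).symm)

theorem TensorNilpotentSplitting.stableInduce_isEquivalence :
    H.stableInduce.IsEquivalence where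
  faithful := ⟨by
    intro X Y f g h
    obtain ⟨f, rfl⟩ := (CategoryTheory.Quotient.functor (stableRel A)).map_surjective f
    obtain ⟨g, rfl⟩ := (CategoryTheory.Quotient.functor (stableRel A)).map_surjective g
    have h' : (CategoryTheory.Quotient.functor (stableRel R)).map (H.gprojInduce.map f) =
      (CategoryTheory.Quotient.functor (stableRel R)).map (H.gprojInduce.map g) := h
    obtain ⟨Q, _, a, b, hab⟩ := (CategoryTheory.Quotient.functor_map_eq_iff _ _ _).1 h'
    exact CategoryTheory.Quotient.sound _ (X.as.property.exists_factorization H Y.as.property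
      (f.hom - g.hom) a b ((Functor.map_sub (fgInduce π)).trans hab))⟩
  full := ⟨by
    intro X Y f
    obtain ⟨f, rfl⟩ := (CategoryTheory.Quotient.functor (stableRel R)).map_surjective
      (X := H.gprojInduce.obj X.as) (Y := H.gprojInduce.obj Y.as) f
    obtain ⟨g, hg⟩ := X.as.property.exists_fgInduce_map_eq H Y.as.property f.hom
    exact ⟨(CategoryTheory.Quotient.functor (stableRel A)).map (ObjectProperty.homMk g),
      congrArg (CategoryTheory.Quotient.functor (stableRel R)).map (ObjectProperty.hom_ext _ hg)⟩⟩
  essSurj := ⟨fun Y =>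
    ⟨(CategoryTheory.Quotient.functor (stableRel A)).obj
      ⟨(fgInduce φ).obj Y.as.obj, H.gproj_induce Y.as.property⟩,
      ⟨(CategoryTheory.Quotient.functor (stableRel R)).mapIso
        ((gproj R).isoMk ((leftAdjointIsoId (fgInduceAdj φ) (fgInduceAdj π)
          (restrictSectionIso H.split)).symm.app Y.as.obj))⟩⟩⟩

variable [HasDerivedCategory.{w₁} (FGModuleCat.{u} R)] [HasDerivedCategory.{w₂} (FGModuleCat.{u} A)]

/-- The natural map from restriction along `R → A` to extension along `A → R`. -/
def TensorNilpotentSplitting.restrictToInduce : restrict φ ⟶ fgInduce π :=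
  Functor.whiskerRight (fgInduceAdj π).unit (restrict φ) ≫
    Functor.whiskerLeft (fgInduce π) (restrictSectionIso H.split).hom

/-- The singular equivalence is restriction while the stable one is `R ⊗_A -`; they agree because
the restricted unit is onto with a kernel that is perfect over `R`. -/
theorem TensorNilpotentSplitting.isIso_restrictToInduce {M : FGModuleCat.{u} A} (hM : gproj A M) :
    IsIso ((toDsg R).map ((stalk R).map (H.restrictToInduce.app M))) := by
  obtain ⟨_, h⟩ := hM.finPD_restrict_kernel_unit H
  let u := (fgInduceAdj π).unit.app M
  let S := ShortComplex.mk (kernel.ι u) u (kernel.condition u)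
  have hS : S.ShortExact := { exact := ShortComplex.exact_kernel _ }
  have h₁ : IsIso ((toDsg R).map ((stalk R).map ((restrict φ).map u))) :=
    isIso_toDsg_map (S := S.map (restrict φ)) (hS.map_of_exact _) h
  have h₂ : H.restrictToInduce.app M = (restrict φ).map u ≫
    (restrictSectionIso H.split).hom.app ((fgInduce π).obj M) := rfl
  rw [h₂, CategoryTheory.Functor.map_comp, CategoryTheory.Functor.map_comp]
  infer_instance

/-- The compatibility of the stable equivalence with the singular equivalence. -/
def TensorNilpotentSplitting.stableToDsgIso :
    stableToDsg A ⋙ H.restrictDsg ≅ H.stableInduce ⋙ stableToDsg R :=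
  CategoryTheory.Quotient.natIsoLift (stableRel A)
    (show (gproj A).ι ⋙ stalk A ⋙ toDsg A ⋙ H.restrictDsg ≅
      (gproj A).ι ⋙ fgInduce π ⋙ stalk R ⋙ toDsg R from
      Functor.isoWhiskerLeft ((gproj A).ι ⋙ stalk A) (verdierMapIso _ _) ≪≫
      Functor.isoWhiskerLeft (gproj A).ι (Functor.isoWhiskerRight (stalkRestrictIso φ) (toDsg R)) ≪≫
      NatIso.ofComponents (fun M =>
        have := H.isIso_restrictToInduce M.property
        asIso ((toDsg R).map ((stalk R).map (H.restrictToInduce.app M.obj))))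
        (fun {M M'} f => by
          have h := H.restrictToInduce.naturality f.hom
          have h' := congrArg (fun g => (toDsg R).map ((stalk R).map g)) h
          simp only [CategoryTheory.Functor.map_comp] at h'
          exact h'))

end StableEquivalence

/-! ### The Gorenstein defect categories. -/

section DefectCategory

variable {k : Type w} [Field k] {R A : Type u} [Ring R] [Ring A] [Algebra k R] [Algebra k A]
  [Module.Finite k R] [Module.Finite k A] [IsNoetherianRing R] [IsNoetherianRing A]
  {φ : R →ₐ[k] A} {π : A →ₐ[k] R} (H : TensorNilpotentSplitting φ π)
  [HasDerivedCategory.{w₁} (FGModuleCat.{u} R)] [HasDerivedCategory.{w₂} (FGModuleCat.{u} A)]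

instance : (gprojImage R).IsStableUnderRetracts :=
  inferInstanceAs ((stableToDsg R).essImage.triangEnvelope.IsStableUnderRetracts)

theorem gprojImage_le {P : ObjectProperty (Dsg R)} [P.IsStableUnderRetracts] [P.IsTriangulated]
    (h : ∀ M, P ((stableToDsg R).obj M)) : gprojImage R ≤ P :=
  (ObjectProperty.triangEnvelope_le_iff _).2 fun X ⟨M, ⟨e⟩⟩ => P.prop_of_iso e (h M)

theorem gprojImage_stableToDsg (M : StableGproj R) : gprojImage R ((stableToDsg R).obj M) :=
  ObjectProperty.le_triangEnvelope _ _ ⟨M, ⟨Iso.refl _⟩⟩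

theorem inverseImage_isStableUnderRetracts {C D : Type*} [Category* C] [Category* D] (F : C ⥤ D)
    (P : ObjectProperty D) [P.IsStableUnderRetracts] :
    (P.inverseImage F).IsStableUnderRetracts where
  of_retract r h := P.prop_of_retract (r.map F) h

include H

theorem TensorNilpotentSplitting.gprojImage_le_inverseImage :
    gprojImage A ≤ (gprojImage R).inverseImage H.restrictDsg := by
  have := inverseImage_isStableUnderRetracts H.restrictDsg (gprojImage R)
  exact gprojImage_le fun M =>
    (gprojImage R).prop_of_iso (H.stableToDsgIso.app M).symm (gprojImage_stableToDsg _)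

/-- By thickness it suffices to pull back stalks of Gorenstein projectives through the
quasi-inverse; up to stable isomorphism these come from Gorenstein projectives over `A`. -/
theorem TensorNilpotentSplitting.inverseImage_le_gprojImage :
    (gprojImage R).inverseImage H.restrictDsg ≤ gprojImage A := by
  have := H.restrictDsg_isEquivalence
  have := H.stableInduce_isEquivalence
  have e (X : Dsg A) : H.sectionDsg.obj (H.restrictDsg.obj X) ≅ X :=
    H.restrictDsg.preimageIso (H.sectionDsgIso.app (H.restrictDsg.obj X))
  have := inverseImage_isStableUnderRetracts H.sectionDsg (gprojImage A)
  have h : gprojImage R ≤ (gprojImage A).inverseImage H.sectionDsg := gprojImage_le fun M =>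
    (gprojImage A).prop_of_iso ((e _).symm ≪≫ H.sectionDsg.mapIso
      (H.stableToDsgIso.app (H.stableInduce.objPreimage M) ≪≫
        (stableToDsg R).mapIso (H.stableInduce.objObjPreimageIso M)))
      (gprojImage_stableToDsg (H.stableInduce.objPreimage M))
  exact fun X hX => (gprojImage A).prop_of_iso (e X) (h _ hX)

end DefectCategory

end

end RingExt

/-! ### The three equivalences together. -/

theorem theorem3p8 {k : Type w} [Field k] {A : Type u} [Ring A] [Algebra k A] [Module.Finite k A]
    (B : Subalgebra k A)
    (projectiveDimension_finite :
      ∃ n : ℕ, HasProjectiveDimensionLE (RingExt.quotientBimodule B.val) n)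
    (tensorPower_zero :
      ∃ p : ℕ, IsZero (RingExt.tensorPower (RingExt.quotientBimodule B.val) p))
    (tor_zero : ∀ i j : ℕ, 1 ≤ i → 1 ≤ j →
      IsZero (RingExt.Tor (RingExt.quotientBimodule B.val) i
        (RingExt.tensorPower (RingExt.quotientBimodule B.val) j)))
    (split : ∃ π : A →ₐ[k] B, ∀ b : B, π (b : A) = b) :
    have : IsNoetherianRing A := RingExt.isNoetherianRing_of_finite k A
    have : IsNoetherianRing B := RingExt.isNoetherianRing_of_finite k B
    ∀ [HasDerivedCategory.{w₁} (FGModuleCat.{u} A)] [HasDerivedCategory.{w₂} (FGModuleCat.{u} B)],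
      -- the singular equivalence, induced by restriction of scalars
      ∃ (G : RingExt.Dsg A ⥤ RingExt.Dsg B) (_ : G.CommShift ℤ),
        G.IsTriangulated ∧ G.IsEquivalence ∧
        (∃ e : RingExt.toDsg A ⋙ G ≅ RingExt.restrictDb B.val ⋙ RingExt.toDsg B,
          NatTrans.CommShift e.hom ℤ) ∧
        -- it restricts to the stable categories of Gorenstein projective modules
        (∃ E : RingExt.StableGproj A ≌ RingExt.StableGproj B,
          Nonempty (RingExt.stableToDsg A ⋙ G ≅ E.functor ⋙ RingExt.stableToDsg B)) ∧
        -- it induces a triangle equivalence of the Gorenstein defect categories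
        ∃ (H : RingExt.Ddef A ⥤ RingExt.Ddef B) (_ : H.CommShift ℤ),
          H.IsTriangulated ∧ H.IsEquivalence ∧
          ∃ e : RingExt.toDdef A ⋙ H ≅ G ⋙ RingExt.toDdef B, NatTrans.CommShift e.hom ℤ := by

  intro _ _ _ _
  obtain ⟨π, hπ⟩ := split
  have : Module.Finite k B := inferInstanceAs (Module.Finite k (Subalgebra.toSubmodule B))
  have H : RingExt.TensorNilpotentSplitting B.val π :=
    .mk' _ _ hπ projectiveDimension_finite tensorPower_zero tor_zero
  have := H.restrictDsg_isEquivalence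
  have := H.stableInduce_isEquivalence
  exact ⟨H.restrictDsg, inferInstance, inferInstance, inferInstance,
    ⟨RingExt.verdierMapIso _ _, inferInstance⟩,
    ⟨H.stableInduce.asEquivalence, ⟨H.stableToDsgIso⟩⟩,
    RingExt.verdierMap H.restrictDsg H.gprojImage_le_inverseImage, inferInstance, inferInstance,
    RingExt.verdierMap_isEquivalence _ _ H.inverseImage_le_gprojImage,
    RingExt.verdierMapIso _ _, inferInstance⟩
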